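/- **Setting.** Let $M=\mathbb S^2\times\mathbb S^1$, with polar coordinates $r\in[0,2]$, $\theta\in[0,2\pi]$ on $\mathbb S^2$ (poles $r=0$ and $r=2$) and $\xi\in[0,2\pi]$ on $\mathbb S^1$. For $0<\epsilon<1$ put $\Omega_\epsilon=\{\epsilon\le r\le 2-\epsilon\}\subset\mathbb S^2$ and $M_\epsilon=\Omega_\epsilon\times\mathbb S^1$, and let $\mathring M=\{0<r<2\}\subset M$. Let $V_0\in\mathbb R$, $A_0>0$, and for $i\in\mathbb N$ let $$g_i=\varphi_i^{-2}\,(dr^2+u_i^2\,d\theta^2)+\varphi_i^2\,d\xi^2,$$ where $0<\varphi_i\in C^\infty(\mathbb S^2)$ and $u_i\in C^\infty([0,2])$ satisfies $u_i>0$ on $(0,2)$, $u_i(0)=u_i(2)=0$, $u_i'(0)=1$, $u_i'(2)=-1$. Assume that for all $i$ $$\mathrm{Scalar}_{g_i}\ge 0,\qquad \mathrm{Vol}_{g_i}(M)\le V_0,\qquad \mathrm{MinA}(M,g_i)\ge A_0,$$ where $\mathrm{MinA}$ is the infimum of the areas of the closed embedded minimal surfaces. **Lee–LeFloch scalar curvature.**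 Let $g_0$ be the standard product metric $g_0=dr^2+\left(\tfrac2\pi\sin\tfrac{\pi r}2\right)^2d\theta^2+d\xi^2$ on $M$, with Levi-Civita connection $\bar\nabla$ and Ricci tensor $\bar R_{ij}$. For a metric tensor $g\in L^\infty_{loc}\cap W^{1,2}_{loc}$ with $g^{-1}\in L^\infty_{loc}$ put (with weak derivatives) $$\Gamma_{ij}^k=\tfrac12 g^{kl}(\bar\nabla_i g_{jl}+\bar\nabla_j g_{il}-\bar\nabla_l g_{ij}),\qquad V^k=g^{ij}\Gamma_{ij}^k-g^{ik}\Gamma_{ji}^j,$$ $$F=g^{ij}\bar R_{ij}-\bar\nabla_k g^{ij}\,\Gamma_{ij}^k+\bar\nabla_k g^{ik}\,\Gamma_{ji}^j+g^{ij}(\Gamma_{kl}^k\Gamma_{ij}^l-\Gamma_{jl}^k\Gamma_{ik}^l),$$ and for $v\in C^\infty(M)$ $$J_g(v)=-V\cdot\bar\nabla\!\left(v\,\frac{d\mu_g}{d\mu_0}\right)+F\,v\,\frac{d\mu_g}{d\mu_0}.$$ For a metric $g$ of this regularity on $\mathring M$, the pairing over all of $M$ is $$\langle R_g,v\rangle=\liminf_{\epsilon\to0^+}\int_{M_\epsilon}J_g(v)\,d\mu_0\in[-\infty,\infty].$$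 **Theorem.** There are a subsequence $(i_k)$ and functions $u_\infty$, $\varphi_\infty$ such that $$(*)\qquad u_{i_k}\to u_\infty \text{ uniformly on }[0,2],\qquad \varphi_{i_k}\to\varphi_\infty\text{ uniformly on }\Omega_\epsilon\text{ for every }0<\epsilon<1 .$$ Moreover, for every subsequence and every $u_\infty,\varphi_\infty$ satisfying $(*)$, the limit metric $$g_\infty=\varphi_\infty^{-2}\,(dr^2+u_\infty^2\,d\theta^2)+\varphi_\infty^2\,d\xi^2$$ has nonnegative scalar curvature on all of $M=\mathbb S^2\times\mathbb S^1$ in the distributional sense of Lee–LeFloch. That is: 1. on $\mathring M$, $g_\infty$ is positive definite, of class $L^\infty_{loc}\cap W^{1,2}_{loc}$, and $g_\infty^{-1}\in L^\infty_{loc}$; 2. for every $v\in C^\infty(M)$ and $0<\epsilon<1$, $J_{g_\infty}(v)$ is integrable on $M_\epsilon$; 3. $\langle R_{g_\infty},v\rangle\ge 0$ for every nonnegative $v\in C^\infty(M)$; 4. in particular, $\int_M J_{g_\infty}(v)\,d\mu_0\ge0$ for every nonnegative $v\in C^\infty(M)$ for which $J_{g_\infty}(v)$ is integrable on $M$. 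-/

import Mathlib

open Set Filter Topology MeasureTheory
open scoped Manifold ContDiff ENNReal

namespace WarpedLL

noncomputable section

/-! ### Coordinate Riemannian geometry -/

/-- Points of the coordinate space, with coordinates `x 0 = r`, `x 1 = θ`, `x 2 = ξ`. -/
abbrev Coord := Fin 3 → ℝ

/-- A field of bilinear forms in coordinates: `g x i j = g_{ij}(x)`. -/
abbrev MetricField := Coord → Matrix (Fin 3) (Fin 3) ℝ

/-- The classical partial derivative `∂_i f`. -/
def pd {n : ℕ} (i : Fin n) (f : (Fin n → ℝ) → ℝ) (x : Fin n → ℝ) : ℝ :=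
  fderiv ℝ f x (Pi.single i 1)

/-- Christoffel symbols `Γ^k_{ij}` of a (smooth) metric. -/
def christoffel (g : MetricField) (k i j : Fin 3) (x : Coord) : ℝ :=
  (1 / 2) * ∑ l, (g x)⁻¹ k l *
    (pd i (fun y => g y j l) x + pd j (fun y => g y i l) x - pd l (fun y => g y i j) x)

/-- Ricci tensor
`R_{ij} = ∂_k Γ^k_{ij} - ∂_i Γ^k_{kj} + Γ^l_{ij} Γ^k_{kl} - Γ^l_{kj} Γ^k_{il}` of a (smooth)
metric. -/
def ricci (g : MetricField) (i j : Fin 3) (x : Coord) : ℝ :=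
  ∑ k, (pd k (christoffel g k i j) x - pd i (christoffel g k k j) x
    + ∑ l, (christoffel g l i j x * christoffel g k k l x
      - christoffel g l k j x * christoffel g k i l x))

/-- Scalar curvature `g^{ij} R_{ij}` of a (smooth) metric. -/
def scalarCurvature (g : MetricField) (x : Coord) : ℝ :=
  ∑ i, ∑ j, (g x)⁻¹ i j * ricci g i j x

/-- The Riemannian volume density `√(det g)`. -/
def volDensity (g : MetricField) (x : Coord) : ℝ := Real.sqrt (g x).det

/-! ### The manifold `S² × S¹` and its polar coordinates -/

/-- The two-sphere. -/
abbrev S2 := Metric.sphere (0 : EuclideanSpace ℝ (Fin 3)) 1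

/-- The point of `S²` with polar coordinates `(r, θ)`; the radial parameter `r` runs over
`[0, 2]`, and the poles are `r = 0` and `r = 2`. -/
def spherePt (r θ : ℝ) : S2 :=
  ⟨!₂[Real.sin (Real.pi * r / 2) * Real.cos θ, Real.sin (Real.pi * r / 2) * Real.sin θ,
      Real.cos (Real.pi * r / 2)], by
    have h1 := Real.sin_sq_add_cos_sq θ
    have h2 := Real.sin_sq_add_cos_sq (Real.pi * r / 2)
    rw [mem_sphere_zero_iff_norm, EuclideanSpace.norm_eq, Real.sqrt_eq_one]
    simp [Fin.sum_univ_three]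
    linear_combination (Real.sin (Real.pi * r / 2)) ^ 2 * h1 + h2⟩

/-- The polar coordinate map into `S² × S¹`. -/
def polar (x : Coord) : S2 × Circle := (spherePt (x 0) (x 1), Circle.exp (x 2))

/-- The coordinate domain `(0,2) × ℝ × ℝ`, on which `polar` is a local diffeomorphism onto the
complement of the two polar circles. -/
def polarDomain : Set Coord := {x | x 0 ∈ Ioo (0 : ℝ) 2}

/-- A fundamental box for the complement of the two polar circles (up to measure zero). -/
def box : Set Coord :=
  {x | x 0 ∈ Ioo (0 : ℝ) 2 ∧ x 1 ∈ Icc (0 : ℝ) (2 * Real.pi) ∧ x 2 ∈ Icc (0 : ℝ) (2 * Real.pi)}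

/-- A fundamental box for `M_ε = Ω_ε × S¹`, the part of `S² × S¹` with `ε ≤ r ≤ 2 - ε`. -/
def boxEps (ε : ℝ) : Set Coord :=
  {x | x 0 ∈ Icc ε (2 - ε) ∧ x 1 ∈ Icc (0 : ℝ) (2 * Real.pi) ∧ x 2 ∈ Icc (0 : ℝ) (2 * Real.pi)}

/-- The region `Ω_ε = {ε ≤ r ≤ 2 - ε}` of the two-sphere. -/
def Omega (ε : ℝ) : Set S2 := {p | ∃ r ∈ Icc ε (2 - ε), ∃ θ : ℝ, p = spherePt r θ}

/-- The metric `φ⁻² (dr² + u² dθ²) + φ² dξ²` in polar coordinates. -/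
def warpedMetric (u : ℝ → ℝ) (φ : S2 → ℝ) : MetricField := fun x =>
  Matrix.diagonal ![(φ (spherePt (x 0) (x 1)) ^ 2)⁻¹,
    u (x 0) ^ 2 * (φ (spherePt (x 0) (x 1)) ^ 2)⁻¹,
    φ (spherePt (x 0) (x 1)) ^ 2]

/-- The standard product metric on `S² × S¹`. The sphere is the round one whose poles are at
distance `2`, in accordance with `r ∈ [0, 2]`. -/
def standardMetric : MetricField := fun x =>
  Matrix.diagonal ![1, (2 / Real.pi * Real.sin (Real.pi * x 0 / 2)) ^ 2, 1]

/-! ### Closed minimal surfaces -/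

/-- Closed (compact, connected, without boundary) smoothly embedded surface in `S² × S¹`: locally
the zero set of a smooth function with nowhere vanishing differential. -/
structure IsClosedSurface (S : Set (S2 × Circle)) : Prop where
  compact : IsCompact S
  connected : IsConnected S
  embedded : ∀ p ∈ S, ∃ N : Set (S2 × Circle), IsOpen N ∧ p ∈ N ∧ ∃ f : S2 × Circle → ℝ,
    ContMDiffOn ((𝓡 2).prod (𝓡 1)) 𝓘(ℝ, ℝ) ∞ f N ∧
    (∀ q ∈ N, mfderiv ((𝓡 2).prod (𝓡 1)) 𝓘(ℝ, ℝ) f q ≠ 0) ∧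
    ∀ q ∈ N, q ∈ S ↔ f q = 0

/-- A smooth immersed patch `X : U → (0,2) × ℝ × ℝ` of the surface `S`, in polar coordinates. -/
structure IsPatch (S : Set (S2 × Circle)) (U : Set (Fin 2 → ℝ)) (X : (Fin 2 → ℝ) → Coord) :
    Prop where
  isOpen : IsOpen U
  smooth : ContDiffOn ℝ ∞ X U
  immersed : ∀ p ∈ U, Function.Injective (fderiv ℝ X p)
  mem_domain : ∀ p ∈ U, X p ∈ polarDomain
  mem_surface : ∀ p ∈ U, polar (X p) ∈ S

/-- `∂_a X^i`. -/
def tangent (X : (Fin 2 → ℝ) → Coord) (a : Fin 2) (p : Fin 2 → ℝ) (i : Fin 3) : ℝ :=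
  pd a (fun q => X q i) p

/-- First fundamental form `G_{ab} = g_{ij} ∂_a X^i ∂_b X^j`. -/
def firstFund (g : MetricField) (X : (Fin 2 → ℝ) → Coord) (p : Fin 2 → ℝ) :
    Matrix (Fin 2) (Fin 2) ℝ :=
  fun a b => ∑ i, ∑ j, g (X p) i j * tangent X a p i * tangent X b p j

/-- `G^{ab} ∇_a ∂_b X`, with `∇` the Levi-Civita connection of `g`. Its normal part is the mean
curvature vector. -/
def tracedHessian (g : MetricField) (X : (Fin 2 → ℝ) → Coord) (p : Fin 2 → ℝ) (k : Fin 3) : ℝ :=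
  ∑ a, ∑ b, (firstFund g X p)⁻¹ a b *
    (pd a (fun q => tangent X b q k) p
      + ∑ i, ∑ j, christoffel g k i j (X p) * tangent X a p i * tangent X b p j)

/-- The mean curvature of the patch `X` vanishes at `p`: `G^{ab} ∇_a ∂_b X` is orthogonal to every
normal vector `ν`. -/
def MeanCurvatureZeroAt (g : MetricField) (X : (Fin 2 → ℝ) → Coord) (p : Fin 2 → ℝ) : Prop :=
  ∀ ν : Fin 3 → ℝ, (∀ a, ∑ i, ∑ j, g (X p) i j * ν i * tangent X a p j = 0) →
    ∑ i, ∑ j, g (X p) i j * ν i * tracedHessian g X p j = 0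

/-- Closed embedded minimal surface. It suffices to test the mean curvature away from the two
polar circles, because they meet a surface in a set without interior points. -/
def IsClosedMinimalSurface (g : MetricField) (S : Set (S2 × Circle)) : Prop :=
  IsClosedSurface S ∧ ∀ U X, IsPatch S U X → ∀ p ∈ U, MeanCurvatureZeroAt g X p

/-- Area of a surface: the supremum of the total area of finitely many embedded patches with
pairwise disjoint images (the two polar circles carry no area). -/
def area (g : MetricField) (S : Set (S2 × Circle)) : ℝ≥0∞ :=
  ⨆ (N : ℕ) (U : Fin N → Set (Fin 2 → ℝ)) (X : Fin N → (Fin 2 → ℝ) → Coord)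
    (_ : ∀ j, IsPatch S (U j) (X j) ∧ InjOn (fun p => polar (X j p)) (U j))
    (_ : Pairwise fun j k => Disjoint ((fun p => polar (X j p)) '' U j)
      ((fun p => polar (X k p)) '' U k)),
    ∑ j, ∫⁻ p in U j, ENNReal.ofReal (Real.sqrt (firstFund g (X j) p).det)

/-- The infimum of the areas of closed minimal surfaces. -/
def MinA (g : MetricField) : ℝ≥0∞ :=
  ⨅ (S : Set (S2 × Circle)) (_ : IsClosedMinimalSurface g S), area g S

/-- The volume of `S² × S¹` (the two polar circles have measure zero). -/
def vol (g : MetricField) : ℝ≥0∞ := ∫⁻ x in box, ENNReal.ofReal (volDensity g x)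

/-! ### The sequences and their limits -/

/-- The warping functions of a metric `φ⁻² (dr² + u² dθ²) + φ² dξ²` on `S² × S¹`, with
`r ∈ [0, 2]`. -/
structure IsWarpingPair (u : ℝ → ℝ) (φ : S2 → ℝ) : Prop where
  u_smooth : ContDiffOn ℝ ∞ u (Icc 0 2)
  u_zero : u 0 = 0
  u_two : u 2 = 0
  deriv_zero : derivWithin u (Icc 0 2) 0 = 1
  deriv_two : derivWithin u (Icc 0 2) 2 = -1
  u_pos : ∀ r ∈ Ioo (0 : ℝ) 2, 0 < u r
  φ_smooth : ContMDiff (𝓡 2) 𝓘(ℝ, ℝ) ∞ φ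
  φ_pos : ∀ p, 0 < φ p

/-- Nonnegative scalar curvature, `Vol ≤ V₀` and `MinA ≥ A₀`. The scalar curvature is tested on
the complement of the two polar circles, which is dense. -/
structure ConditionLambda (V₀ A₀ : ℝ) (g : MetricField) : Prop where
  scalar_nonneg : ∀ x ∈ polarDomain, 0 ≤ scalarCurvature g x
  vol_le : vol g ≤ ENNReal.ofReal V₀
  minA_ge : ENNReal.ofReal A₀ ≤ MinA g

/-- `u_i → u_∞` uniformly on `[0, 2]`, and `φ_i → φ_∞` uniformly on each `Ω_ε`. -/
structure IsWarpingLimit (u : ℕ → ℝ → ℝ) (φ : ℕ → S2 → ℝ) (u' : ℝ → ℝ) (φ' : S2 → ℝ) :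
    Prop where
  u_tendsto : TendstoUniformlyOn u u' atTop (Icc 0 2)
  φ_tendsto : ∀ ε ∈ Ioo (0 : ℝ) 1, TendstoUniformlyOn φ φ' atTop (Omega ε)

/-! ### Weak derivatives and the distributional scalar curvature of Lee and LeFloch -/

/-- `f'` is the weak partial derivative `∂_i f` on the open set `Ω`. -/
structure HasWeakPartial (Ω : Set Coord) (i : Fin 3) (f f' : Coord → ℝ) : Prop where
  locInt : LocallyIntegrableOn f Ω
  locInt' : LocallyIntegrableOn f' Ω
  parts : ∀ ψ : Coord → ℝ, ContDiff ℝ ∞ ψ → HasCompactSupport ψ → tsupport ψ ⊆ Ω →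
    ∫ x in Ω, f x * pd i ψ x = -∫ x in Ω, f' x * ψ x

open Classical in
/-- The weak partial derivative `∂_i f` on `Ω`, defined up to null sets (and `0` if it does not
exist). -/
def weakPartial (Ω : Set Coord) (i : Fin 3) (f : Coord → ℝ) : Coord → ℝ :=
  if h : ∃ f', HasWeakPartial Ω i f f' then h.choose else 0

/-- `f ∈ L^∞_loc(Ω)`. -/
def LocallyEssBounded (Ω : Set Coord) (f : Coord → ℝ) : Prop :=
  ∀ K ⊆ Ω, IsCompact K → MemLp f ⊤ (volume.restrict K)

/-- `g` is a metric tensor of class `L^∞_loc ∩ W^{1,2}_loc` on `Ω`, with locally bounded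
inverse. -/
structure IsLeeLeFlochMetric (Ω : Set Coord) (g : MetricField) : Prop where
  posDef : ∀ x ∈ Ω, (g x).PosDef
  bounded : ∀ i j, LocallyEssBounded Ω (fun x => g x i j)
  inv_bounded : ∀ i j, LocallyEssBounded Ω (fun x => (g x)⁻¹ i j)
  sobolev : ∀ k i j, ∃ w, HasWeakPartial Ω k (fun x => g x i j) w ∧
    ∀ K ⊆ Ω, IsCompact K → MemLp w 2 (volume.restrict K)

section LeeLeFloch

variable (Ω : Set Coord) (g₀ g : MetricField)

/-- `∇̄_i g_{jl}`, with `∇̄` the Levi-Civita connection of the background metric `g₀`. -/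
def covMetric (i j l : Fin 3) (x : Coord) : ℝ :=
  weakPartial Ω i (fun y => g y j l) x
    - ∑ m, (christoffel g₀ m i j x * g x m l + christoffel g₀ m i l x * g x j m)

/-- `∇̄_k g^{ij}`. -/
def covInverse (k i j : Fin 3) (x : Coord) : ℝ :=
  weakPartial Ω k (fun y => (g y)⁻¹ i j) x
    + ∑ m, (christoffel g₀ i k m x * (g x)⁻¹ m j + christoffel g₀ j k m x * (g x)⁻¹ i m)

/-- `Γ^k_{ij} = ½ g^{kl} (∇̄_i g_{jl} + ∇̄_j g_{il} - ∇̄_l g_{ij})`. -/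
def Gam (k i j : Fin 3) (x : Coord) : ℝ :=
  (1 / 2) * ∑ l, (g x)⁻¹ k l *
    (covMetric Ω g₀ g i j l x + covMetric Ω g₀ g j i l x - covMetric Ω g₀ g l i j x)

/-- `V^k = g^{ij} Γ^k_{ij} - g^{ik} Γ^j_{ji}`. -/
def V (k : Fin 3) (x : Coord) : ℝ :=
  ∑ i, ∑ j, ((g x)⁻¹ i j * Gam Ω g₀ g k i j x - (g x)⁻¹ i k * Gam Ω g₀ g j j i x)

/-- `F = R̄ - ∇̄_k g^{ij} Γ^k_{ij} + ∇̄_k g^{ik} Γ^j_{ji}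
  + g^{ij} (Γ^k_{kl} Γ^l_{ij} - Γ^k_{jl} Γ^l_{ik})`, where `R̄ = g^{ij} R̄_{ij}` and `R̄_{ij}` is the
Ricci tensor of `g₀`. -/
def F (x : Coord) : ℝ :=
  (∑ i, ∑ j, (g x)⁻¹ i j * ricci g₀ i j x)
    - (∑ k, ∑ i, ∑ j, covInverse Ω g₀ g k i j x * Gam Ω g₀ g k i j x)
    + (∑ k, ∑ i, ∑ j, covInverse Ω g₀ g k i k x * Gam Ω g₀ g j j i x)
    + ∑ i, ∑ j, (g x)⁻¹ i j * ∑ k, ∑ l,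
        (Gam Ω g₀ g k k l x * Gam Ω g₀ g l i j x - Gam Ω g₀ g k j l x * Gam Ω g₀ g l i k x)

/-- `v dμ_g / dμ_0`. -/
def weighted (v : Coord → ℝ) (x : Coord) : ℝ := v x * (volDensity g x / volDensity g₀ x)

/-- The integrand `(-V · ∇̄(v dμ_g/dμ_0) + F v dμ_g/dμ_0) dμ_0` of the pairing `⟨R_g, v⟩`, as a
density with respect to `dr dθ dξ`. Note that the `g₀`-inner product of `V` with the
`g₀`-gradient of a function `f` is `V^k ∂_k f`. -/
def pairingDensity (v : Coord → ℝ) (x : Coord) : ℝ :=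
  (-(∑ k, V Ω g₀ g k x * weakPartial Ω k (weighted g₀ g v) x)
    + F Ω g₀ g x * weighted g₀ g v x) * volDensity g₀ x

end LeeLeFloch

/-- The integrand of `⟨R_g, v⟩` for a function `v` on `S² × S¹`, in polar coordinates, with the
standard product metric as the background metric. -/
def integrand (g : MetricField) (v : S2 × Circle → ℝ) : Coord → ℝ :=
  pairingDensity polarDomain standardMetric g (fun x => v (polar x))

/-- The pairing `⟨R_g, v⟩` over all of `S² × S¹`, for a metric `g` defined off the two polar
circles: the (lower) limit, in the extended reals, of the integrals over the regions `M_ε` that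
exhaust `S² × S¹` up to the polar circles. -/
def pairing (g : MetricField) (v : S2 × Circle → ℝ) : EReal :=
  liminf (fun ε : ℝ => ((∫ x in boxEps ε, integrand g v x : ℝ) : EReal)) (𝓝[>] (0 : ℝ))

/-- Nonnegative scalar curvature in the distributional sense of Lee and LeFloch on all of
`S² × S¹`, for a metric defined off the two polar circles: there it has the regularity that the
definition of the scalar curvature distribution requires, the integrals over the regions `M_ε`
converge absolutely, and `⟨R_g, v⟩ ≥ 0` for each smooth `v ≥ 0` on `S² × S¹`, both as an exhaustion
limit and, whenever it converges absolutely, as an integral over `S² × S¹`. -/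
structure NonnegDistributionalScalar (g : MetricField) : Prop where
  regular : IsLeeLeFlochMetric polarDomain g
  integrable : ∀ v : S2 × Circle → ℝ, ContMDiff ((𝓡 2).prod (𝓡 1)) 𝓘(ℝ, ℝ) ∞ v →
    ∀ ε ∈ Ioo (0 : ℝ) 1, IntegrableOn (integrand g v) (boxEps ε)
  pairing_nonneg : ∀ v : S2 × Circle → ℝ, ContMDiff ((𝓡 2).prod (𝓡 1)) 𝓘(ℝ, ℝ) ∞ v →
    (∀ p, 0 ≤ v p) → 0 ≤ pairing g v
  integral_nonneg : ∀ v : S2 × Circle → ℝ, ContMDiff ((𝓡 2).prod (𝓡 1)) 𝓘(ℝ, ℝ) ∞ v →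
    (∀ p, 0 ≤ v p) → IntegrableOn (integrand g v) box → 0 ≤ ∫ x in box, integrand g v x

end

end WarpedLL

namespace WarpedLL

noncomputable section

/-! ### Smoothness in polar coordinates -/

/-! Write φ = e^ψ, so that g = e^{-2ψ}(dr² + u² dθ²) + e^{2ψ} dξ². Its scalar curvature is
2e^{2ψ}(-u''/u - |∇ψ|²) with |∇ψ|² = ψ_r² + ψ_θ²/u² (`SmoothPair.scalarCurvature_eq`), so
nonnegativity is the inequality u|∇ψ|² ≤ -u'' (`IsEnergyPair`). It makes u concave with |u'| ≤ 1
and, since ∫ -u'' = 2, bounds a weighted Dirichlet energy of ψ uniformly.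

Two minimal surfaces and the volume exclude degeneration. The torus over a critical circle of u has
area at most 4π²u there, which forces u ≥ m r(2 - r). The sphere S² × {1} is totally geodesic; its
area bounds ψ from above at a base point, and the volume bounds it from below. Since |ψ_r| ≤
√(-u''/u), the arithmetic-geometric mean inequality spreads this to |ψ| ≤ C + |log(r/(2 - r))|/2
(`exists_uniformBounds`). The same argument on thin slabs gives equicontinuity
(`equicontinuousAt_log`), and Arzelà–Ascoli yields the subsequence.

For the limit, u_i' converges almost everywhere by concavity, and ∇ψ_i converges weakly in L²_loc
along a further subsequence. The Lee–LeFloch integrand is a quadratic polynomial in ∇ψ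
(`jetDensity_eq`) whose coefficients converge almost everywhere, boundedly on compact sets, and
whose quadratic part is nonpositive when v ≥ 0. Its integral over M_ε is therefore upper
semicontinuous, and a lower bound common to the sequence survives in the limit
(`IsBoundedLimit.integral_jetDensity_ge`).

Such a bound comes from a divergence identity: for smooth pairs the integrand is v times the scalar
curvature density plus the r-derivative of the flux e^ψ v (2u' - s'(s/u + u/s)), where s is the
radius function of the background sphere (`SmoothPair.jetDensity_eq_pd_flux`). Because |u'| ≤ 1 and
s/u + u/s ≥ 2, the unfavourable boundary flux on M_ε is at most 2e^ψ v(1 - cos(πε/2)), which is O(ε)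
since e^ψ = O(1/ε) there. So the integrals over M_ε are at least -Nε with N independent of i, and ε
→ 0 finishes the proof. -/

theorem contMDiff_spherePt :
    ContMDiff 𝓘(ℝ, Coord) (𝓡 2) ∞ (fun x : Coord => spherePt (x 0) (x 1)) := by
  have h : ContMDiff 𝓘(ℝ, Coord) 𝓘(ℝ, EuclideanSpace ℝ (Fin 3)) ∞
      (fun x : Coord => ((spherePt (x 0) (x 1) : S2) : EuclideanSpace ℝ (Fin 3))) := by
    rw [contMDiff_iff_contDiff, contDiff_euclidean]
    intro i
    fin_cases i <;> simp [spherePt] <;> fun_prop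
  have := Fact.mk (@finrank_euclideanSpace_fin ℝ _ (2 + 1))
  exact ContMDiff.codRestrict_sphere h _

theorem contMDiff_polar :
    ContMDiff 𝓘(ℝ, Coord) ((𝓡 2).prod (𝓡 1)) ∞ polar := by
  refine contMDiff_spherePt.prodMk ?_
  refine contMDiff_circleExp.comp (?_ : ContMDiff 𝓘(ℝ, Coord) 𝓘(ℝ, ℝ) ∞ (fun x : Coord => x 2))
  rw [contMDiff_iff_contDiff]
  fun_prop

/-- A function on the sphere, read in polar coordinates. -/
def polarLift (φ : S2 → ℝ) (x : Coord) : ℝ := φ (spherePt (x 0) (x 1))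

/-- The logarithm of a function on the sphere, read in polar coordinates. -/
def logLift (φ : S2 → ℝ) (x : Coord) : ℝ := Real.log (polarLift φ x)

theorem contDiff_polarLift {φ : S2 → ℝ} (h : ContMDiff (𝓡 2) 𝓘(ℝ, ℝ) ∞ φ) :
    ContDiff ℝ ∞ (polarLift φ) := by
  rw [← contMDiff_iff_contDiff]
  exact h.comp contMDiff_spherePt

theorem contDiff_logLift {φ : S2 → ℝ} (h : ContMDiff (𝓡 2) 𝓘(ℝ, ℝ) ∞ φ) (h0 : ∀ p, 0 < φ p) :
    ContDiff ℝ ∞ (logLift φ) :=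
  (contDiff_polarLift h).log fun _ => (h0 _).ne'

theorem contDiff_comp_polar {v : S2 × Circle → ℝ}
    (h : ContMDiff ((𝓡 2).prod (𝓡 1)) 𝓘(ℝ, ℝ) ∞ v) :
    ContDiff ℝ ∞ (fun x => v (polar x)) := by
  rw [← contMDiff_iff_contDiff]
  exact h.comp contMDiff_polar

theorem exp_logLift {φ : S2 → ℝ} {x : Coord} (h0 : 0 < polarLift φ x) :
    Real.exp (logLift φ x) = polarLift φ x :=
  Real.exp_log h0

theorem spherePt_add_int_mul (r θ : ℝ) (n : ℤ) :
    spherePt r (θ + n * (2 * Real.pi)) = spherePt r θ := by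
  simp [spherePt]

theorem spherePt_radius_inj {r r' θ θ' : ℝ} (hr : r ∈ Icc (0 : ℝ) 2) (hr' : r' ∈ Icc (0 : ℝ) 2)
    (h : spherePt r θ = spherePt r' θ') : r = r' := by
  have h2 : Real.cos (Real.pi * r / 2) = Real.cos (Real.pi * r' / 2) := by
    have := congrArg (fun p : S2 => (p : EuclideanSpace ℝ (Fin 3)) 2) h
    simpa [spherePt] using this
  have hpi := Real.pi_pos
  have := Real.injOn_cos ⟨by nlinarith [hr.1], by nlinarith [hr.2]⟩
    ⟨by nlinarith [hr'.1], by nlinarith [hr'.2]⟩ h2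
  field_simp at this
  exact this

theorem sin_half_pi_pos {r : ℝ} (hr : r ∈ Ioo (0 : ℝ) 2) : 0 < Real.sin (Real.pi * r / 2) :=
  Real.sin_pos_of_pos_of_lt_pi (by have := hr.1; positivity) (by nlinarith [Real.pi_pos, hr.2])

theorem isOpen_polarDomain : IsOpen polarDomain :=
  isOpen_Ioo.preimage (continuous_apply (0 : Fin 3))

theorem boxEps_eq_Icc (ε : ℝ) :
    boxEps ε = Icc ![ε, 0, 0] ![2 - ε, 2 * Real.pi, 2 * Real.pi] := by
  ext x
  simp [boxEps, Pi.le_def, Fin.forall_fin_succ]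
  tauto

theorem isCompact_boxEps (ε : ℝ) : IsCompact (boxEps ε) := by
  rw [boxEps_eq_Icc]; exact isCompact_Icc

theorem boxEps_subset {ε : ℝ} (hε : 0 < ε) : boxEps ε ⊆ polarDomain := fun x hx =>
  ⟨lt_of_lt_of_le hε hx.1.1, lt_of_le_of_lt hx.1.2 (by linarith)⟩

theorem Icc_mem_Ioo {ε r : ℝ} (hε : 0 < ε) (hr : r ∈ Icc ε (2 - ε)) : r ∈ Ioo (0 : ℝ) 2 :=
  ⟨hε.trans_le hr.1, hr.2.trans_lt (by linarith)⟩

/-! ### Partial derivatives -/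

theorem pd_eq_of_hasFDerivAt {n : ℕ} {k : Fin n} {f : (Fin n → ℝ) → ℝ} {x : Fin n → ℝ}
    {L : (Fin n → ℝ) →L[ℝ] ℝ} (h : HasFDerivAt f L x) : pd k f x = L (Pi.single k 1) := by
  rw [pd, h.fderiv]

theorem pd_congr {n : ℕ} {k : Fin n} {f g : (Fin n → ℝ) → ℝ} {x : Fin n → ℝ}
    (h : f =ᶠ[𝓝 x] g) : pd k f x = pd k g x := by
  rw [pd, pd, h.fderiv_eq]

@[simp] theorem pd_const {n : ℕ} (k : Fin n) (c : ℝ) (x : Fin n → ℝ) :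
    pd k (fun _ => c) x = 0 := by simp [pd]

/-- The partial derivative is the derivative along a coordinate line. -/
theorem hasDerivAt_pd {n : ℕ} {f : (Fin n → ℝ) → ℝ} {x : Fin n → ℝ} (k : Fin n)
    (h : DifferentiableAt ℝ f x) :
    HasDerivAt (fun t => f (Function.update x k t)) (pd k f x) (x k) := by
  have h1 : HasDerivAt (Function.update x k) (Pi.single k (1 : ℝ)) (x k) := hasDerivAt_update x k _
  have h2 : HasFDerivAt f (fderiv ℝ f x) (Function.update x k (x k)) := by
    simpa using h.hasFDerivAt
  exact h2.comp_hasDerivAt (x k) h1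

theorem pd_mul {n : ℕ} {k : Fin n} {f g : (Fin n → ℝ) → ℝ} {x : Fin n → ℝ}
    (hf : DifferentiableAt ℝ f x) (hg : DifferentiableAt ℝ g x) :
    pd k (fun y => f y * g y) x = pd k f x * g x + f x * pd k g x := by
  rw [pd_eq_of_hasFDerivAt (f := fun y => f y * g y) (hf.hasFDerivAt.mul hg.hasFDerivAt)]
  simp [pd]; ring

theorem pd_neg {n : ℕ} {k : Fin n} {f : (Fin n → ℝ) → ℝ} {x : Fin n → ℝ} :
    pd k (fun y => -f y) x = -pd k f x := by
  simp [pd]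

theorem pd_add {n : ℕ} {k : Fin n} {f g : (Fin n → ℝ) → ℝ} {x : Fin n → ℝ}
    (hf : DifferentiableAt ℝ f x) (hg : DifferentiableAt ℝ g x) :
    pd k (fun y => f y + g y) x = pd k f x + pd k g x := by
  rw [pd_eq_of_hasFDerivAt (f := fun y => f y + g y) (hf.hasFDerivAt.add hg.hasFDerivAt)]
  simp [pd]

theorem pd_sub {n : ℕ} {k : Fin n} {f g : (Fin n → ℝ) → ℝ} {x : Fin n → ℝ}
    (hf : DifferentiableAt ℝ f x) (hg : DifferentiableAt ℝ g x) :
    pd k (fun y => f y - g y) x = pd k f x - pd k g x := by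
  rw [pd_eq_of_hasFDerivAt (f := fun y => f y - g y) (hf.hasFDerivAt.sub hg.hasFDerivAt)]
  simp [pd]

theorem pd_comp_coord {n : ℕ} {k i : Fin n} {f : ℝ → ℝ} {x : Fin n → ℝ}
    (hf : DifferentiableAt ℝ f (x i)) :
    pd k (fun y => f (y i)) x = if k = i then deriv f (x i) else 0 := by
  have := hf.hasDerivAt.comp_hasFDerivAt x (hasFDerivAt_apply (𝕜 := ℝ) i x)
  rw [pd_eq_of_hasFDerivAt (f := fun y => f (y i)) this]
  by_cases h : k = i
  · subst h; simp
  · simp [h, Ne.symm h]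

theorem pd_exp {n : ℕ} {k : Fin n} {f : (Fin n → ℝ) → ℝ} {x : Fin n → ℝ}
    (hf : DifferentiableAt ℝ f x) :
    pd k (fun y => Real.exp (f y)) x = Real.exp (f x) * pd k f x := by
  rw [pd_eq_of_hasFDerivAt hf.hasFDerivAt.exp]
  simp [pd]

theorem pd_zpow {n : ℕ} {k : Fin n} {f : (Fin n → ℝ) → ℝ} {x : Fin n → ℝ} (m : ℤ)
    (hf : DifferentiableAt ℝ f x) (h0 : f x ≠ 0) :
    pd k (fun y => f y ^ m) x = m * f x ^ (m - 1) * pd k f x := by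
  have := (hasDerivAt_zpow m (f x) (Or.inl h0)).comp_hasFDerivAt x hf.hasFDerivAt
  rw [pd_eq_of_hasFDerivAt (f := fun y => f y ^ m) this]
  simp [pd]

/-- `∂_k u^a` for a function `u` of `r`, written with `u'` supported on `k = 0`. -/
def radial (du : ℝ → ℝ) (k : Fin 3) (x : Coord) : ℝ := if k = 0 then du (x 0) else 0

/-- Product rule for `c u^a e^{bψ}`. -/
theorem pd_monomial {k : Fin 3} {c ψ : Coord → ℝ} {u : ℝ → ℝ} {x : Coord} (a b : ℤ)
    (hc : DifferentiableAt ℝ c x) (hu : DifferentiableAt ℝ u (x 0)) (h0 : u (x 0) ≠ 0)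
    (hψ : DifferentiableAt ℝ ψ x) :
    pd k (fun y => c y * u (y 0) ^ a * Real.exp (ψ y) ^ b) x =
      pd k c x * u (x 0) ^ a * Real.exp (ψ x) ^ b
        + c x * a * u (x 0) ^ (a - 1) * radial (deriv u) k x * Real.exp (ψ x) ^ b
        + c x * u (x 0) ^ a * b * Real.exp (ψ x) ^ b * pd k ψ x := by
  have hu' : DifferentiableAt ℝ (fun y : Coord => u (y 0)) x :=
    hu.comp x (differentiableAt_apply 0 x)
  have hua : DifferentiableAt ℝ (fun y : Coord => u (y 0) ^ a) x :=
    hu'.zpow (Or.inl h0)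
  have he : DifferentiableAt ℝ (fun y : Coord => Real.exp (ψ y) ^ b) x :=
    hψ.exp.zpow (Or.inl (Real.exp_pos _).ne')
  rw [pd_mul (f := fun y => c y * u (y 0) ^ a) (hc.mul hua) he, pd_mul hc hua,
    pd_zpow (f := fun y => u (y 0)) a hu' h0,
    pd_zpow (f := fun y => Real.exp (ψ y)) b hψ.exp (Real.exp_pos _).ne', pd_exp hψ,
    pd_comp_coord hu]
  have : Real.exp (ψ x) ^ b = Real.exp (ψ x) ^ (b - 1) * Real.exp (ψ x) := by
    rw [← zpow_add_one₀ (Real.exp_pos _).ne']; simp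
  rw [this, radial]
  ring

/-! ### The metrics `e^{-2ψ} (dr² + u² dθ²) + e^{2ψ} dξ²` -/

/-- Exponents of `u` in the diagonal metric components. -/
def uExp : Fin 3 → ℤ := ![0, 2, 0]

/-- Exponents of `e^ψ` in the diagonal metric components. -/
def eExp : Fin 3 → ℤ := ![-2, -2, 2]

/-- The metric `e^{-2ψ} (dr² + u² dθ²) + e^{2ψ} dξ²`. -/
def logMetric (u : ℝ → ℝ) (ψ : Coord → ℝ) : MetricField := fun x =>
  Matrix.diagonal fun i => u (x 0) ^ uExp i * Real.exp (ψ x) ^ eExp i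

/-- The inverse metric. -/
def logMetricInv (u : ℝ → ℝ) (ψ : Coord → ℝ) : MetricField := fun x =>
  Matrix.diagonal fun i => u (x 0) ^ (-uExp i) * Real.exp (ψ x) ^ (-eExp i)

theorem logMetric_inv {u : ℝ → ℝ} {ψ : Coord → ℝ} {x : Coord} (h0 : u (x 0) ≠ 0) :
    (logMetric u ψ x)⁻¹ = logMetricInv u ψ x := by
  apply Matrix.inv_eq_right_inv
  rw [logMetric, logMetricInv, Matrix.diagonal_mul_diagonal, ← Matrix.diagonal_one]
  congr 1
  funext i
  have he := (Real.exp_pos (ψ x)).ne'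
  rw [zpow_neg, zpow_neg]
  have h1 : u (x 0) ^ uExp i ≠ 0 := zpow_ne_zero _ h0
  have h2 : Real.exp (ψ x) ^ eExp i ≠ 0 := zpow_ne_zero _ he
  field_simp

theorem warpedMetric_eq {u : ℝ → ℝ} {φ : S2 → ℝ} {x : Coord} (h : 0 < polarLift φ x) :
    warpedMetric u φ x = logMetric u (logLift φ) x := by
  rw [warpedMetric, logMetric]
  congr 1
  rw [exp_logLift h]
  funext i
  fin_cases i <;> simp [uExp, eExp, polarLift, zpow_ofNat, zpow_neg]

/-- The radius of the circles of latitude of the standard sphere. -/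
def stdRadius (r : ℝ) : ℝ := 2 / Real.pi * Real.sin (Real.pi * r / 2)

theorem standardMetric_eq : standardMetric = logMetric stdRadius (fun _ => 0) := by
  funext x
  rw [standardMetric, logMetric]
  congr 1
  funext i
  fin_cases i <;> simp [uExp, stdRadius, zpow_ofNat]

/-- A radius function and a function on the sphere in polar coordinates, both smooth. -/
structure SmoothPair (u : ℝ → ℝ) (ψ : Coord → ℝ) : Prop where
  u_smooth : ContDiffOn ℝ ∞ u (Ioo 0 2)
  u_pos : ∀ r ∈ Ioo (0 : ℝ) 2, 0 < u r
  ψ_smooth : ContDiff ℝ ∞ ψ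
  ψ_axial : ∀ x, pd 2 ψ x = 0

theorem contDiff_pd {n : ℕ} {f : (Fin n → ℝ) → ℝ} (h : ContDiff ℝ ∞ f) (k : Fin n) :
    ContDiff ℝ ∞ (pd k f) :=
  (h.fderiv_right (m := ∞) (by simp)).clm_apply contDiff_const

namespace SmoothPair

variable {u : ℝ → ℝ} {ψ : Coord → ℝ} (h : SmoothPair u ψ)
include h

theorem u_diff {r : ℝ} (hr : r ∈ Ioo (0 : ℝ) 2) : DifferentiableAt ℝ u r :=
  (h.u_smooth.contDiffAt (isOpen_Ioo.mem_nhds hr)).differentiableAt (by simp)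

theorem deriv_smooth : ContDiffOn ℝ ∞ (deriv u) (Ioo 0 2) :=
  h.u_smooth.deriv_of_isOpen isOpen_Ioo (by simp)

theorem du_diff {r : ℝ} (hr : r ∈ Ioo (0 : ℝ) 2) : DifferentiableAt ℝ (deriv u) r :=
  (h.deriv_smooth.contDiffAt (isOpen_Ioo.mem_nhds hr)).differentiableAt (by simp)

theorem ψ_diff (x : Coord) : DifferentiableAt ℝ ψ x :=
  h.ψ_smooth.differentiable (by simp) x

theorem pd_diff (k : Fin 3) (x : Coord) : DifferentiableAt ℝ (pd k ψ) x :=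
  (contDiff_pd h.ψ_smooth k).differentiable (by simp) x

end SmoothPair

/-- The partial derivative `∂_k (u^a e^{bψ})` in terms of those of `u` and `ψ`. -/
def monoDeriv (a b : ℤ) (u du E : ℝ) (P : Fin 3 → ℝ) (k : Fin 3) : ℝ :=
  a * u ^ (a - 1) * (if k = 0 then du else 0) * E ^ b + u ^ a * b * E ^ b * P k

theorem pd_diagonal (f : Fin 3 → Coord → ℝ) (i j k : Fin 3) (x : Coord) :
    pd k (fun y => (Matrix.diagonal fun i => f i y : Matrix (Fin 3) (Fin 3) ℝ) i j) x =
      if i = j then pd k (f i) x else 0 := by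
  by_cases hij : i = j
  · subst hij; simp
  · simp [hij]

theorem SmoothPair.pd_logMetric {u : ℝ → ℝ} {ψ : Coord → ℝ} (h : SmoothPair u ψ) {x : Coord}
    (hx : x ∈ polarDomain) (i j k : Fin 3) :
    pd k (fun y => logMetric u ψ y i j) x = if i = j then
      monoDeriv (uExp i) (eExp i) (u (x 0)) (deriv u (x 0)) (Real.exp (ψ x))
        (fun k => pd k ψ x) k else 0 := by
  rw [show (fun y => logMetric u ψ y i j) = fun y =>
    (Matrix.diagonal fun i => (fun i (y : Coord) => u (y 0) ^ uExp i * Real.exp (ψ y) ^ eExp i) i y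
      : Matrix (Fin 3) (Fin 3) ℝ) i j from rfl, pd_diagonal]
  congr 1
  have := pd_monomial (k := k) (c := fun _ => 1) (uExp i) (eExp i) (differentiableAt_const 1)
    (h.u_diff hx) (h.u_pos _ hx).ne' (h.ψ_diff x)
  simp only [one_mul, pd_const, zero_mul, zero_add] at this
  exact this

/-- The Christoffel symbols of `e^{-2ψ} (dr² + u² dθ²) + e^{2ψ} dξ²` in terms of `E = e^ψ` and
`P_k = ∂_k ψ`. -/
def chr (u du E P₀ P₁ : ℝ) : Fin 3 → Matrix (Fin 3) (Fin 3) ℝ :=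
  ![!![-P₀, -P₁, 0; -P₁, -(u * du) + u ^ 2 * P₀, 0; 0, 0, -(E ^ 4 * P₀)],
    !![P₁ / u ^ 2, du / u - P₀, 0; du / u - P₀, -P₁, 0; 0, 0, -(E ^ 4 * P₁ / u ^ 2)],
    !![0, 0, P₀; 0, 0, P₁; P₀, P₁, 0]]

/-- The Christoffel formula, for diagonal metrics of the given form. -/
theorem sum_monoDeriv_eq_chr {u du E : ℝ} {P : Fin 3 → ℝ} (hu : u ≠ 0) (hE : E ≠ 0) (hP : P 2 = 0)
    (k i j : Fin 3) :
    (1 / 2) * ∑ l, (Matrix.diagonal fun i => u ^ (-uExp i) * E ^ (-eExp i) :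
        Matrix (Fin 3) (Fin 3) ℝ) k l *
      ((if j = l then monoDeriv (uExp j) (eExp j) u du E P i else 0)
        + (if i = l then monoDeriv (uExp i) (eExp i) u du E P j else 0)
        - (if i = j then monoDeriv (uExp i) (eExp i) u du E P l else 0)) =
      chr u du E (P 0) (P 1) k i j := by
  fin_cases k <;> fin_cases i <;> fin_cases j <;>
    simp [Matrix.diagonal_apply, monoDeriv, uExp, eExp, chr, hP, zpow_ofNat,
      zpow_neg] <;> field_simp <;> ring

theorem SmoothPair.christoffel_eq {u : ℝ → ℝ} {ψ : Coord → ℝ} (h : SmoothPair u ψ) {x : Coord}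
    (hx : x ∈ polarDomain) (k i j : Fin 3) :
    christoffel (logMetric u ψ) k i j x =
      chr (u (x 0)) (deriv u (x 0)) (Real.exp (ψ x)) (pd 0 ψ x) (pd 1 ψ x) k i j := by
  rw [christoffel, logMetric_inv (h.u_pos _ hx).ne']
  simp only [h.pd_logMetric hx]
  exact sum_monoDeriv_eq_chr (P := fun k => pd k ψ x) (h.u_pos _ hx).ne' (Real.exp_pos _).ne'
    (h.ψ_axial x) k i j

/-- The closed form holds on an open set, so it may be differentiated. -/
theorem SmoothPair.pd_christoffel {u : ℝ → ℝ} {ψ : Coord → ℝ} (h : SmoothPair u ψ) {x : Coord}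
    (hx : x ∈ polarDomain) (m k i j : Fin 3) :
    pd m (christoffel (logMetric u ψ) k i j) x =
      pd m (fun y => chr (u (y 0)) (deriv u (y 0)) (Real.exp (ψ y)) (pd 0 ψ y) (pd 1 ψ y) k i j)
        x := by
  apply pd_congr
  filter_upwards [isOpen_polarDomain.mem_nhds hx] with y hy using h.christoffel_eq hy k i j

/-! ### Ricci and scalar curvature of the smooth metrics. -/

namespace SmoothPair

variable {u : ℝ → ℝ} {ψ : Coord → ℝ} (h : SmoothPair u ψ) {x : Coord} (hx : x ∈ polarDomain)
include h hx

theorem u_comp_diff : DifferentiableAt ℝ (fun y : Coord => u (y 0)) x :=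
  (h.u_diff hx).comp x (differentiableAt_apply 0 x)

theorem du_comp_diff : DifferentiableAt ℝ (fun y : Coord => deriv u (y 0)) x :=
  DifferentiableAt.comp (g := deriv u) (f := fun y : Coord => y 0) x (h.du_diff hx)
    (differentiableAt_apply 0 x)

/-- This and the next four lemmas supply the derivatives that occur in the diagonal Ricci
components: ∂_r of Γ^r_θθ, of Γ^r_ξξ and of Γ^θ_rθ, then ∂_θ of Γ^θ_rr and of Γ^θ_ξξ. -/
theorem pd_chr_aux₁ : pd 0 (fun y => -(u (y 0) * deriv u (y 0)) + u (y 0) ^ 2 * pd 0 ψ y) x =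
    -(deriv u (x 0) ^ 2 + u (x 0) * deriv (deriv u) (x 0))
      + (2 * u (x 0) * deriv u (x 0) * pd 0 ψ x + u (x 0) ^ 2 * pd 0 (pd 0 ψ) x) := by
  have h1 := h.u_comp_diff hx
  have h2 := h.du_comp_diff hx
  have h3 := h.pd_diff 0 x
  simp only [pow_two]
  rw [pd_add (h1.fun_mul h2).fun_neg ((h1.fun_mul h1).fun_mul h3), pd_neg, pd_mul h1 h2,
    pd_mul (h1.fun_mul h1) h3, pd_mul h1 h1, pd_comp_coord (h.u_diff hx),
    pd_comp_coord (h.du_diff hx)]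
  simp only [if_true]
  ring

omit hx in
theorem pd_chr_aux₂ (k m : Fin 3) : pd m (fun y => -(Real.exp (ψ y) ^ 4 * pd k ψ y)) x =
    -(Real.exp (ψ x) ^ 4 * (4 * pd m ψ x * pd k ψ x + pd m (pd k ψ) x)) := by
  have h3 := h.pd_diff k x
  have h4 := (h.ψ_diff x).exp
  have h5 := pd_zpow (k := m) 4 h4 (Real.exp_pos _).ne'
  simp only [zpow_ofNat, pd_exp (h.ψ_diff x), show (4 : ℤ) - 1 = (3 : ℕ) from rfl,
    zpow_natCast] at h5
  rw [pd_neg, pd_mul (h4.fun_pow 4) h3, h5]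
  push_cast; ring

theorem pd_chr_aux₃ : pd 0 (fun y => deriv u (y 0) / u (y 0) - pd 0 ψ y) x =
    deriv (deriv u) (x 0) / u (x 0) - deriv u (x 0) ^ 2 / u (x 0) ^ 2 - pd 0 (pd 0 ψ) x := by
  have h0 := (h.u_pos _ hx).ne'
  have h1 := h.u_comp_diff hx
  have h2 := h.du_comp_diff hx
  have hq : DifferentiableAt ℝ (fun y : Coord => deriv u (y 0) / u (y 0)) x :=
    DifferentiableAt.comp (g := fun r => deriv u r / u r) (f := fun y : Coord => y 0) x
      ((h.du_diff hx).fun_div (h.u_diff hx) h0)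
      (differentiableAt_apply 0 x)
  rw [pd_sub hq (h.pd_diff 0 x),
    pd_comp_coord (f := fun r => deriv u r / u r) ((h.du_diff hx).div (h.u_diff hx) h0)]
  have := ((h.du_diff hx).hasDerivAt.div (h.u_diff hx).hasDerivAt h0).deriv
  simp only [if_true]
  rw [show (fun r => deriv u r / u r) = deriv u / u from rfl, this]
  field_simp

theorem pd_chr_aux₄ : pd 1 (fun y => pd 1 ψ y / u (y 0) ^ 2) x =
    pd 1 (pd 1 ψ) x / u (x 0) ^ 2 := by
  have h0 := (h.u_pos _ hx).ne'
  have h1 : DifferentiableAt ℝ (fun r => (u r ^ 2)⁻¹) (x 0) :=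
    ((h.u_diff hx).fun_pow 2).fun_inv (pow_ne_zero 2 h0)
  have h2 : DifferentiableAt ℝ (fun y : Coord => (u (y 0) ^ 2)⁻¹) x :=
    DifferentiableAt.comp (g := fun r => (u r ^ 2)⁻¹) (f := fun y : Coord => y 0) x h1
      (differentiableAt_apply 0 x)
  simp only [div_eq_mul_inv]
  rw [pd_mul (h.pd_diff 1 x) h2, pd_comp_coord (f := fun r => (u r ^ 2)⁻¹) h1]
  simp

theorem pd_chr_aux₅ : pd 1 (fun y => -(Real.exp (ψ y) ^ 4 * pd 1 ψ y / u (y 0) ^ 2)) x =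
    -(Real.exp (ψ x) ^ 4 * (4 * pd 1 ψ x * pd 1 ψ x + pd 1 (pd 1 ψ) x) / u (x 0) ^ 2) := by
  have h0 := (h.u_pos _ hx).ne'
  have h1 : DifferentiableAt ℝ (fun r => (u r ^ 2)⁻¹) (x 0) :=
    ((h.u_diff hx).fun_pow 2).fun_inv (pow_ne_zero 2 h0)
  have h2 : DifferentiableAt ℝ (fun y : Coord => (u (y 0) ^ 2)⁻¹) x :=
    DifferentiableAt.comp (g := fun r => (u r ^ 2)⁻¹) (f := fun y : Coord => y 0) x h1
      (differentiableAt_apply 0 x)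
  have h3 := h.pd_diff 1 x
  have h4 := h.ψ_diff x
  have := h.pd_chr_aux₂ (x := x) 1 1
  rw [pd_neg] at this
  simp only [div_eq_mul_inv]
  rw [pd_neg, pd_mul ((h4.exp.fun_pow 4).fun_mul h3) h2, pd_comp_coord (f := fun r => (u r ^ 2)⁻¹) h1]
  rw [neg_inj] at this
  rw [this]
  simp

/-- The diagonal Ricci components. -/
theorem ricci_diag (i : Fin 3) : ricci (logMetric u ψ) i i x =
    ![-(deriv (deriv u) (x 0) / u (x 0)) + pd 1 (pd 1 ψ) x / u (x 0) ^ 2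
        + deriv u (x 0) / u (x 0) * pd 0 ψ x - 2 * pd 0 ψ x ^ 2 + pd 1 ψ x ^ 2 / u (x 0) ^ 2,
      -(u (x 0) * deriv (deriv u) (x 0)) + u (x 0) ^ 2 * pd 0 (pd 0 ψ) x
        + u (x 0) ^ 2 * pd 0 ψ x ^ 2 - 2 * pd 1 ψ x ^ 2,
      -(Real.exp (ψ x) ^ 4 * (pd 0 (pd 0 ψ) x + pd 1 (pd 1 ψ) x / u (x 0) ^ 2
        + deriv u (x 0) / u (x 0) * pd 0 ψ x + pd 0 ψ x ^ 2 + pd 1 ψ x ^ 2 / u (x 0) ^ 2))] i := by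
  have h0 := (h.u_pos _ hx).ne'
  have e1 := h.pd_chr_aux₁ hx
  have e2 := h.pd_chr_aux₂ (x := x) 0 0
  have e3 := h.pd_chr_aux₃ hx
  have e4 := h.pd_chr_aux₄ hx
  have e5 := h.pd_chr_aux₅ hx
  simp only [ricci, h.christoffel_eq hx, h.pd_christoffel hx, Fin.sum_univ_three]
  fin_cases i <;> simp [chr, e1, e2, e3, e4, e5, pd_neg] <;> field_simp <;> ring

/-- The scalar curvature of `e^{-2ψ} (dr² + u² dθ²) + e^{2ψ} dξ²` is
`2 e^{2ψ} (-u''/u - |∇ψ|²)`. -/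
theorem scalarCurvature_eq : scalarCurvature (logMetric u ψ) x =
    2 * Real.exp (ψ x) ^ 2 *
      (-(deriv (deriv u) (x 0) / u (x 0)) - pd 0 ψ x ^ 2 - pd 1 ψ x ^ 2 / u (x 0) ^ 2) := by
  have h0 := (h.u_pos _ hx).ne'
  have hE := (Real.exp_pos (ψ x)).ne'
  rw [scalarCurvature, logMetric_inv h0]
  simp [logMetricInv, Matrix.diagonal_apply, Fin.sum_univ_three, h.ricci_diag hx, uExp, eExp,
    zpow_ofNat, zpow_neg]
  field_simp
  ring

end SmoothPair

/-! ### The Lee–LeFloch integrand of `e^{-2ψ} (dr² + u² dθ²) + e^{2ψ} dξ²` -/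

theorem stdRadius_pos {r : ℝ} (hr : r ∈ Ioo (0 : ℝ) 2) : 0 < stdRadius r :=
  mul_pos (by have := Real.pi_pos; positivity) (sin_half_pi_pos hr)

theorem contDiff_stdRadius : ContDiff ℝ ∞ stdRadius := by
  unfold stdRadius; fun_prop

theorem deriv_stdRadius (r : ℝ) : deriv stdRadius r = Real.cos (Real.pi * r / 2) := by
  have h : HasDerivAt (fun r : ℝ => Real.pi * r / 2) (Real.pi / 2) r := by
    simpa using ((hasDerivAt_id r).const_mul Real.pi).div_const 2
  have := (h.sin.const_mul (2 / Real.pi)).deriv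
  rw [show stdRadius = fun r => 2 / Real.pi * Real.sin (Real.pi * r / 2) from rfl, this]
  field_simp

theorem smoothPair_std : SmoothPair stdRadius (fun _ => 0) where
  u_smooth := contDiff_stdRadius.contDiffOn
  u_pos _ hr := stdRadius_pos hr
  ψ_smooth := contDiff_const
  ψ_axial x := pd_const 2 0 x

theorem christoffel_standard {x : Coord} (hx : x ∈ polarDomain) (k i j : Fin 3) :
    christoffel standardMetric k i j x =
      chr (stdRadius (x 0)) (deriv stdRadius (x 0)) 1 0 0 k i j := by
  rw [standardMetric_eq, smoothPair_std.christoffel_eq hx]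
  simp

theorem ricci_standard {x : Coord} (hx : x ∈ polarDomain) (i : Fin 3) :
    ricci standardMetric i i x =
      ![-(deriv (deriv stdRadius) (x 0) / stdRadius (x 0)),
        -(stdRadius (x 0) * deriv (deriv stdRadius) (x 0)), 0] i := by
  have h1 : (pd 0 fun _ : Coord => (0 : ℝ)) = fun _ => 0 := by ext; simp
  have h2 : (pd 1 fun _ : Coord => (0 : ℝ)) = fun _ => 0 := by ext; simp
  rw [standardMetric_eq, smoothPair_std.ricci_diag hx]
  simp [h1, h2]

theorem volDensity_logMetric {u : ℝ → ℝ} {ψ : Coord → ℝ} {x : Coord} (hu : 0 < u (x 0)) :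
    volDensity (logMetric u ψ) x = u (x 0) * (Real.exp (ψ x))⁻¹ := by
  have hE := Real.exp_pos (ψ x)
  rw [volDensity, logMetric, Matrix.det_diagonal, Fin.prod_univ_three]
  rw [show u (x 0) ^ uExp 0 * Real.exp (ψ x) ^ eExp 0 * (u (x 0) ^ uExp 1 * Real.exp (ψ x) ^ eExp 1) *
    (u (x 0) ^ uExp 2 * Real.exp (ψ x) ^ eExp 2) = (u (x 0) * (Real.exp (ψ x))⁻¹) ^ 2 by
      simp [uExp, eExp, zpow_ofNat, zpow_neg]; field_simp]
  exact Real.sqrt_sq (by positivity)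

theorem volDensity_standard {x : Coord} (hx : x ∈ polarDomain) :
    volDensity standardMetric x = stdRadius (x 0) := by
  rw [standardMetric_eq, volDensity_logMetric (stdRadius_pos hx)]
  simp

/-- The values at a point of `g = e^{-2ψ} (dr² + u² dθ²) + e^{2ψ} dξ²`, of its inverse, and of
their weak derivatives, where `E = e^ψ` and `P_k = ∂_k ψ`. -/
structure HasWeakJet (g : MetricField) (x : Coord) (u du E : ℝ) (P : Fin 3 → ℝ) : Prop where
  metric : g x = Matrix.diagonal fun i => u ^ uExp i * E ^ eExp i
  inverse : (g x)⁻¹ = Matrix.diagonal fun i => u ^ (-uExp i) * E ^ (-eExp i)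
  metric_deriv : ∀ k i j, weakPartial polarDomain k (fun y => g y i j) x =
    if i = j then monoDeriv (uExp i) (eExp i) u du E P k else 0
  inverse_deriv : ∀ k i j, weakPartial polarDomain k (fun y => (g y)⁻¹ i j) x =
    if i = j then monoDeriv (-uExp i) (-eExp i) u du E P k else 0

namespace HasWeakJet

variable {g : MetricField} {x : Coord} {u du E : ℝ} {P : Fin 3 → ℝ}
  (h : HasWeakJet g x u du E P) (hx : x ∈ polarDomain) (hu : u ≠ 0) (hE : E ≠ 0) (hP : P 2 = 0)
include h hx hu hE hP

/-- The Christoffel formula with ∇̄ in place of ∂ computes the difference tensor of the two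
connections, hence the difference of their symbols. -/
theorem gam_eq (k i j : Fin 3) : Gam polarDomain standardMetric g k i j x =
    chr u du E (P 0) (P 1) k i j -
      chr (stdRadius (x 0)) (deriv stdRadius (x 0)) 1 0 0 k i j := by
  have hs := (stdRadius_pos hx).ne'
  rw [← sum_monoDeriv_eq_chr hu hE hP, Gam, h.inverse]
  simp only [covMetric, h.metric_deriv, christoffel_standard hx, h.metric]
  generalize stdRadius (x 0) = s at *
  generalize deriv stdRadius (x 0) = ds
  fin_cases k <;> fin_cases i <;> fin_cases j <;>
    simp [Fin.sum_univ_three, Matrix.diagonal_apply, uExp, eExp, chr, zpow_ofNat,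
      zpow_neg] <;> field_simp <;> ring

/-- The gradient of ψ cancels and V is radial. Hence only the r-derivative of the weighted test
function enters the pairing. -/
theorem V_eq (k : Fin 3) : V polarDomain standardMetric g k x =
    if k = 0 then E ^ 2 / u * (-(2 * du) + deriv stdRadius (x 0) *
      (stdRadius (x 0) / u + u / stdRadius (x 0))) else 0 := by
  have hs := (stdRadius_pos hx).ne'
  simp only [V, h.gam_eq hx hu hE hP, h.inverse]
  generalize stdRadius (x 0) = s at *
  generalize deriv stdRadius (x 0) = ds
  fin_cases k <;>
    simp [Fin.sum_univ_three, Matrix.diagonal_apply, uExp, eExp, chr, zpow_ofNat,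
      zpow_neg] <;> field_simp <;> ring

theorem F_eq : F polarDomain standardMetric g x = E ^ 2 *
    (-(deriv (deriv stdRadius) (x 0) / stdRadius (x 0))
      - deriv (deriv stdRadius) (x 0) * stdRadius (x 0) / u ^ 2
      + 2 * du * deriv stdRadius (x 0) / (stdRadius (x 0) * u)
      - 2 * P 0 * deriv stdRadius (x 0) / stdRadius (x 0)
      - 2 * du ^ 2 / u ^ 2 - 2 * deriv stdRadius (x 0) ^ 2 / u ^ 2 - 2 * P 1 ^ 2 / u ^ 2
      + 4 * P 0 * du / u - 2 * P 0 ^ 2 - 2 * stdRadius (x 0) * P 0 * deriv stdRadius (x 0) / u ^ 2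
      + 2 * stdRadius (x 0) * du * deriv stdRadius (x 0) / u ^ 3) := by
  have hs := (stdRadius_pos hx).ne'
  have hi : ∀ i j, (Matrix.diagonal fun i => u ^ (-uExp i) * E ^ (-eExp i) :
    Matrix (Fin 3) (Fin 3) ℝ) i j * ricci standardMetric i j x =
      if i = j then u ^ (-uExp i) * E ^ (-eExp i) * ricci standardMetric i i x else 0 := by
    intro i j
    by_cases hij : i = j
    · subst hij; simp
    · simp [hij]
  simp only [F, covInverse, h.inverse_deriv, h.gam_eq hx hu hE hP, h.inverse, hi,
    ricci_standard hx, christoffel_standard hx]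
  generalize deriv (deriv stdRadius) (x 0) = dds
  generalize stdRadius (x 0) = s at *
  generalize deriv stdRadius (x 0) = ds
  simp [Fin.sum_univ_three, Matrix.diagonal_apply, uExp, eExp, chr, zpow_ofNat, monoDeriv,
      zpow_neg, hP]
  field_simp
  ring

end HasWeakJet

/-- The Lee–LeFloch integrand in terms of `u`, `u'`, `E = e^ψ`, `P_k = ∂_k ψ`, of the values `w`,
`w₀` of the test function and its radial derivative, and of the radius `s` of the circles of
latitude of the standard sphere and its derivatives. -/
def jetDensity (u du E P₀ P₁ w w₀ s ds dds : ℝ) : ℝ :=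
  2 * du * E * (P₀ * w + w₀) - 2 * E * w * u * (P₀ ^ 2 + P₁ ^ 2 / u ^ 2)
    - ((w₀ + w * P₀) * E * ds * (s / u + u / s) + w * E * dds * (s / u + u / s)
      + w * E * ds * (ds / u - s * du / u ^ 2 + du / s - u * ds / s ^ 2))

/-- The hypothesis `hv` is the product rule for v u e^{-ψ}/s, which is what `weighted` amounts to
here. -/
theorem HasWeakJet.pairingDensity_eq {g : MetricField} {x : Coord} {u du E : ℝ} {P : Fin 3 → ℝ}
    (h : HasWeakJet g x u du E P) (hx : x ∈ polarDomain) (hu : 0 < u) (hE : 0 < E) (hP : P 2 = 0)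
    {v : Coord → ℝ} {v₀ : ℝ}
    (hv : weakPartial polarDomain 0 (weighted standardMetric g v) x =
      (v₀ / stdRadius (x 0) - v x * deriv stdRadius (x 0) / stdRadius (x 0) ^ 2) * u * E⁻¹
        + v x / stdRadius (x 0) * du * E⁻¹ - v x / stdRadius (x 0) * u * E⁻¹ * P 0) :
    pairingDensity polarDomain standardMetric g v x =
      jetDensity u du E (P 0) (P 1) (v x) v₀ (stdRadius (x 0)) (deriv stdRadius (x 0))
        (deriv (deriv stdRadius) (x 0)) := by
  have hs := (stdRadius_pos hx).ne'
  have hvol : volDensity g x = u * E⁻¹ := by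
    rw [volDensity, h.metric, Matrix.det_diagonal, Fin.prod_univ_three]
    rw [show u ^ uExp 0 * E ^ eExp 0 * (u ^ uExp 1 * E ^ eExp 1) * (u ^ uExp 2 * E ^ eExp 2) =
      (u * E⁻¹) ^ 2 by simp [uExp, eExp, zpow_ofNat, zpow_neg]; field_simp]
    exact Real.sqrt_sq (by positivity)
  rw [pairingDensity, Fin.sum_univ_three, h.V_eq hx hu.ne' hE.ne' hP, h.V_eq hx hu.ne' hE.ne' hP,
    h.V_eq hx hu.ne' hE.ne' hP, hv, h.F_eq hx hu.ne' hE.ne' hP, weighted, hvol,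
    volDensity_standard hx]
  simp only [if_true, one_ne_zero, if_false, show (2 : Fin 3) ≠ 0 by decide, zero_mul, add_zero,
    jetDensity]
  generalize deriv (deriv stdRadius) (x 0) = dds
  generalize stdRadius (x 0) = s at *
  generalize deriv stdRadius (x 0) = ds
  field_simp
  ring

/-! ### Consequences of nonnegative scalar curvature -/

theorem logLift_congr {φ : S2 → ℝ} {x y : Coord} (h0 : x 0 = y 0) (h1 : x 1 = y 1) :
    logLift φ x = logLift φ y := by
  simp [logLift, polarLift, h0, h1]

theorem pd_two_logLift (φ : S2 → ℝ) (x : Coord) : pd 2 (logLift φ) x = 0 := by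
  by_cases h : DifferentiableAt ℝ (logLift φ) x
  · have h1 := hasDerivAt_pd 2 h
    have h2 : (fun t => logLift φ (Function.update x 2 t)) = fun _ => logLift φ x := by
      funext t
      exact logLift_congr (by simp) (by simp)
    rw [h2] at h1
    exact h1.unique (hasDerivAt_const _ _)
  -- `fderiv` is zero by default where there is no derivative, so no smoothness of φ is needed.
  · rw [pd, fderiv_zero_of_not_differentiableAt h]; rfl

namespace IsWarpingPair

variable {u : ℝ → ℝ} {φ : S2 → ℝ} (h : IsWarpingPair u φ)
include h

theorem smoothPair : SmoothPair u (logLift φ) where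
  u_smooth := h.u_smooth.mono Ioo_subset_Icc_self
  u_pos := h.u_pos
  ψ_smooth := contDiff_logLift h.φ_smooth h.φ_pos
  ψ_axial := pd_two_logLift φ

theorem warpedMetric_eq_logMetric : warpedMetric u φ = logMetric u (logLift φ) :=
  funext fun _ => warpedMetric_eq (h.φ_pos _)

theorem continuousOn : ContinuousOn u (Icc 0 2) := h.u_smooth.continuousOn

end IsWarpingPair

/-- The inequality `|∇ log φ|² ≤ -u''/u`, together with the properties of `u` and `φ` that are
used with it. -/
structure IsEnergyPair (u : ℝ → ℝ) (φ : S2 → ℝ) : Prop extends IsWarpingPair u φ where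
  energy : ∀ x ∈ polarDomain, u (x 0) * (pd 0 (logLift φ) x ^ 2
    + pd 1 (logLift φ) x ^ 2 / u (x 0) ^ 2) ≤ -deriv (deriv u) (x 0)

theorem IsWarpingPair.isEnergyPair {u : ℝ → ℝ} {φ : S2 → ℝ} (h : IsWarpingPair u φ)
    (hs : ∀ x ∈ polarDomain, 0 ≤ scalarCurvature (warpedMetric u φ) x) : IsEnergyPair u φ where
  toIsWarpingPair := h
  energy x hx := by
    have h0 := h.u_pos _ hx
    have h1 := hs x hx
    rw [h.warpedMetric_eq_logMetric, h.smoothPair.scalarCurvature_eq hx] at h1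
    have h2 : 0 ≤ -(deriv (deriv u) (x 0) / u (x 0)) - pd 0 (logLift φ) x ^ 2
        - pd 1 (logLift φ) x ^ 2 / u (x 0) ^ 2 :=
      nonneg_of_mul_nonneg_right h1 (by positivity)
    have h3 := mul_nonneg h0.le h2
    have h4 : u (x 0) * (deriv (deriv u) (x 0) / u (x 0)) = deriv (deriv u) (x 0) := by
      field_simp
    linarith

/-! ### Concavity, Lipschitz and lower bounds for u. -/

namespace IsEnergyPair

variable {u : ℝ → ℝ} {φ : S2 → ℝ} (h : IsEnergyPair u φ)
include h

theorem deriv2_nonpos {r : ℝ} (hr : r ∈ Ioo (0 : ℝ) 2) : deriv (deriv u) r ≤ 0 := by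
  have h0 := h.u_pos r hr
  have h1 := h.energy ![r, 0, 0] hr
  have : (0 : ℝ) ≤ u (![r, 0, 0] 0) * (pd 0 (logLift φ) ![r, 0, 0] ^ 2
    + pd 1 (logLift φ) ![r, 0, 0] ^ 2 / u (![r, 0, 0] 0) ^ 2) :=
    mul_nonneg h0.le (by positivity)
  have h2 : (![r, 0, 0] : Coord) 0 = r := rfl
  rw [h2] at h1 this
  linarith

/-- By concavity u' decreases from 1 at one pole to -1 at the other. The proof runs through
`derivWithin` because u is controlled only on [0,2], so `deriv` carries no information at the
endpoints. -/
theorem abs_deriv_le {r : ℝ} (hr : r ∈ Ioo (0 : ℝ) 2) : |deriv u r| ≤ 1 := by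
  have heq : ∀ t ∈ Ioo (0 : ℝ) 2, derivWithin u (Icc 0 2) t = deriv u t := fun t ht =>
    derivWithin_of_mem_nhds (Icc_mem_nhds ht.1 ht.2)
  have hanti : AntitoneOn (derivWithin u (Icc 0 2)) (Icc 0 2) := by
    have hev : ∀ t ∈ interior (Icc (0 : ℝ) 2), derivWithin u (Icc 0 2) =ᶠ[𝓝 t] deriv u := by
      intro t ht
      rw [interior_Icc] at ht
      filter_upwards [isOpen_Ioo.mem_nhds ht] with y hy using heq y hy
    refine antitoneOn_of_deriv_nonpos (convex_Icc 0 2)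
      (h.u_smooth.continuousOn_derivWithin (uniqueDiffOn_Icc (by norm_num)) (by simp)) ?_ ?_
    · intro t ht
      have := hev t ht
      rw [interior_Icc] at ht
      exact ((h.smoothPair.du_diff ht).congr_of_eventuallyEq this).differentiableWithinAt
    · intro t ht
      rw [(hev t ht).deriv_eq]
      rw [interior_Icc] at ht
      exact h.deriv2_nonpos ht
  have hr' := Ioo_subset_Icc_self hr
  have h1 := hanti (left_mem_Icc.2 (by norm_num)) hr' hr'.1
  have h2 := hanti hr' (right_mem_Icc.2 (by norm_num)) hr'.2
  rw [h.deriv_zero, heq r hr] at h1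
  rw [h.deriv_two, heq r hr] at h2
  exact abs_le.2 ⟨h2, h1⟩

theorem concaveOn : ConcaveOn ℝ (Icc 0 2) u := by
  refine concaveOn_of_deriv2_nonpos (convex_Icc 0 2) h.continuousOn ?_ ?_ ?_ <;>
    rw [interior_Icc]
  · exact fun t ht => (h.smoothPair.u_diff ht).differentiableWithinAt
  · exact fun t ht => (h.smoothPair.du_diff ht).differentiableWithinAt
  · exact fun t ht => h.deriv2_nonpos ht

theorem abs_sub_le {r t : ℝ} (hr : r ∈ Icc (0 : ℝ) 2) (ht : t ∈ Icc (0 : ℝ) 2) :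
    |u r - u t| ≤ |r - t| := by
  have key : ∀ a ∈ Icc (0 : ℝ) 2, ∀ b ∈ Icc (0 : ℝ) 2, a < b → |u b - u a| ≤ b - a := by
    intro a ha b hb hab
    obtain ⟨c, hc, hc'⟩ := exists_deriv_eq_slope u hab (h.continuousOn.mono (Icc_subset_Icc ha.1 hb.2))
      (fun t ht => (h.smoothPair.u_diff ⟨ha.1.trans_lt ht.1, ht.2.trans_le hb.2⟩).differentiableWithinAt)
    have h1 := h.abs_deriv_le ⟨ha.1.trans_lt hc.1, hc.2.trans_le hb.2⟩
    rw [hc', abs_div, abs_of_pos (sub_pos.2 hab), div_le_one (sub_pos.2 hab)] at h1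
    exact h1
  rcases lt_trichotomy r t with hrt | hrt | hrt
  · rw [abs_sub_comm, abs_sub_comm r, abs_of_pos (sub_pos.2 hrt)]; exact key r hr t ht hrt
  · simp [hrt]
  · rw [abs_of_pos (sub_pos.2 hrt)]; exact key t ht r hr hrt

theorem u_nonneg {r : ℝ} (hr : r ∈ Icc (0 : ℝ) 2) : 0 ≤ u r := by
  rcases eq_or_lt_of_le hr.1 with h0 | h0
  · rw [← h0, h.u_zero]
  rcases eq_or_lt_of_le hr.2 with h1 | h1
  · rw [h1, h.u_two]
  exact (h.u_pos r ⟨h0, h1⟩).le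

theorem u_le_left {r : ℝ} (hr : r ∈ Icc (0 : ℝ) 2) : u r ≤ r := by
  have := h.abs_sub_le hr (left_mem_Icc.2 (by norm_num) : (0 : ℝ) ∈ Icc (0 : ℝ) 2)
  rw [h.u_zero, sub_zero, sub_zero, abs_of_nonneg hr.1] at this
  exact (le_abs_self _).trans this

theorem u_le_right {r : ℝ} (hr : r ∈ Icc (0 : ℝ) 2) : u r ≤ 2 - r := by
  have := h.abs_sub_le hr (right_mem_Icc.2 (by norm_num) : (2 : ℝ) ∈ Icc (0 : ℝ) 2)
  rw [h.u_two, sub_zero, abs_sub_comm, abs_of_nonneg (sub_nonneg.2 hr.2)] at this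
  exact (le_abs_self _).trans this

/-- A lower bound at one point gives a lower bound everywhere, by concavity. -/
theorem le_u {m r₀ : ℝ} (hr₀ : r₀ ∈ Ioo (0 : ℝ) 2) (hm0 : 0 ≤ m) (hm : m ≤ u r₀) {r : ℝ}
    (hr : r ∈ Icc (0 : ℝ) 2) : m / 4 * (r * (2 - r)) ≤ u r := by
  have h0 : (0 : ℝ) ∈ Icc (0 : ℝ) 2 := left_mem_Icc.2 (by norm_num)
  have h2 : (2 : ℝ) ∈ Icc (0 : ℝ) 2 := right_mem_Icc.2 (by norm_num)
  have hr₀' := Ioo_subset_Icc_self hr₀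
  have hr1 := hr.1
  have hr2 := hr.2
  have hc := h.concaveOn.2
  -- The chord from (0,0) to (r₀, u r₀) gives u r ≥ m r/2, and r(2 - r) ≤ 2r accounts for the factor
  -- 1/4. The other side of r₀ is the mirror image.
  rcases le_total r r₀ with hle | hle
  · have h1 := hc h0 hr₀' (a := 1 - r / r₀) (b := r / r₀)
      (sub_nonneg.2 ((div_le_one hr₀.1).2 hle)) (div_nonneg hr.1 hr₀.1.le) (by ring)
    have h3 : (1 - r / r₀) • (0 : ℝ) + (r / r₀) • r₀ = r := by
      have := hr₀.1.ne'
      simp only [smul_eq_mul]; field_simp; ring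
    rw [h3, h.u_zero] at h1
    simp only [smul_eq_mul, mul_zero, zero_add] at h1
    have h4 : r / 2 ≤ r / r₀ := by
      have := hr₀.1
      gcongr; exact hr₀.2.le
    have h5 : r / 2 * m ≤ r / r₀ * u r₀ := by
      have := div_nonneg hr.1 hr₀.1.le
      gcongr
    nlinarith [mul_nonneg hm0 hr1, mul_nonneg (mul_nonneg hm0 hr1) hr1]
  · have hp : 0 < 2 - r₀ := sub_pos.2 hr₀.2
    have h1 := hc h2 hr₀' (a := 1 - (2 - r) / (2 - r₀)) (b := (2 - r) / (2 - r₀))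
      (sub_nonneg.2 ((div_le_one hp).2 (by linarith))) (div_nonneg (by linarith) hp.le) (by ring)
    have h3 : (1 - (2 - r) / (2 - r₀)) • (2 : ℝ) + ((2 - r) / (2 - r₀)) • r₀ = r := by
      simp only [smul_eq_mul]; field_simp; ring
    rw [h3, h.u_two] at h1
    simp only [smul_eq_mul, mul_zero, zero_add] at h1
    have h4 : (2 - r) / 2 ≤ (2 - r) / (2 - r₀) := by
      have : 0 ≤ 2 - r := by linarith
      gcongr; linarith [hr₀.1]
    have h5 : (2 - r) / 2 * m ≤ (2 - r) / (2 - r₀) * u r₀ := by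
      have : 0 ≤ (2 - r) / (2 - r₀) := div_nonneg (by linarith) hp.le
      gcongr
    have h6 : 0 ≤ 2 - r := by linarith
    nlinarith [mul_nonneg hm0 h6, mul_nonneg (mul_nonneg hm0 h6) h6]

/-! ### Oscillation of `log φ` -/

theorem sq_pd_zero_le {x : Coord} (hx : x ∈ polarDomain) :
    u (x 0) * pd 0 (logLift φ) x ^ 2 ≤ -deriv (deriv u) (x 0) := by
  have h0 := h.u_pos _ hx
  refine le_trans ?_ (h.energy x hx)
  have : 0 ≤ pd 1 (logLift φ) x ^ 2 / u (x 0) ^ 2 := by positivity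
  nlinarith

theorem sq_pd_one_le {x : Coord} (hx : x ∈ polarDomain) :
    pd 1 (logLift φ) x ^ 2 ≤ u (x 0) * -deriv (deriv u) (x 0) := by
  have h0 := h.u_pos _ hx
  have h1 := mul_le_mul_of_nonneg_left (h.energy x hx) h0.le
  refine le_trans ?_ h1
  have : u (x 0) * (u (x 0) * (pd 0 (logLift φ) x ^ 2 + pd 1 (logLift φ) x ^ 2 / u (x 0) ^ 2)) =
    u (x 0) ^ 2 * pd 0 (logLift φ) x ^ 2 + pd 1 (logLift φ) x ^ 2 := by field_simp
  rw [this]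
  nlinarith [sq_nonneg (u (x 0) * pd 0 (logLift φ) x)]

/-- A weakening that gives all coordinate derivatives the same weight u. It loses a factor u² ≤ 1 in
the θ direction, harmless away from the poles. -/
theorem sq_pd_le {x : Coord} (hx : x ∈ polarDomain) (k : Fin 3) :
    u (x 0) * pd k (logLift φ) x ^ 2 ≤ -deriv (deriv u) (x 0) := by
  have h0 := h.u_pos _ hx
  have h1 : u (x 0) ≤ 1 := by
    have := Ioo_subset_Icc_self hx
    linarith [h.u_le_left this, h.u_le_right this]
  have h2 := h.deriv2_nonpos hx
  fin_cases k
  · exact h.sq_pd_zero_le hx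
  · have h3 := mul_le_mul_of_nonneg_left (h.sq_pd_one_le hx) h0.le
    refine h3.trans ?_
    have : u (x 0) * u (x 0) ≤ 1 := by nlinarith
    simp only [← mul_assoc]
    nlinarith
  · simp only [Fin.reduceFinMk, pd_two_logLift]
    linarith

/-- If `1 ≤ K u L'`, then the variation of `log φ` along a meridian is controlled by `K u'`
and `L`. -/
theorem abs_sub_le_of_barrier {K a b θ : ℝ} (hK : 0 < K) (ha : 0 < a) (hab : a ≤ b) (hb : b < 2)
    {L L' : ℝ → ℝ} (hL : ∀ r ∈ Icc a b, HasDerivAt L (L' r) r)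
    (hL' : ∀ r ∈ Icc a b, 1 ≤ K * u r * L' r) :
    |logLift φ ![b, θ, 0] - logLift φ ![a, θ, 0]| ≤ K + (L b - L a) / 2 := by
  have hsub : ∀ r ∈ Icc a b, r ∈ Ioo (0 : ℝ) 2 := fun r hr =>
    ⟨ha.trans_le hr.1, hr.2.trans_lt hb⟩
  have hψ : ∀ r, HasDerivAt (fun r => logLift φ ![r, θ, 0]) (pd 0 (logLift φ) ![r, θ, 0]) r := by
    intro r
    have := hasDerivAt_pd (x := ![r, θ, 0]) 0 (h.smoothPair.ψ_diff _)
    have e : (fun t => logLift φ (Function.update ![r, θ, 0] 0 t)) =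
        fun t => logLift φ ![t, θ, 0] := by
      funext t
      exact logLift_congr (by simp) (by simp)
    rwa [e] at this
  have hB : ∀ r ∈ Icc a b, HasDerivAt (fun r => (-(K * deriv u r) + L r) / 2)
      ((-(K * deriv (deriv u) r) + L' r) / 2) r := fun r hr =>
    (((h.smoothPair.du_diff (hsub r hr)).hasDerivAt.const_mul K).fun_neg.fun_add (hL r hr)).div_const 2
  have hbd : ∀ r ∈ Icc a b, |pd 0 (logLift φ) ![r, θ, 0]| ≤
      (-(K * deriv (deriv u) r) + L' r) / 2 := by
    intro r hr
    have h0 := h.u_pos r (hsub r hr)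
    have h1 := h.sq_pd_zero_le (x := ![r, θ, 0]) (hsub r hr)
    have h2 := hL' r hr
    have h3 := h.deriv2_nonpos (hsub r hr)
    simp only [Matrix.cons_val_zero] at h1
    set p := pd 0 (logLift φ) ![r, θ, 0]
    have hL0 : 0 < L' r := by
      by_contra hc
      push Not at hc
      have : K * u r * L' r ≤ 0 := mul_nonpos_of_nonneg_of_nonpos (by positivity) hc
      linarith
    have hs : 0 ≤ (-(K * deriv (deriv u) r) + L' r) / 2 := by nlinarith
    apply abs_le_of_sq_le_sq _ hs
    -- The barrier condition replaces 1/u by K L'; then √(xy) ≤ (x + y)/2 with x = -K u'' and y =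
    -- L'. Both terms are exact derivatives.
    have h4 : p ^ 2 ≤ K * -deriv (deriv u) r * L' r := by
      calc p ^ 2 = 1 * p ^ 2 := by ring
        _ ≤ (K * u r * L' r) * p ^ 2 := by gcongr
        _ = K * L' r * (u r * p ^ 2) := by ring
        _ ≤ K * L' r * -deriv (deriv u) r := by gcongr
        _ = _ := by ring
    nlinarith [sq_nonneg (K * -deriv (deriv u) r - L' r)]
  -- Since |u'| ≤ 1 at both ends, the increment of -K u'/2 is at most K.
  have hda := h.abs_deriv_le (hsub a (left_mem_Icc.2 hab))
  have hdb := h.abs_deriv_le (hsub b (right_mem_Icc.2 hab))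
  rw [abs_le] at hda hdb
  have m1 : MonotoneOn (fun r => (-(K * deriv u r) + L r) / 2 - logLift φ ![r, θ, 0]) (Icc a b) := by
    have hd : ∀ r ∈ Icc a b, HasDerivAt (fun r => (-(K * deriv u r) + L r) / 2 - logLift φ ![r, θ, 0])
      ((-(K * deriv (deriv u) r) + L' r) / 2 - pd 0 (logLift φ) ![r, θ, 0]) r :=
      fun r hr => (hB r hr).fun_sub (hψ r)
    refine monotoneOn_of_hasDerivWithinAt_nonneg (convex_Icc a b)
      (fun r hr => (hd r hr).continuousAt.continuousWithinAt)
      (fun r hr => (hd r (interior_subset hr)).hasDerivWithinAt) ?_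
    intro r hr
    linarith [hbd r (interior_subset hr), le_abs_self (pd 0 (logLift φ) ![r, θ, 0])]
  have m2 : MonotoneOn (fun r => (-(K * deriv u r) + L r) / 2 + logLift φ ![r, θ, 0]) (Icc a b) := by
    have hd : ∀ r ∈ Icc a b, HasDerivAt (fun r => (-(K * deriv u r) + L r) / 2 + logLift φ ![r, θ, 0])
      ((-(K * deriv (deriv u) r) + L' r) / 2 + pd 0 (logLift φ) ![r, θ, 0]) r :=
      fun r hr => (hB r hr).fun_add (hψ r)
    refine monotoneOn_of_hasDerivWithinAt_nonneg (convex_Icc a b)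
      (fun r hr => (hd r hr).continuousAt.continuousWithinAt)
      (fun r hr => (hd r (interior_subset hr)).hasDerivWithinAt) ?_
    intro r hr
    linarith [hbd r (interior_subset hr), neg_abs_le (pd 0 (logLift φ) ![r, θ, 0])]
  have e1 := m1 (left_mem_Icc.2 hab) (right_mem_Icc.2 hab) hab
  have e2 := m2 (left_mem_Icc.2 hab) (right_mem_Icc.2 hab) hab
  simp only at e1 e2
  rw [abs_le]
  constructor <;> nlinarith

end IsEnergyPair

/-! ### Areas of patches -/

/-- Sets that are disjoint, and injective, modulo translations have at most the volume of a set
whose translates cover them. -/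
theorem sum_volume_le_of_translates {N : ℕ} {ι : Type*} [Countable ι] (s : ι → Fin 2 → ℝ)
    {C : Set (Fin 2 → ℝ)} (hC : MeasurableSet C) {A : Fin N → Set (Fin 2 → ℝ)}
    (hA : ∀ j, MeasurableSet (A j)) (hcover : ∀ j, ∀ y ∈ A j, ∃ n, y - s n ∈ C)
    (hdisj : ∀ j k n m y, y + s n ∈ A j → y + s m ∈ A k → j = k ∧ n = m) :
    ∑ j, volume (A j) ≤ volume C := by
  -- Cut each set into pieces by translates of C and move every piece back into C; there the pieces
  -- are disjoint.
  let B : Fin N × ι → Set (Fin 2 → ℝ) := fun q => {y | y + s q.2 ∈ A q.1} ∩ C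
  have hBm : ∀ q, MeasurableSet (B q) := fun q =>
    ((measurable_add_const (s q.2)) (hA q.1)).inter hC
  have hBd : Pairwise fun q q' => Disjoint (B q) (B q') := by
    rintro ⟨j, n⟩ ⟨k, m⟩ hne
    rw [Set.disjoint_left]
    rintro y ⟨hy, -⟩ ⟨hy', -⟩
    obtain ⟨h1, h2⟩ := hdisj j k n m y hy hy'
    exact hne (by rw [h1, h2])
  have hle : ∀ j, volume (A j) ≤ ∑' n, volume (B (j, n)) := by
    intro j
    have hsub : A j ⊆ ⋃ n, (fun y => y + -s n) ⁻¹' B (j, n) := by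
      intro y hy
      obtain ⟨n, hn⟩ := hcover j y hy
      refine mem_iUnion.2 ⟨n, ?_, ?_⟩
      · simpa using hy
      · simpa [sub_eq_add_neg] using hn
    refine (measure_mono hsub).trans ((measure_iUnion_le _).trans (le_of_eq ?_))
    simp only [measure_preimage_add_right]
  calc ∑ j, volume (A j) ≤ ∑ j, ∑' n, volume (B (j, n)) := Finset.sum_le_sum fun j _ => hle j
    _ = ∑' q, volume (B q) := by
      rw [ENNReal.tsum_prod', tsum_fintype]
    _ = volume (⋃ q, B q) := (measure_iUnion hBd hBm).symm
    _ ≤ volume C := measure_mono (iUnion_subset fun q => inter_subset_right)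

/-- Projection to two of the three coordinates. -/
def coordPair (a b : Fin 3) (x : Coord) : Fin 2 → ℝ := ![x a, x b]

/-! ### Area of a patch through a coordinate projection. -/

namespace IsPatch

variable {S : Set (S2 × Circle)} {U : Set (Fin 2 → ℝ)} {X : (Fin 2 → ℝ) → Coord}
  (h : IsPatch S U X) {p : Fin 2 → ℝ} (hp : p ∈ U)
include h hp

theorem differentiableAt : DifferentiableAt ℝ X p :=
  (h.smooth.contDiffAt (h.isOpen.mem_nhds hp)).differentiableAt (by simp)

theorem differentiableAt_coord (i : Fin 3) : DifferentiableAt ℝ (fun q => X q i) p :=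
  differentiableAt_pi.1 (h.differentiableAt hp) i

theorem tangent_eq (a : Fin 2) (i : Fin 3) :
    tangent X a p i = fderiv ℝ X p (Pi.single a 1) i := by
  rw [tangent, pd, fderiv_apply (h.differentiableAt hp)]
  rfl

theorem hasFDerivAt_coordPair (a b : Fin 3) :
    HasFDerivAt (fun q => coordPair a b (X q)) (fderiv ℝ (fun q => coordPair a b (X q)) p) p := by
  have : DifferentiableAt ℝ (fun q => coordPair a b (X q)) p := by
    rw [differentiableAt_pi]
    intro i
    fin_cases i
    · exact h.differentiableAt_coord hp a
    · exact h.differentiableAt_coord hp b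
  exact this.hasFDerivAt

theorem det_coordPair (a b : Fin 3) :
    (fderiv ℝ (fun q => coordPair a b (X q)) p).det =
      tangent X 0 p a * tangent X 1 p b - tangent X 1 p a * tangent X 0 p b := by
  have hd := (h.hasFDerivAt_coordPair hp a b).differentiableAt
  rw [ContinuousLinearMap.det, ← LinearMap.det_toMatrix', Matrix.det_fin_two]
  have e : ∀ i j, LinearMap.toMatrix' (↑(fderiv ℝ (fun q => coordPair a b (X q)) p) :
      (Fin 2 → ℝ) →ₗ[ℝ] (Fin 2 → ℝ)) i j = pd j (fun q => coordPair a b (X q) i) p := by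
    intro i j
    rw [LinearMap.toMatrix'_apply, pd, fderiv_apply hd]
    simp only [ContinuousLinearMap.coe_coe, ContinuousLinearMap.comp_apply,
      ContinuousLinearMap.proj_apply]
  simp only [e]
  simp only [coordPair, Matrix.cons_val_zero, Matrix.cons_val_one, tangent]

omit hp in
theorem measurableSet_image_coordPair {a b : Fin 3}
    (hinj : InjOn (fun q => coordPair a b (X q)) U) :
    MeasurableSet ((fun q => coordPair a b (X q)) '' U) :=
  measurable_image_of_fderivWithin h.isOpen.measurableSet
    (fun _ hq => (h.hasFDerivAt_coordPair hq a b).hasFDerivWithinAt) hinj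

omit hp in
-- Change of variables: the 2 × 2 minor of the tangent vectors is the Jacobian of the projection to
-- the coordinates a and b.
theorem lintegral_area_le {g : MetricField} {a b : Fin 3} {B : ℝ} (hB : 0 ≤ B)
    (hinj : InjOn (fun q => coordPair a b (X q)) U)
    (hdet : ∀ q ∈ U, Real.sqrt (firstFund g X q).det ≤
      B * |tangent X 0 q a * tangent X 1 q b - tangent X 1 q a * tangent X 0 q b|) :
    ∫⁻ q in U, ENNReal.ofReal (Real.sqrt (firstFund g X q).det) ≤
      ENNReal.ofReal B * volume ((fun q => coordPair a b (X q)) '' U) := by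
  rw [← lintegral_abs_det_fderiv_eq_addHaar_image volume h.isOpen.measurableSet
    (fun _ hq => (h.hasFDerivAt_coordPair hq a b).hasFDerivWithinAt) hinj,
    ← lintegral_const_mul' _ _ ENNReal.ofReal_ne_top]
  refine setLIntegral_mono' h.isOpen.measurableSet fun q hq => ?_
  rw [← ENNReal.ofReal_mul hB, h.det_coordPair hq]
  exact ENNReal.ofReal_le_ofReal (hdet q hq)

/-- A vector orthogonal to an immersed patch. -/
theorem eq_zero_of_dot_tangent {i j k : Fin 3} (hk : ∀ l, l = i ∨ l = j ∨ l = k)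
    (hzero : ∀ a, tangent X a p k = 0) {α β : ℝ}
    (horth : ∀ a, α * tangent X a p i + β * tangent X a p j = 0) : α = 0 ∧ β = 0 := by
  have hker : ∀ c : Fin 2 → ℝ, (∀ l, c 0 * tangent X 0 p l + c 1 * tangent X 1 p l = 0) → c = 0 := by
    intro c hc
    apply h.immersed p hp
    rw [map_zero]
    have : c = c 0 • Pi.single 0 (1 : ℝ) + c 1 • Pi.single 1 (1 : ℝ) := by
      ext l; fin_cases l <;> simp
    rw [this, map_add, map_smul, map_smul]
    ext l
    simpa [h.tangent_eq hp] using hc l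
  have h0 := horth 0
  have h1 := horth 1
  by_contra hne
  -- A nonzero (α, β) makes this determinant vanish. The combinations tested below then lie in the
  -- kernel of dX, which is trivial; so the i and j components vanish, and with the k component
  -- already zero this contradicts immersion.
  have hdet : tangent X 0 p i * tangent X 1 p j = tangent X 1 p i * tangent X 0 p j := by
    by_contra hd
    apply hne
    have hd' := sub_ne_zero.2 hd
    constructor
    · apply (mul_eq_zero.1 (?_ : α * (tangent X 0 p i * tangent X 1 p j
        - tangent X 1 p i * tangent X 0 p j) = 0)).resolve_right hd'
      linear_combination tangent X 1 p j * h0 - tangent X 0 p j * h1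
    · apply (mul_eq_zero.1 (?_ : β * (tangent X 0 p i * tangent X 1 p j
        - tangent X 1 p i * tangent X 0 p j) = 0)).resolve_right hd'
      linear_combination tangent X 0 p i * h1 - tangent X 1 p i * h0
  have c1 := hker ![tangent X 1 p i, -tangent X 0 p i] (by
    intro l
    simp only [Matrix.cons_val_zero, Matrix.cons_val_one]
    rcases hk l with rfl | rfl | rfl
    · ring
    · linear_combination -hdet
    · rw [hzero, hzero]; ring)
  have c2 := hker ![tangent X 1 p j, -tangent X 0 p j] (by
    intro l
    simp only [Matrix.cons_val_zero, Matrix.cons_val_one]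
    rcases hk l with rfl | rfl | rfl
    · linear_combination hdet
    · ring
    · rw [hzero, hzero]; ring)
  have t1 : tangent X 1 p i = 0 := by simpa using congrFun c1 0
  have t2 : tangent X 1 p j = 0 := by simpa using congrFun c2 0
  have := hker ![0, 1] (by
    intro l
    simp only [Matrix.cons_val_zero, Matrix.cons_val_one]
    rcases hk l with rfl | rfl | rfl <;> simp [t1, t2, hzero])
  simpa using congrFun this 1

end IsPatch

/-- A combination of several bounds on patches. -/
theorem area_le_of_patches {g : MetricField} {S : Set (S2 × Circle)} {a b : Fin 3} {B : ℝ}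
    (hB : 0 ≤ B) {ι : Type*} [Countable ι] (s : ι → Fin 2 → ℝ) {C : Set (Fin 2 → ℝ)}
    (hC : MeasurableSet C)
    (hdet : ∀ U X, IsPatch S U X → ∀ q ∈ U, Real.sqrt (firstFund g X q).det ≤
      B * |tangent X 0 q a * tangent X 1 q b - tangent X 1 q a * tangent X 0 q b|)
    (hcover : ∀ x ∈ polarDomain, polar x ∈ S → ∃ n, coordPair a b x - s n ∈ C)
    (hs : ∀ x ∈ polarDomain, ∀ y ∈ polarDomain, polar x ∈ S → polar y ∈ S → ∀ n m,
      coordPair a b x - s n = coordPair a b y - s m → polar x = polar y)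
    (hs0 : Function.Injective s) :
    area g S ≤ ENNReal.ofReal B * volume C := by
  refine iSup_le fun N => iSup_le fun U => iSup_le fun X => iSup_le fun hX => iSup_le fun hd => ?_
  -- A point of the surface is determined by its coordinate pair modulo the translations `s`. Thus
  -- disjointness and injectivity of the patches in S² × S¹ become disjointness and injectivity
  -- modulo `s` of their planar images.
  have hpolar : ∀ j k, ∀ p ∈ U j, ∀ q ∈ U k, ∀ n m,
      coordPair a b (X j p) - s n = coordPair a b (X k q) - s m → j = k ∧ n = m := by
    intro j k p hp q hq n m he
    have h1 := hs _ ((hX j).1.mem_domain p hp) _ ((hX k).1.mem_domain q hq)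
      ((hX j).1.mem_surface p hp) ((hX k).1.mem_surface q hq) n m he
    have hjk : j = k := by
      by_contra hne
      exact Set.disjoint_left.1 (hd hne) (mem_image_of_mem _ hp) (h1 ▸ mem_image_of_mem _ hq)
    subst hjk
    have hpq := (hX j).2 hp hq h1
    subst hpq
    exact ⟨rfl, hs0 (sub_right_injective he)⟩
  have hinj : ∀ j, InjOn (fun q => coordPair a b (X j q)) (U j) := by
    intro j p hp q hq he
    obtain ⟨n, -⟩ := hcover _ ((hX j).1.mem_domain p hp) ((hX j).1.mem_surface p hp)
    refine (hX j).2 hp hq (hs _ ((hX j).1.mem_domain p hp) _ ((hX j).1.mem_domain q hq)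
      ((hX j).1.mem_surface p hp) ((hX j).1.mem_surface q hq) n n ?_)
    simp only at he
    rw [he]
  calc ∑ j, ∫⁻ p in U j, ENNReal.ofReal (Real.sqrt (firstFund g (X j) p).det)
      ≤ ∑ j, ENNReal.ofReal B * volume ((fun q => coordPair a b (X j q)) '' U j) :=
        Finset.sum_le_sum fun j _ =>
          (hX j).1.lintegral_area_le hB (hinj j) (hdet _ _ (hX j).1)
    _ = ENNReal.ofReal B * ∑ j, volume ((fun q => coordPair a b (X j q)) '' U j) := by
        rw [Finset.mul_sum]
    _ ≤ ENNReal.ofReal B * volume C := by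
        gcongr
        refine sum_volume_le_of_translates s hC
          (fun j => (hX j).1.measurableSet_image_coordPair (hinj j)) ?_ ?_
        · rintro j _ ⟨p, hp, rfl⟩
          exact hcover _ ((hX j).1.mem_domain p hp) ((hX j).1.mem_surface p hp)
        · rintro j k n m y ⟨p, hp, hpy⟩ ⟨q, hq, hqy⟩
          simp only at hpy hqy
          exact hpolar j k p hp q hq n m (by rw [hpy, hqy]; simp)

/-! ### Two minimal surfaces -/

theorem exists_spherePt {p : S2} (hp : |(p : EuclideanSpace ℝ (Fin 3)) 2| < 1) :
    ∃ r ∈ Ioo (0 : ℝ) 2, ∃ θ, p = spherePt r θ := by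
  have hpi := Real.pi_pos
  set z := (p : EuclideanSpace ℝ (Fin 3)) 2 with hz
  rw [abs_lt] at hp
  refine ⟨2 / Real.pi * Real.arccos z, ⟨?_, ?_⟩, ?_⟩
  · have := Real.arccos_pos.2 hp.2
    positivity
  · have h1 : Real.arccos z < Real.pi := by
      refine lt_of_le_of_ne (Real.arccos_le_pi z) fun h => ?_
      rw [Real.arccos_eq_pi] at h
      linarith [hp.1]
    calc 2 / Real.pi * Real.arccos z < 2 / Real.pi * Real.pi := by gcongr
      _ = 2 := by field_simp
  · set w : ℂ := ⟨(p : EuclideanSpace ℝ (Fin 3)) 0, (p : EuclideanSpace ℝ (Fin 3)) 1⟩ with hw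
    have hnorm : (p : EuclideanSpace ℝ (Fin 3)) 0 ^ 2 + (p : EuclideanSpace ℝ (Fin 3)) 1 ^ 2
        + z ^ 2 = 1 := by
      have := p.2
      rw [mem_sphere_zero_iff_norm, EuclideanSpace.norm_eq, Real.sqrt_eq_one] at this
      simpa [Fin.sum_univ_three] using this
    have hwn : ‖w‖ = Real.sqrt (1 - z ^ 2) := by
      rw [Complex.norm_def, Complex.normSq_apply]
      congr 1
      simp only [hw]
      linarith
    have harg : Real.pi * (2 / Real.pi * Real.arccos z) / 2 = Real.arccos z := by field_simp
    refine ⟨Complex.arg w, ?_⟩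
    apply Subtype.ext
    ext i
    fin_cases i
    · simp [spherePt, harg, Real.sin_arccos]
      rw [← hwn, Complex.norm_mul_cos_arg]
    · simp [spherePt, harg, Real.sin_arccos]
      rw [← hwn, Complex.norm_mul_sin_arg]
    · simp [spherePt, harg, Real.cos_arccos hp.1.le hp.2.le, ← hz]

theorem continuous_polar : Continuous polar := contMDiff_polar.continuous

theorem contMDiff_circle_im :
    ContMDiff ((𝓡 2).prod (𝓡 1)) 𝓘(ℝ, ℝ) ∞ (fun q : S2 × Circle => (q.2 : ℂ).im) := by
  have : Fact (Module.finrank ℝ ℂ = 1 + 1) := finrank_real_complex_fact'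
  have h1 : ContMDiff (𝓡 1) 𝓘(ℝ, ℂ) ∞ (fun z : Circle => (z : ℂ)) := contMDiff_coe_sphere
  have h2 : ContMDiff 𝓘(ℝ, ℂ) 𝓘(ℝ, ℝ) ∞ (fun z : ℂ => z.im) := by
    rw [contMDiff_iff_contDiff]; exact Complex.imCLM.contDiff
  exact h2.comp (h1.comp contMDiff_snd)

theorem contMDiff_sphere_coord (c : ℝ) : ContMDiff ((𝓡 2).prod (𝓡 1)) 𝓘(ℝ, ℝ) ∞
    (fun q : S2 × Circle => (q.1 : EuclideanSpace ℝ (Fin 3)) 2 - c) := by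
  have := Fact.mk (@finrank_euclideanSpace_fin ℝ _ (2 + 1))
  have h1 : ContMDiff (𝓡 2) 𝓘(ℝ, EuclideanSpace ℝ (Fin 3)) ∞
    (fun z : S2 => (z : EuclideanSpace ℝ (Fin 3))) := contMDiff_coe_sphere
  have h2 : ContMDiff 𝓘(ℝ, EuclideanSpace ℝ (Fin 3)) 𝓘(ℝ, ℝ) ∞
      (fun z : EuclideanSpace ℝ (Fin 3) => z 2 - c) := by
    rw [contMDiff_iff_contDiff]; fun_prop
  exact h2.comp (h1.comp contMDiff_fst)

/-- A function with nonzero derivative along a coordinate line has nonzero differential. -/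
theorem mfderiv_ne_zero_of_polar {f : S2 × Circle → ℝ} {x : Coord} {k : Fin 3}
    (hf : ContMDiff ((𝓡 2).prod (𝓡 1)) 𝓘(ℝ, ℝ) ∞ f) (h : pd k (fun y => f (polar y)) x ≠ 0) :
    mfderiv ((𝓡 2).prod (𝓡 1)) 𝓘(ℝ, ℝ) f (polar x) ≠ 0 := by
  intro h0
  apply h
  have h1 : mfderiv 𝓘(ℝ, Coord) 𝓘(ℝ, ℝ) (f ∘ polar) x = 0 := by
    rw [mfderiv_comp x (hf.mdifferentiable (by simp) _) (contMDiff_polar.mdifferentiable (by simp) _),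
      h0]
    exact ContinuousLinearMap.zero_comp _
  rw [mfderiv_eq_fderiv] at h1
  rw [pd]
  exact congrArg (fun L : Coord →L[ℝ] ℝ => L (Pi.single k 1)) h1

theorem exists_spherePt' (p : S2) : ∃ r θ, p = spherePt r θ := by
  by_cases h : |(p : EuclideanSpace ℝ (Fin 3)) 2| < 1
  · obtain ⟨r, -, θ, h⟩ := exists_spherePt h
    exact ⟨r, θ, h⟩
  · have hnorm : (p : EuclideanSpace ℝ (Fin 3)) 0 ^ 2 + (p : EuclideanSpace ℝ (Fin 3)) 1 ^ 2
        + (p : EuclideanSpace ℝ (Fin 3)) 2 ^ 2 = 1 := by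
      have := p.2
      rw [mem_sphere_zero_iff_norm, EuclideanSpace.norm_eq, Real.sqrt_eq_one] at this
      simpa [Fin.sum_univ_three] using this
    push Not at h
    have h1 : 1 ≤ (p : EuclideanSpace ℝ (Fin 3)) 2 ^ 2 := (one_le_sq_iff_one_le_abs _).2 h
    have h2 : (p : EuclideanSpace ℝ (Fin 3)) 0 = 0 := by
      nlinarith [sq_nonneg ((p : EuclideanSpace ℝ (Fin 3)) 0),
        sq_nonneg ((p : EuclideanSpace ℝ (Fin 3)) 1)]
    have h3 : (p : EuclideanSpace ℝ (Fin 3)) 1 = 0 := by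
      nlinarith [sq_nonneg ((p : EuclideanSpace ℝ (Fin 3)) 0),
        sq_nonneg ((p : EuclideanSpace ℝ (Fin 3)) 1)]
    have h4 : (p : EuclideanSpace ℝ (Fin 3)) 2 ^ 2 = 1 := by rw [h2, h3] at hnorm; linarith
    rcases sq_eq_one_iff.1 h4 with h5 | h5
    · refine ⟨0, 0, Subtype.ext ?_⟩
      ext i
      fin_cases i <;> simp [spherePt, h2, h3, h5]
    · refine ⟨2, 0, Subtype.ext ?_⟩
      ext i
      fin_cases i <;> simp [spherePt, h2, h3, h5]

theorem exists_polar (q : S2 × Circle) : ∃ x, polar x = q := by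
  obtain ⟨r, θ, h⟩ := exists_spherePt' q.1
  refine ⟨![r, θ, Complex.arg q.2], ?_⟩
  ext1
  · exact h.symm
  · exact Circle.exp_arg q.2

/-- The totally geodesic sphere `S² × {1}`. -/
def slice : Set (S2 × Circle) := {q | q.2 = 1}

theorem isClosedSurface_slice : IsClosedSurface slice where
  compact := (isClosed_eq continuous_snd continuous_const).isCompact
  connected := by
    have h1 : IsConnected (univ : Set S2) := by
      rw [← Set.image_univ_of_surjective (f := fun p : S2 => p) Function.surjective_id, image_id',
        ← connectedSpace_iff_univ]
      exact isConnected_iff_connectedSpace.1 (isConnected_sphere (by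
        rw [← Module.finrank_eq_rank, finrank_euclideanSpace_fin]; norm_num) _ zero_le_one)
    have h2 : slice = (fun p : S2 => (p, (1 : Circle))) '' univ := by
      ext ⟨p, z⟩
      simp [slice, eq_comm]
    rw [h2]
    exact h1.image _ (by fun_prop)
  embedded := by
    intro p hp
    -- Im z also vanishes at z = -1, so the defining function is restricted to Re z > 0; there its
    -- ξ-derivative, cos ξ = Re z, is nonzero.
    refine ⟨{q | 0 < (q.2 : ℂ).re}, ?_, ?_, fun q => (q.2 : ℂ).im, contMDiff_circle_im.contMDiffOn,
      ?_, ?_⟩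
    · exact isOpen_lt continuous_const (by fun_prop)
    · rw [slice, mem_ofPred_eq] at hp
      simp [hp]
    · intro q hq
      obtain ⟨x, rfl⟩ := exists_polar q
      refine mfderiv_ne_zero_of_polar (k := 2) contMDiff_circle_im ?_
      have hq' : 0 < Real.cos (x 2) := by
        simpa [polar, Circle.coe_exp, Complex.exp_ofReal_mul_I_re] using hq
      have : (fun y : Coord => ((polar y).2 : ℂ).im) = fun y => Real.sin (y 2) := by
        funext y
        simp [polar, Circle.coe_exp, Complex.exp_ofReal_mul_I_im]
      rw [this, pd_comp_coord Real.differentiableAt_sin]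
      simpa using hq'.ne'
    · intro q hq
      rw [slice, mem_ofPred_eq]
      constructor
      · intro h; simp [h]
      · intro h
        have h1 : (q.2 : ℂ).re = 1 := by
          have h2 : Complex.normSq (q.2 : ℂ) = 1 := Circle.normSq_coe q.2
          have h' : (q.2 : ℂ).im = 0 := h
          rw [Complex.normSq_apply, h', mul_zero, add_zero] at h2
          have h3 : (0 : ℝ) < (q.2 : ℂ).re := hq
          nlinarith
        exact Circle.ext (Complex.ext (by simpa using h1) (by simpa using h))

/-- The torus `{r = r₀}`. -/
def torus (r₀ : ℝ) : Set (S2 × Circle) := polar '' {x | x 0 = r₀}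

theorem isClosedSurface_torus {r₀ : ℝ} (hr : r₀ ∈ Ioo (0 : ℝ) 2) :
    IsClosedSurface (torus r₀) := by
  have hpi := Real.pi_pos
  have hcos : |Real.cos (Real.pi * r₀ / 2)| < 1 := by
    have h1 := Real.sin_sq_add_cos_sq (Real.pi * r₀ / 2)
    have h2 := sin_half_pi_pos hr
    rw [← sq_lt_one_iff_abs_lt_one]
    nlinarith
  have hmem : ∀ q : S2 × Circle, q ∈ torus r₀ ↔
      (q.1 : EuclideanSpace ℝ (Fin 3)) 2 = Real.cos (Real.pi * r₀ / 2) := by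
    intro q
    constructor
    · rintro ⟨x, hx, rfl⟩
      rw [mem_ofPred_eq] at hx
      simp [polar, spherePt, hx]
    · intro h
      obtain ⟨r, hr', θ, h1⟩ := exists_spherePt (p := q.1) (by rw [h]; exact hcos)
      refine ⟨![r, θ, Complex.arg q.2], ?_, ?_⟩
      · rw [h1] at h
        have h2 : Real.cos (Real.pi * r / 2) = Real.cos (Real.pi * r₀ / 2) := by
          simpa [spherePt] using h
        have := Real.injOn_cos ⟨by nlinarith [hr'.1], by nlinarith [hr'.2]⟩
          ⟨by nlinarith [hr.1], by nlinarith [hr.2]⟩ h2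
        field_simp at this
        exact this
      · ext1
        · exact h1.symm
        · exact Circle.exp_arg q.2
  have hset : torus r₀ = {q | (q.1 : EuclideanSpace ℝ (Fin 3)) 2 = Real.cos (Real.pi * r₀ / 2)} :=
    Set.ext hmem
  refine ⟨?_, ?_, ?_⟩
  · rw [hset]
    exact (isClosed_eq (by fun_prop) continuous_const).isCompact
  · refine IsConnected.image (s := {x : Coord | x 0 = r₀}) ⟨⟨fun _ => r₀, rfl⟩, ?_⟩ _
      continuous_polar.continuousOn
    apply Convex.isPreconnected
    exact convex_hyperplane (f := fun x : Coord => x 0) ⟨fun _ _ => rfl, fun _ _ => rfl⟩ r₀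
  · intro p hp
    -- The height function is critical only at the poles, which this neighbourhood omits.
    refine ⟨{q | |(q.1 : EuclideanSpace ℝ (Fin 3)) 2| < 1}, ?_, ?_,
      fun q => (q.1 : EuclideanSpace ℝ (Fin 3)) 2 - Real.cos (Real.pi * r₀ / 2),
      (contMDiff_sphere_coord _).contMDiffOn, ?_, ?_⟩
    · exact isOpen_lt (by fun_prop) continuous_const
    · rw [mem_ofPred_eq, (hmem p).1 hp]; exact hcos
    · intro q hq
      obtain ⟨r, hr', θ, h1⟩ := exists_spherePt (p := q.1) hq
      have h2 : polar ![r, θ, Complex.arg q.2] = q := by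
        ext1
        · exact h1.symm
        · exact Circle.exp_arg q.2
      rw [← h2]
      refine mfderiv_ne_zero_of_polar (k := 0) (contMDiff_sphere_coord _) ?_
      have : (fun y : Coord => ((polar y).1 : EuclideanSpace ℝ (Fin 3)) 2
          - Real.cos (Real.pi * r₀ / 2)) =
          fun y => (fun t => Real.cos (Real.pi * t / 2) - Real.cos (Real.pi * r₀ / 2)) (y 0) := by
        funext y
        simp [polar, spherePt]
      have hd : HasDerivAt (fun t => Real.cos (Real.pi * t / 2) - Real.cos (Real.pi * r₀ / 2))
          (-Real.sin (Real.pi * r / 2) * (Real.pi / 2)) r := by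
        have h : HasDerivAt (fun r : ℝ => Real.pi * r / 2) (Real.pi / 2) r := by
          simpa using ((hasDerivAt_id r).const_mul Real.pi).div_const 2
        exact h.cos.sub_const _
      rw [this, pd_comp_coord (f := fun t => Real.cos (Real.pi * t / 2)
        - Real.cos (Real.pi * r₀ / 2)) hd.differentiableAt]
      simp only [if_true, Matrix.cons_val_zero]
      rw [hd.deriv]
      have := sin_half_pi_pos hr'
      have : 0 < Real.sin (Real.pi * r / 2) * (Real.pi / 2) := by positivity
      intro h0
      linarith
    · intro q _
      rw [hmem, sub_eq_zero]

/-! ### Minimality and area of the sphere and the tori. -/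

theorem sum_diagonal {d : Fin 3 → ℝ} (a b : Fin 3 → ℝ) :
    ∑ i, ∑ j, (Matrix.diagonal d : Matrix (Fin 3) (Fin 3) ℝ) i j * a i * b j =
      d 0 * a 0 * b 0 + d 1 * a 1 * b 1 + d 2 * a 2 * b 2 := by
  simp [Fin.sum_univ_three, Matrix.diagonal_apply]

theorem firstFund_logMetric (u : ℝ → ℝ) (ψ : Coord → ℝ) (X : (Fin 2 → ℝ) → Coord) (p : Fin 2 → ℝ)
    (a b : Fin 2) : firstFund (logMetric u ψ) X p a b =
      (Real.exp (ψ (X p)) ^ 2)⁻¹ * tangent X a p 0 * tangent X b p 0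
      + u (X p 0) ^ 2 * (Real.exp (ψ (X p)) ^ 2)⁻¹ * tangent X a p 1 * tangent X b p 1
      + Real.exp (ψ (X p)) ^ 2 * tangent X a p 2 * tangent X b p 2 := by
  rw [firstFund, logMetric, sum_diagonal]
  simp [uExp, eExp, zpow_ofNat, zpow_neg]

theorem pd_eq_zero_of_eqOn {U : Set (Fin 2 → ℝ)} (hU : IsOpen U) {f : (Fin 2 → ℝ) → ℝ} {c : ℝ}
    (h : ∀ q ∈ U, f q = c) {p : Fin 2 → ℝ} (hp : p ∈ U) (a : Fin 2) : pd a f p = 0 := by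
  rw [pd_congr (g := fun _ => c) (by filter_upwards [hU.mem_nhds hp] with q hq using h q hq),
    pd_const]

/-- The coordinate ξ is known only modulo 2π on the slice. Differentiating sin ξ = 0 where cos ξ = 1
avoids choosing a branch. -/
theorem tangent_slice {U : Set (Fin 2 → ℝ)} {X : (Fin 2 → ℝ) → Coord} (h : IsPatch slice U X)
    {p : Fin 2 → ℝ} (hp : p ∈ U) (a : Fin 2) : tangent X a p 2 = 0 := by
  have h1 : ∀ q ∈ U, Circle.exp (X q 2) = 1 := fun q hq => h.mem_surface q hq
  have hcos : Real.cos (X p 2) = 1 := by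
    have := congrArg (fun z : Circle => (z : ℂ).re) (h1 p hp)
    simpa [Circle.coe_exp, Complex.exp_ofReal_mul_I_re] using this
  have hsin : ∀ q ∈ U, Real.sin (X q 2) = 0 := by
    intro q hq
    have := congrArg (fun z : Circle => (z : ℂ).im) (h1 q hq)
    simpa [Circle.coe_exp, Complex.exp_ofReal_mul_I_im] using this
  have h2 := pd_eq_zero_of_eqOn h.isOpen hsin hp a
  rw [pd_eq_of_hasFDerivAt (h.differentiableAt_coord hp 2).hasFDerivAt.sin, hcos, one_smul] at h2
  exact h2

theorem spherePt_eq_of_polar_eq {x y : Coord} (h : polar x = polar y) :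
    spherePt (x 0) (x 1) = spherePt (y 0) (y 1) := congrArg Prod.fst h

theorem patch_torus {r₀ : ℝ} (hr : r₀ ∈ Ioo (0 : ℝ) 2) {x : Coord} (hx : x ∈ polarDomain)
    (h : polar x ∈ torus r₀) : x 0 = r₀ := by
  obtain ⟨y, hy, hxy⟩ := h
  have := spherePt_radius_inj (hy ▸ Ioo_subset_Icc_self hr) (Ioo_subset_Icc_self hx)
    (spherePt_eq_of_polar_eq hxy)
  rw [← this]; exact hy

theorem tangent_torus {r₀ : ℝ} (hr : r₀ ∈ Ioo (0 : ℝ) 2) {U : Set (Fin 2 → ℝ)}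
    {X : (Fin 2 → ℝ) → Coord} (h : IsPatch (torus r₀) U X) {p : Fin 2 → ℝ} (hp : p ∈ U)
    (a : Fin 2) : tangent X a p 0 = 0 :=
  pd_eq_zero_of_eqOn h.isOpen
    (fun q hq => patch_torus hr (h.mem_domain q hq) (h.mem_surface q hq)) hp a

namespace SmoothPair

variable {u : ℝ → ℝ} {ψ : Coord → ℝ} (h : SmoothPair u ψ)
include h

/-- A normal vector has only a ξ component, and Γ^ξ_ij = 0 for i, j among r, θ because the metric is
diagonal and independent of ξ. -/
theorem isClosedMinimalSurface_slice : IsClosedMinimalSurface (logMetric u ψ) slice := by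
  refine ⟨isClosedSurface_slice, fun U X hX p hp ν hν => ?_⟩
  have hx := hX.mem_domain p hp
  have hu := h.u_pos _ hx
  have hE := Real.exp_pos (ψ (X p))
  simp only [logMetric, sum_diagonal, tangent_slice hX hp, mul_zero, add_zero] at hν
  have h1 := hX.eq_zero_of_dot_tangent hp (i := 0) (j := 1) (k := 2) (by decide)
    (tangent_slice hX hp) hν
  have h2 : tracedHessian (logMetric u ψ) X p 2 = 0 := by
    rw [tracedHessian]
    refine Finset.sum_eq_zero fun a _ => Finset.sum_eq_zero fun b _ => ?_
    rw [pd_eq_zero_of_eqOn hX.isOpen (fun q hq => tangent_slice hX hq b) hp]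
    simp only [h.christoffel_eq hx]
    simp [Fin.sum_univ_three, tangent_slice hX hp, chr]
  simp only [logMetric, sum_diagonal]
  rw [h1.1, h1.2, h2]
  ring

/-- The normal is radial, and tracing Γ^r over the θ, ξ directions gives e^{2ψ}(-u'/u + ψ_r) -
e^{2ψ}ψ_r: the contributions of ψ cancel, so only u' = 0 is needed, whatever φ is. -/
theorem isClosedMinimalSurface_torus {r₀ : ℝ} (hr : r₀ ∈ Ioo (0 : ℝ) 2) (hd : deriv u r₀ = 0) :
    IsClosedMinimalSurface (logMetric u ψ) (torus r₀) := by
  refine ⟨isClosedSurface_torus hr, fun U X hX p hp ν hν => ?_⟩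
  have hx := hX.mem_domain p hp
  have hx0 := patch_torus hr hx (hX.mem_surface p hp)
  have hu := (h.u_pos _ hr).ne'
  have hE := (Real.exp_pos (ψ (X p))).ne'
  have ht : ∀ a, tangent X a p 0 = 0 := tangent_torus hr hX hp
  simp only [logMetric, sum_diagonal, ht, mul_zero, zero_add] at hν
  have h1 := hX.eq_zero_of_dot_tangent hp (i := 1) (j := 2) (k := 0) (by decide) ht hν
  have h2 : tracedHessian (logMetric u ψ) X p 0 = 0 := by
    rw [tracedHessian]
    have h3 : ∀ a b, pd a (fun q => tangent X b q 0) p = 0 := fun a b =>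
      pd_eq_zero_of_eqOn hX.isOpen (fun q hq => tangent_torus hr hX hq b) hp a
    simp only [h.christoffel_eq hx, h3, hx0, hd]
    simp only [Matrix.inv_def, Matrix.adjugate_fin_two, firstFund_logMetric, ht, hx0]
    simp [Fin.sum_univ_three, Fin.sum_univ_two, ht, chr]
    field_simp
    ring
  simp only [logMetric, sum_diagonal]
  rw [h1.1, h1.2, h2]
  ring

theorem area_slice_le {B : ℝ} (hB : ∀ x ∈ polarDomain, u (x 0) * (Real.exp (ψ x) ^ 2)⁻¹ ≤ B) :
    area (logMetric u ψ) slice ≤ ENNReal.ofReal (B * (4 * Real.pi)) := by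
  have hpi := Real.pi_pos
  have hB0 : 0 ≤ B := by
    have h1 : (1 : ℝ) ∈ Ioo (0 : ℝ) 2 := by norm_num
    have h2 := hB (fun _ => 1) h1
    have := h.u_pos 1 h1
    exact le_trans (by positivity) h2
  let C : Set (Fin 2 → ℝ) := Set.pi univ ![Ioo 0 2, Ico 0 (2 * Real.pi)]
  have hCm : MeasurableSet C := by
    refine MeasurableSet.univ_pi fun i => ?_
    fin_cases i
    · exact measurableSet_Ioo
    · exact measurableSet_Ico
  have hvol : volume C = ENNReal.ofReal (4 * Real.pi) := by
    rw [volume_pi_pi, Fin.prod_univ_two]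
    simp only [Matrix.cons_val_zero, Matrix.cons_val_one, Real.volume_Ioo, Real.volume_Ico]
    rw [← ENNReal.ofReal_mul (by norm_num)]
    congr 1; ring
  rw [ENNReal.ofReal_mul hB0, ← hvol]
  refine area_le_of_patches (a := 0) (b := 1) hB0
    (fun n : ℤ => ![0, n * (2 * Real.pi)]) hCm ?_ ?_ ?_ ?_
  · intro U X hX q hq
    have hx := hX.mem_domain q hq
    have hu := h.u_pos _ hx
    have ht := tangent_slice hX hq
    have e : (firstFund (logMetric u ψ) X q).det = (u (X q 0) * (Real.exp (ψ (X q)) ^ 2)⁻¹ *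
        (tangent X 0 q 0 * tangent X 1 q 1 - tangent X 1 q 0 * tangent X 0 q 1)) ^ 2 := by
      simp only [Matrix.det_fin_two, firstFund_logMetric, ht]
      ring
    rw [e, Real.sqrt_sq_eq_abs, abs_mul, abs_of_nonneg (by positivity)]
    gcongr
    exact hB _ hx
  · intro x hx _
    refine ⟨⌊x 1 / (2 * Real.pi)⌋, ?_⟩
    have h1 := Int.floor_le (x 1 / (2 * Real.pi))
    have h2 := Int.lt_floor_add_one (x 1 / (2 * Real.pi))
    rw [le_div_iff₀ (by positivity)] at h1
    rw [div_lt_iff₀ (by positivity)] at h2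
    intro i _
    fin_cases i
    · have hx' : 0 < x 0 ∧ x 0 < 2 := hx
      simpa [coordPair] using hx'
    · constructor <;> simp [coordPair] <;> linarith
  · intro x hx y hy hxS hyS n m he
    have e0 : x 0 = y 0 := by simpa [coordPair] using congrFun he 0
    have e1 : x 1 - n * (2 * Real.pi) = y 1 - m * (2 * Real.pi) := by
      simpa [coordPair] using congrFun he 1
    ext1
    · have : x 1 = y 1 + ((n - m : ℤ) : ℝ) * (2 * Real.pi) := by push_cast; linarith
      change spherePt (x 0) (x 1) = spherePt (y 0) (y 1)
      rw [e0, this, spherePt_add_int_mul]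
    · exact Eq.trans hxS (Eq.symm hyS)
  · intro n m hnm
    have h1 : (n : ℝ) * (2 * Real.pi) = m * (2 * Real.pi) := by simpa using congrFun hnm 1
    exact_mod_cast mul_right_cancel₀ (by positivity) h1

theorem area_torus_le {r₀ : ℝ} (hr : r₀ ∈ Ioo (0 : ℝ) 2) :
    area (logMetric u ψ) (torus r₀) ≤ ENNReal.ofReal (u r₀ * (4 * Real.pi ^ 2)) := by
  have hpi := Real.pi_pos
  have hu0 := h.u_pos r₀ hr
  let C : Set (Fin 2 → ℝ) := Set.pi univ fun _ => Ico 0 (2 * Real.pi)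
  have hCm : MeasurableSet C := MeasurableSet.univ_pi fun i => measurableSet_Ico
  have hvol : volume C = ENNReal.ofReal (4 * Real.pi ^ 2) := by
    rw [volume_pi_pi, Fin.prod_univ_two, Real.volume_Ico, ← ENNReal.ofReal_mul (by linarith)]
    congr 1; ring
  rw [ENNReal.ofReal_mul hu0.le, ← hvol]
  refine area_le_of_patches (a := 1) (b := 2) hu0.le
    (fun n : ℤ × ℤ => ![n.1 * (2 * Real.pi), n.2 * (2 * Real.pi)]) hCm ?_ ?_ ?_ ?_
  · intro U X hX q hq
    have hx := hX.mem_domain q hq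
    have hx0 := patch_torus hr hx (hX.mem_surface q hq)
    have ht : ∀ a, tangent X a q 0 = 0 := tangent_torus hr hX hq
    have hE := (Real.exp_pos (ψ (X q))).ne'
    -- The factors e^{-2ψ} and e^{2ψ} of the two tangential directions cancel, so the area element
    -- is u dθ dξ.
    have e : (firstFund (logMetric u ψ) X q).det = (u r₀ *
        (tangent X 0 q 1 * tangent X 1 q 2 - tangent X 1 q 1 * tangent X 0 q 2)) ^ 2 := by
      simp only [Matrix.det_fin_two, firstFund_logMetric, ht, hx0]
      field_simp
      ring
    rw [e, Real.sqrt_sq_eq_abs, abs_mul, abs_of_nonneg hu0.le]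
  · intro x hx _
    have key : ∀ t : ℝ, t - ⌊t / (2 * Real.pi)⌋ * (2 * Real.pi) ∈ Ico 0 (2 * Real.pi) := by
      intro t
      have h1 := Int.floor_le (t / (2 * Real.pi))
      have h2 := Int.lt_floor_add_one (t / (2 * Real.pi))
      rw [le_div_iff₀ (by positivity)] at h1
      rw [div_lt_iff₀ (by positivity)] at h2
      constructor <;> linarith
    refine ⟨(⌊x 1 / (2 * Real.pi)⌋, ⌊x 2 / (2 * Real.pi)⌋), fun i _ => ?_⟩
    fin_cases i
    · exact key (x 1)
    · exact key (x 2)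
  · intro x hx y hy hxS hyS n m he
    have e0 : x 0 = y 0 := (patch_torus hr hx hxS).trans (patch_torus hr hy hyS).symm
    have e1 : x 1 - n.1 * (2 * Real.pi) = y 1 - m.1 * (2 * Real.pi) := by
      simpa [coordPair] using congrFun he 0
    have e2 : x 2 - n.2 * (2 * Real.pi) = y 2 - m.2 * (2 * Real.pi) := by
      simpa [coordPair] using congrFun he 1
    ext1
    · have : x 1 = y 1 + ((n.1 - m.1 : ℤ) : ℝ) * (2 * Real.pi) := by push_cast; linarith
      change spherePt (x 0) (x 1) = spherePt (y 0) (y 1)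
      rw [e0, this, spherePt_add_int_mul]
    · have : x 2 = y 2 + ((n.2 - m.2 : ℤ) : ℝ) * (2 * Real.pi) := by push_cast; linarith
      change Circle.exp (x 2) = Circle.exp (y 2)
      rw [Circle.exp_eq_exp]
      exact ⟨n.2 - m.2, this⟩
  · rintro ⟨n, n'⟩ ⟨m, m'⟩ hnm
    have h1 : (n : ℝ) * (2 * Real.pi) = m * (2 * Real.pi) := by simpa using congrFun hnm 0
    have h2 : (n' : ℝ) * (2 * Real.pi) = m' * (2 * Real.pi) := by simpa using congrFun hnm 1
    have h3 : n = m := by exact_mod_cast mul_right_cancel₀ (by positivity) h1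
    have h4 : n' = m' := by exact_mod_cast mul_right_cancel₀ (by positivity) h2
    rw [h3, h4]

end SmoothPair

/-- The area bound for the sphere `S² × {1}`. -/
theorem IsWarpingPair.area_bound_slice {u : ℝ → ℝ} {φ : S2 → ℝ} (h : IsWarpingPair u φ) {A₀ : ℝ}
    (hA : ENNReal.ofReal A₀ ≤ MinA (warpedMetric u φ)) {B : ℝ}
    (hB : ∀ x ∈ polarDomain, u (x 0) * (Real.exp (logLift φ x) ^ 2)⁻¹ ≤ B) :
    A₀ ≤ B * (4 * Real.pi) := by
  rw [h.warpedMetric_eq_logMetric] at hA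
  have h1 : MinA (logMetric u (logLift φ)) ≤ area (logMetric u (logLift φ)) slice :=
    iInf₂_le slice h.smoothPair.isClosedMinimalSurface_slice
  have h2 := hA.trans (h1.trans (h.smoothPair.area_slice_le hB))
  refine (ENNReal.ofReal_le_ofReal_iff (mul_nonneg ?_ (by positivity))).1 h2
  have h3 : (1 : ℝ) ∈ Ioo (0 : ℝ) 2 := by norm_num
  have := h.u_pos 1 h3
  exact le_trans (by positivity) (hB (fun _ => 1) h3)

/-- The area bound for the torus over the largest circle of latitude. -/
theorem IsWarpingPair.area_bound_torus {u : ℝ → ℝ} {φ : S2 → ℝ} (h : IsWarpingPair u φ) {A₀ : ℝ}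
    (hA : ENNReal.ofReal A₀ ≤ MinA (warpedMetric u φ)) :
    ∃ r₀ ∈ Ioo (0 : ℝ) 2, A₀ / (4 * Real.pi ^ 2) ≤ u r₀ := by
  -- Rolle's theorem; any critical point of u serves.
  obtain ⟨r₀, hr₀, hd⟩ := exists_deriv_eq_zero (by norm_num : (0 : ℝ) < 2) h.continuousOn
    (h.u_zero.trans h.u_two.symm)
  refine ⟨r₀, hr₀, ?_⟩
  have hpi := Real.pi_pos
  rw [h.warpedMetric_eq_logMetric] at hA
  have h1 : MinA (logMetric u (logLift φ)) ≤ area (logMetric u (logLift φ)) (torus r₀) :=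
    iInf₂_le _ (h.smoothPair.isClosedMinimalSurface_torus hr₀ hd)
  have h2 := hA.trans (h1.trans (h.smoothPair.area_torus_le hr₀))
  rw [div_le_iff₀ (by positivity)]
  exact (ENNReal.ofReal_le_ofReal_iff (mul_nonneg (h.u_pos _ hr₀).le (by positivity))).1 h2

/-! ### Uniform bounds -/

theorem logLift_periodic (φ : S2 → ℝ) (r θ : ℝ) (n : ℤ) :
    logLift φ ![r, θ + n * (2 * Real.pi), 0] = logLift φ ![r, θ, 0] := by
  simp [logLift, polarLift, spherePt_add_int_mul]

theorem logLift_eq_vec (φ : S2 → ℝ) (x : Coord) : logLift φ x = logLift φ ![x 0, x 1, 0] :=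
  logLift_congr rfl rfl

/-- `log (r / (2 - r))`, whose derivative is `2 / (r (2 - r))`. -/
def poleLog (r : ℝ) : ℝ := Real.log r - Real.log (2 - r)

theorem hasDerivAt_poleLog {r : ℝ} (hr : r ∈ Ioo (0 : ℝ) 2) :
    HasDerivAt poleLog (2 / (r * (2 - r))) r := by
  have h1 := hr.1.ne'
  have h2 : 2 - r ≠ 0 := (sub_pos.2 hr.2).ne'
  have h3 : HasDerivAt (fun r : ℝ => 2 - r) (-1) r := by
    simpa using (hasDerivAt_id r).const_sub 2
  convert! (Real.hasDerivAt_log h1).fun_sub (h3.log h2) using 1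
  field_simp
  ring

theorem poleLog_one : poleLog 1 = 0 := by norm_num [poleLog]

/-! ### Oscillation estimates from explicit barriers. -/

namespace IsEnergyPair

variable {u : ℝ → ℝ} {φ : S2 → ℝ} (h : IsEnergyPair u φ) {m : ℝ} (hm : 0 < m)
  (hu : ∀ r ∈ Icc (0 : ℝ) 2, m * (r * (2 - r)) ≤ u r)
include h hm hu

/-- The barrier `poleLog` with K = 1/(2m) fits u ≥ m r(2 - r) exactly. The coefficient 1/2 of the
logarithm means that φ and 1/φ grow at most like the inverse square root of the distance to a pole.
-/
theorem abs_sub_meridian_le {r θ : ℝ} (hr : r ∈ Ioo (0 : ℝ) 2) :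
    |logLift φ ![r, θ, 0] - logLift φ ![1, θ, 0]| ≤ 1 / (2 * m) + |poleLog r| / 2 := by
  have hK : 0 < 1 / (2 * m) := by positivity
  have hb : ∀ t ∈ Ioo (0 : ℝ) 2, 1 ≤ 1 / (2 * m) * u t * (2 / (t * (2 - t))) := by
    intro t ht
    have h0 : 0 < t * (2 - t) := mul_pos ht.1 (sub_pos.2 ht.2)
    have h1 := hu t (Ioo_subset_Icc_self ht)
    have h2 := ht.1.ne'
    have h3 : 2 - t ≠ 0 := (sub_pos.2 ht.2).ne'
    calc (1 : ℝ) = 1 / (2 * m) * (m * (t * (2 - t))) * (2 / (t * (2 - t))) := by field_simp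
      _ ≤ _ := by gcongr
  rcases le_total r 1 with hle | hle
  · have := h.abs_sub_le_of_barrier (θ := θ) hK hr.1 hle (by norm_num) (L := poleLog)
      (fun t ht => hasDerivAt_poleLog ⟨hr.1.trans_le ht.1, by linarith [ht.2]⟩)
      (fun t ht => hb t ⟨hr.1.trans_le ht.1, by linarith [ht.2]⟩)
    rw [abs_sub_comm]
    rw [poleLog_one] at this
    linarith [neg_abs_le (poleLog r)]
  · have := h.abs_sub_le_of_barrier (θ := θ) hK one_pos hle hr.2 (L := poleLog)
      (fun t ht => hasDerivAt_poleLog ⟨by linarith [ht.1], ht.2.trans_lt hr.2⟩)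
      (fun t ht => hb t ⟨by linarith [ht.1], ht.2.trans_lt hr.2⟩)
    rw [poleLog_one] at this
    linarith [le_abs_self (poleLog r)]

/-- Away from the poles u ≥ mε, so a linear barrier suffices and K stays free. Small K followed by
small b - a gives a modulus of continuity in r that does not depend on the pair. -/
theorem abs_sub_slab_le {ε K a b θ : ℝ} (hε : 0 < ε) (hε1 : ε < 1) (hK : 0 < K) (ha : ε ≤ a)
    (hab : a ≤ b) (hb : b ≤ 2 - ε) :
    |logLift φ ![b, θ, 0] - logLift φ ![a, θ, 0]| ≤ K + (b - a) / (2 * K * (m * ε)) := by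
  have hμ : 0 < m * ε := mul_pos hm hε
  have := h.abs_sub_le_of_barrier (θ := θ) hK (hε.trans_le ha) hab (by linarith)
    (L := fun r => r / (K * (m * ε))) (L' := fun _ => 1 / (K * (m * ε)))
    (fun t _ => (hasDerivAt_id t).div_const _) (fun t ht => by
      have h1 := hu t ⟨by linarith [ht.1], by linarith [ht.2]⟩
      have h2 : m * ε ≤ u t := by
        refine le_trans ?_ h1
        have h3 : ε ≤ t := ha.trans ht.1
        have h4 : t ≤ 2 - ε := ht.2.trans hb
        gcongr
        nlinarith
      calc (1 : ℝ) = K * (m * ε) * (1 / (K * (m * ε))) := by field_simp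
        _ ≤ K * u t * (1 / (K * (m * ε))) := by gcongr)
  refine this.trans (le_of_eq ?_)
  field_simp

omit hm hu in
-- There is no uniform bound for u'' at a prescribed latitude. The mean value theorem for u' finds a
-- latitude in (a, b) with -u'' ≤ 2/(b - a), and there ψ_θ² ≤ -u u'' ≤ 2/(b - a).
theorem exists_abs_sub_circle_le {a b : ℝ} (ha : 0 < a) (hab : a < b) (hb : b < 2) :
    ∃ r ∈ Ioo a b, ∀ θ θ', |logLift φ ![r, θ, 0] - logLift φ ![r, θ', 0]| ≤
      Real.sqrt (2 / (b - a)) * |θ - θ'| := by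
  have hsub : ∀ r ∈ Icc a b, r ∈ Ioo (0 : ℝ) 2 := fun r hr =>
    ⟨ha.trans_le hr.1, hr.2.trans_lt hb⟩
  obtain ⟨r, hr, hr'⟩ := exists_deriv_eq_slope (deriv u) hab
    (fun t ht => (h.smoothPair.du_diff (hsub t ht)).continuousAt.continuousWithinAt)
    (fun t ht => (h.smoothPair.du_diff (hsub t (Ioo_subset_Icc_self ht))).differentiableWithinAt)
  refine ⟨r, hr, fun θ θ' => ?_⟩
  have hr2 := hsub r (Ioo_subset_Icc_self hr)
  have hbound : ∀ t, |pd 1 (logLift φ) ![r, t, 0]| ≤ Real.sqrt (2 / (b - a)) := by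
    intro t
    apply Real.abs_le_sqrt
    have h1 := h.sq_pd_one_le (x := ![r, t, 0]) hr2
    simp only [Matrix.cons_val_zero] at h1
    refine h1.trans ?_
    have h2 : u r ≤ 1 := by
      have := Ioo_subset_Icc_self hr2
      linarith [h.u_le_left this, h.u_le_right this]
    have h3 := h.deriv2_nonpos hr2
    have ha' := (abs_le.1 (h.abs_deriv_le (hsub a (left_mem_Icc.2 hab.le)))).2
    have hb' := (abs_le.1 (h.abs_deriv_le (hsub b (right_mem_Icc.2 hab.le)))).1
    have h4 : -deriv (deriv u) r ≤ 2 / (b - a) := by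
      rw [hr', ← neg_div]
      have : 0 < b - a := sub_pos.2 hab
      gcongr
      linarith
    nlinarith
  have hψ : ∀ t, HasDerivAt (fun t => logLift φ ![r, t, 0]) (pd 1 (logLift φ) ![r, t, 0]) t := by
    intro t
    have := hasDerivAt_pd (x := ![r, t, 0]) 1 (h.smoothPair.ψ_diff _)
    have e : (fun s => logLift φ (Function.update ![r, t, 0] 1 s)) =
        fun s => logLift φ ![r, s, 0] := by
      funext s
      exact logLift_congr (by simp) (by simp)
    rwa [e] at this
  have := convex_univ.norm_image_sub_le_of_norm_hasDerivWithin_le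
    (fun t _ => (hψ t).hasDerivWithinAt) (fun t _ => hbound t) (mem_univ θ') (mem_univ θ)
  simpa only [Real.norm_eq_abs] using this

/-- The path follows a meridian to the good circle of latitude, turns by θ - θ' along it, and
follows another meridian to r = a. -/
theorem abs_sub_angle_le {ε K a b θ θ' : ℝ} (hε : 0 < ε) (hε1 : ε < 1) (hK : 0 < K) (ha : ε ≤ a)
    (hab : a < b) (hb : b ≤ 2 - ε) {t : ℝ} (ht : t ∈ Icc a b) :
    |logLift φ ![t, θ, 0] - logLift φ ![a, θ', 0]| ≤
      2 * (K + (b - a) / (2 * K * (m * ε))) + Real.sqrt (2 / (b - a)) * |θ - θ'| := by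
  obtain ⟨r, hr, h1⟩ := h.exists_abs_sub_circle_le (hε.trans_le ha) hab (by linarith)
  have hosc : ∀ c ∈ Icc a b, ∀ d ∈ Icc a b, ∀ t,
      |logLift φ ![c, t, 0] - logLift φ ![d, t, 0]| ≤ K + (b - a) / (2 * K * (m * ε)) := by
    intro c hc d hd t
    have hμ : 0 < m * ε := mul_pos hm hε
    rcases le_total c d with hcd | hcd
    · rw [abs_sub_comm]
      refine (h.abs_sub_slab_le hm hu hε hε1 hK (ha.trans hc.1) hcd (hd.2.trans hb)).trans ?_
      gcongr
      · exact hd.2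
      · exact hc.1
    · refine (h.abs_sub_slab_le hm hu hε hε1 hK (ha.trans hd.1) hcd (hc.2.trans hb)).trans ?_
      gcongr
      · exact hc.2
      · exact hd.1
  have hr' := Ioo_subset_Icc_self hr
  have e1 := hosc t ht r hr' θ
  have e2 := h1 θ θ'
  have e3 := hosc r hr' a (left_mem_Icc.2 hab.le) θ'
  rw [abs_le] at *
  constructor <;> linarith

theorem abs_sub_center_le {x : Coord} (hx : x ∈ polarDomain) :
    |logLift φ x - logLift φ ![1, 0, 0]| ≤
      (1 / (2 * m) + 2 * (1 + 1 / (2 * m)) + 4 * Real.pi) + |poleLog (x 0)| / 2 := by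
  have hpi := Real.pi_pos
  set n : ℤ := ⌊x 1 / (2 * Real.pi)⌋
  set θ := x 1 + (-n : ℤ) * (2 * Real.pi) with hθ
  have h1 := Int.floor_le (x 1 / (2 * Real.pi))
  have h2 := Int.lt_floor_add_one (x 1 / (2 * Real.pi))
  rw [le_div_iff₀ (by positivity)] at h1
  rw [div_lt_iff₀ (by positivity)] at h2
  have hθ0 : |θ - 0| ≤ 2 * Real.pi := by
    rw [sub_zero, abs_le, hθ]
    push_cast
    constructor <;> linarith
  have e1 := h.abs_sub_meridian_le hm hu (θ := θ) hx
  -- A slab of width 1/2 has angular slope √4 = 2; with an angle of at most 2π this is the term 4π.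
  have e2 := h.abs_sub_angle_le hm hu (ε := 1 / 2) (K := 1) (a := 1) (b := 3 / 2) (t := 1)
    (θ := θ) (θ' := 0) (by norm_num) (by norm_num) one_pos (by norm_num) (by norm_num)
    (by norm_num) (by norm_num)
  have e3 : Real.sqrt (2 / (3 / 2 - 1)) = 2 := by
    rw [show (2 / (3 / 2 - 1) : ℝ) = 2 ^ 2 by norm_num]
    exact Real.sqrt_sq (by norm_num)
  have e4 : logLift φ x = logLift φ ![x 0, θ, 0] := by
    rw [hθ, logLift_periodic, ← logLift_eq_vec]
  have e5 : (3 / 2 - 1 : ℝ) / (2 * 1 * (m * (1 / 2))) = 1 / (2 * m) := by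
    field_simp; norm_num
  rw [e3, e5] at e2
  rw [e4]
  rw [abs_le] at e1 e2 ⊢
  constructor <;> linarith

end IsEnergyPair

/-- Applied with t = u(r): the vanishing of u at the poles absorbs the blow-up of e^{-2ψ}, so the
area density of the sphere S² × {1} stays bounded. -/
theorem exp_abs_poleLog_le {r t : ℝ} (hr : r ∈ Ioo (0 : ℝ) 2) (h1 : t ≤ r)
    (h2 : t ≤ 2 - r) : t * Real.exp |poleLog r| ≤ 2 := by
  have hr1 := hr.1
  have hr2 : 0 < 2 - r := sub_pos.2 hr.2
  rcases abs_cases (poleLog r) with ⟨h, -⟩ | ⟨h, -⟩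
  · rw [h, poleLog, Real.exp_sub, Real.exp_log hr1, Real.exp_log hr2]
    calc t * (r / (2 - r)) ≤ (2 - r) * (r / (2 - r)) := by gcongr
      _ = r := by field_simp
      _ ≤ 2 := hr.2.le
  · rw [h, poleLog, neg_sub, Real.exp_sub, Real.exp_log hr1, Real.exp_log hr2]
    calc t * ((2 - r) / r) ≤ r * ((2 - r) / r) := by gcongr
      _ = 2 - r := by field_simp
      _ ≤ 2 := by linarith

theorem volume_boxEps {ε : ℝ} (hε1 : ε < 1) :
    volume (boxEps ε) = ENNReal.ofReal ((2 - 2 * ε) * (4 * Real.pi ^ 2)) := by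
  have hpi := Real.pi_pos
  rw [boxEps_eq_Icc, Real.volume_Icc_pi, Fin.prod_univ_three]
  simp only [Matrix.cons_val_zero, Matrix.cons_val_one, Matrix.cons_val]
  rw [← ENNReal.ofReal_mul (by linarith), ← ENNReal.ofReal_mul (by nlinarith)]
  congr 1; ring

/-- The bounds that hold uniformly along a sequence of metrics satisfying the hypotheses of the
theorem. -/
structure HasUniformBounds (m C : ℝ) (u : ℝ → ℝ) (φ : S2 → ℝ) : Prop extends IsEnergyPair u φ where
  le_u : ∀ r ∈ Icc (0 : ℝ) 2, m * (r * (2 - r)) ≤ u r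
  abs_log_le : ∀ x ∈ polarDomain, |logLift φ x| ≤ C + |poleLog (x 0)| / 2

/-- The torus fixes m, and m fixes the oscillation constant `C₁`. It remains to bound ψ at the
single point r = 1, θ = 0. -/
theorem exists_uniformBounds (V₀ A₀ : ℝ) (hA₀ : 0 < A₀) : ∃ m > 0, ∃ C, ∀ u φ,
    IsWarpingPair u φ → ConditionLambda V₀ A₀ (warpedMetric u φ) → HasUniformBounds m C u φ := by
  have hpi := Real.pi_pos
  set m := A₀ / (4 * Real.pi ^ 2) / 4 with hmdef
  have hm : 0 < m := by positivity
  set C₁ := 1 / (2 * m) + 2 * (1 + 1 / (2 * m)) + 4 * Real.pi with hC₁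
  -- On 1/2 ≤ r ≤ 3/2 one has r(2 - r) ≥ 3/4 and |poleLog r| ≤ |poleLog (3/2)|; the coordinate
  -- volume of that slab is 4π².
  set c := m * (3 / 4) * Real.exp (-(C₁ + |poleLog (3 / 2)| / 2)) * (4 * Real.pi ^ 2) with hc
  have hc0 : 0 < c := by positivity
  -- `ENNReal.ofReal` truncates a negative V₀ to zero. The summand 1 in `W / c + 1` below keeps the
  -- logarithm's argument positive.
  set W := max V₀ 0 with hW
  have hW0 : 0 ≤ W := le_max_right _ _
  refine ⟨m, hm, C₁ + |Real.log (W / c + 1)| + |Real.log (8 * Real.pi * Real.exp (2 * C₁) / A₀)|,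
    fun u φ hp hΛ => ?_⟩
  have h := hp.isEnergyPair hΛ.scalar_nonneg
  obtain ⟨r₀, hr₀, hur₀⟩ := hp.area_bound_torus hΛ.minA_ge
  have hu : ∀ r ∈ Icc (0 : ℝ) 2, m * (r * (2 - r)) ≤ u r := fun r hr =>
    h.le_u hr₀ (by positivity) hur₀ hr
  refine ⟨h, hu, ?_⟩
  set N := logLift φ ![1, 0, 0] with hN
  have hosc : ∀ x ∈ polarDomain, |logLift φ x - N| ≤ C₁ + |poleLog (x 0)| / 2 := fun x hx =>
    h.abs_sub_center_le hm hu hx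
  -- A large φ at the base point would make the sphere S² × {1} too small.
  have hupper : 2 * N ≤ Real.log (8 * Real.pi * Real.exp (2 * C₁) / A₀) := by
    have hB : ∀ x ∈ polarDomain, u (x 0) * (Real.exp (logLift φ x) ^ 2)⁻¹ ≤
        2 * Real.exp (2 * C₁ - 2 * N) := by
      intro x hx
      have hx' := Ioo_subset_Icc_self hx
      have h0 := h.u_nonneg hx'
      have h1 := exp_abs_poleLog_le hx (h.u_le_left hx') (h.u_le_right hx')
      have h2 := (abs_le.1 (hosc x hx)).1
      calc u (x 0) * (Real.exp (logLift φ x) ^ 2)⁻¹ = u (x 0) * Real.exp (-(2 * logLift φ x)) := by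
            rw [Real.exp_neg, ← Real.exp_nat_mul]; norm_num
        _ ≤ u (x 0) * Real.exp (|poleLog (x 0)| + (2 * C₁ - 2 * N)) := by
            gcongr; linarith
        _ = (u (x 0) * Real.exp |poleLog (x 0)|) * Real.exp (2 * C₁ - 2 * N) := by
            rw [Real.exp_add]; ring
        _ ≤ _ := by gcongr
    have h3 := hp.area_bound_slice hΛ.minA_ge hB
    rw [Real.le_log_iff_exp_le (by positivity), le_div_iff₀ hA₀]
    calc Real.exp (2 * N) * A₀ ≤
        Real.exp (2 * N) * (2 * Real.exp (2 * C₁ - 2 * N) * (4 * Real.pi)) := by gcongr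
      _ = 8 * Real.pi * (Real.exp (2 * N) * Real.exp (2 * C₁ - 2 * N)) := by ring
      _ = _ := by rw [← Real.exp_add]; congr 2; ring
  -- A small φ at the base point would make the volume density u e^{-ψ} too large on the middle
  -- slab.
  have hlower : -N ≤ Real.log (W / c + 1) := by
    have h1 : ∀ x ∈ boxEps (1 / 2), m * (3 / 4) * Real.exp (-(C₁ + |poleLog (3 / 2)| / 2)) *
        Real.exp (-N) ≤ volDensity (warpedMetric u φ) x := by
      intro x hx
      have hxp := boxEps_subset (by norm_num) hx
      have hx0 := hx.1
      rw [hp.warpedMetric_eq_logMetric, volDensity_logMetric (hp.u_pos _ hxp), ← Real.exp_neg,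
        mul_assoc, ← Real.exp_add]
      have h2 := (abs_le.1 (hosc x hxp)).2
      have h3 : |poleLog (x 0)| ≤ |poleLog (3 / 2)| := by
        have hmono : MonotoneOn poleLog (Icc (1 / 2) (3 / 2)) := by
          intro a ha b hb hab
          have ha0 : 0 < a := by linarith [ha.1]
          have hb0 : 0 < 2 - b := by linarith [hb.2]
          exact sub_le_sub (Real.log_le_log ha0 hab) (Real.log_le_log hb0 (by linarith))
        have hx1 : x 0 ∈ Icc (1 / 2 : ℝ) (3 / 2) := ⟨hx0.1, by linarith [hx0.2]⟩
        have e1 := hmono (left_mem_Icc.2 (by norm_num)) hx1 hx1.1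
        have e2 := hmono hx1 (right_mem_Icc.2 (by norm_num)) hx1.2
        have e3 : poleLog (1 / 2) = -poleLog (3 / 2) := by
          rw [poleLog, poleLog]; norm_num
        rw [e3] at e1
        exact (abs_le.2 ⟨e1, e2⟩).trans (le_abs_self _)
      have h4 : m * (3 / 4) ≤ u (x 0) := by
        refine le_trans ?_ (hu _ (Ioo_subset_Icc_self hxp))
        gcongr
        nlinarith [hx0.1, hx0.2]
      have := (hp.u_pos _ hxp).le
      gcongr
      linarith
    have h2 : ENNReal.ofReal (c * Real.exp (-N)) ≤ ENNReal.ofReal V₀ := by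
      refine le_trans ?_ hΛ.vol_le
      have hbox : boxEps (1 / 2) ⊆ box := fun x hx =>
        ⟨boxEps_subset (by norm_num) hx, hx.2⟩
      calc ENNReal.ofReal (c * Real.exp (-N))
          = ∫⁻ x in boxEps (1 / 2), ENNReal.ofReal (m * (3 / 4) *
            Real.exp (-(C₁ + |poleLog (3 / 2)| / 2)) * Real.exp (-N)) := by
            rw [setLIntegral_const, volume_boxEps (by norm_num),
              ← ENNReal.ofReal_mul (by positivity)]
            congr 1
            rw [hc]; ring
        _ ≤ ∫⁻ x in boxEps (1 / 2), ENNReal.ofReal (volDensity (warpedMetric u φ) x) :=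
            setLIntegral_mono' (isCompact_boxEps _).measurableSet fun x hx =>
              ENNReal.ofReal_le_ofReal (h1 x hx)
        _ ≤ vol (warpedMetric u φ) := lintegral_mono_set hbox
    have h3 : c * Real.exp (-N) ≤ W := by
      have : ENNReal.ofReal V₀ ≤ ENNReal.ofReal W := ENNReal.ofReal_le_ofReal (le_max_left _ _)
      exact (ENNReal.ofReal_le_ofReal_iff hW0).1 (h2.trans this)
    rw [Real.le_log_iff_exp_le (by positivity)]
    have : Real.exp (-N) ≤ W / c := by rw [le_div_iff₀ hc0]; linarith
    linarith
  intro x hx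
  have h1 := abs_le.1 (hosc x hx)
  have a1 := le_abs_self (Real.log (W / c + 1))
  have a2 := le_abs_self (Real.log (8 * Real.pi * Real.exp (2 * C₁) / A₀))
  have a3 := abs_nonneg (Real.log (W / c + 1))
  have a4 := abs_nonneg (Real.log (8 * Real.pi * Real.exp (2 * C₁) / A₀))
  rw [abs_le]
  constructor <;> linarith

/-! ### Extraction of a convergent subsequence -/

/-- Sequential form of the Arzelà–Ascoli theorem. -/
theorem exists_subseq_tendsto_continuousMap {X : Type*} [TopologicalSpace X]
    [WeaklyLocallyCompactSpace X] [SigmaCompactSpace X] (f : ℕ → C(X, ℝ))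
    (hb : ∀ x, ∃ M, ∀ i, |f i x| ≤ M) (heq : Equicontinuous fun i => ⇑(f i)) :
    ∃ σ : ℕ → ℕ, StrictMono σ ∧ ∃ F : C(X, ℝ), Tendsto (fun i => f (σ i)) atTop (𝓝 F) := by
  choose M hM using hb
  -- The closure is taken for pointwise convergence. It stays equicontinuous, so its members are
  -- continuous, and Tychonoff makes it compact.
  let A : Set (X → ℝ) := closure (range fun i => ⇑(f i))
  have hAeq : A.Equicontinuous := (equicontinuous_iff_range.1 heq).closure
  let S : Set C(X, ℝ) := {g | ⇑g ∈ A}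
  have himg : ContinuousMap.toFun '' S = A := by
    ext g
    constructor
    · rintro ⟨g', hg', rfl⟩
      exact hg'
    · intro hg
      exact ⟨⟨g, hAeq.continuous ⟨g, hg⟩⟩, hg, rfl⟩
  have hAc : IsCompact A := by
    refine (isCompact_univ_pi fun x => isCompact_Icc (a := -M x) (b := M x)).of_isClosed_subset
      isClosed_closure (closure_minimal ?_ (isClosed_set_pi fun x _ => isClosed_Icc))
    rintro _ ⟨i, rfl⟩ x -
    exact abs_le.1 (hM x i)
  have hS : IsCompact S := by
    refine ArzelaAscoli.isCompact_of_equicontinuous S (himg ▸ hAc) ?_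
    exact hAeq.comp fun g : S => (⟨g.1, g.2⟩ : A)
  obtain ⟨F, -, σ, hσ, hF⟩ := hS.isSeqCompact (x := f) fun i => subset_closure ⟨i, rfl⟩
  exact ⟨σ, hσ, F, hF⟩

theorem exists_subseq_radius {u : ℕ → ℝ → ℝ} {φ : ℕ → S2 → ℝ}
    (h : ∀ i, IsEnergyPair (u i) (φ i)) :
    ∃ σ : ℕ → ℕ, StrictMono σ ∧ ∃ u' : ℝ → ℝ,
      TendstoUniformlyOn (fun i => u (σ i)) u' atTop (Icc 0 2) := by
  let f : ℕ → C(Icc (0 : ℝ) 2, ℝ) := fun i => ⟨fun r => u i r, (h i).continuousOn.domRestrict⟩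
  obtain ⟨σ, hσ, F, hF⟩ := exists_subseq_tendsto_continuousMap f
    (fun x => ⟨2, fun i => by
      have h1 := (h i).u_nonneg x.2
      have h2 := (h i).u_le_left x.2
      have h3 := x.2.2
      change |u i x| ≤ 2
      rw [abs_of_nonneg h1]; linarith⟩)
    (by
      intro x
      rw [Metric.equicontinuousAt_iff]
      intro ε hε
      refine ⟨ε, hε, fun y hy i => lt_of_le_of_lt ?_ hy⟩
      rw [dist_comm y x]
      exact (h i).abs_sub_le x.2 y.2)
  refine ⟨σ, hσ, fun r => if hr : r ∈ Icc (0 : ℝ) 2 then F ⟨r, hr⟩ else 0, ?_⟩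
  rw [ContinuousMap.tendsto_iff_tendstoUniformly] at hF
  rw [tendstoUniformlyOn_iff_tendstoUniformly_comp_coe]
  convert! hF using 1
  funext r
  exact dif_pos r.2

theorem equicontinuousAt_log {m C : ℝ} (hm : 0 < m) {u : ℕ → ℝ → ℝ} {φ : ℕ → S2 → ℝ}
    (h : ∀ i, HasUniformBounds m C (u i) (φ i)) {r₀ θ₀ : ℝ} (hr₀ : r₀ ∈ Ioo (0 : ℝ) 2) {η : ℝ}
    (hη : 0 < η) : ∃ δ > 0, ∀ r θ, |r - r₀| < δ → |θ - θ₀| < δ → ∀ i,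
      |logLift (φ i) ![r, θ, 0] - logLift (φ i) ![r₀, θ₀, 0]| < η := by
  set ε := min r₀ (2 - r₀) / 2 with hε
  have hmin : 0 < min r₀ (2 - r₀) := lt_min hr₀.1 (sub_pos.2 hr₀.2)
  have hε0 : 0 < ε := by positivity
  have hε1 : ε < 1 := by
    have := min_le_left r₀ (2 - r₀)
    have := min_le_right r₀ (2 - r₀)
    linarith
  have hεr : 2 * ε ≤ r₀ := by linarith [min_le_left r₀ (2 - r₀)]
  have hεr' : 2 * ε ≤ 2 - r₀ := by linarith [min_le_right r₀ (2 - r₀)]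
  -- With d/(K m ε) ≤ K each meridian part 2(K + d/(K m ε)) costs at most 4K = η/4. Two of them and
  -- η/4 for the turn stay below η.
  set K := η / 16 with hK
  have hK0 : 0 < K := by positivity
  set d := min ε (K * K * (m * ε)) with hd
  have hd0 : 0 < d := lt_min hε0 (by positivity)
  have hd1 : d ≤ ε := min_le_left _ _
  have hd2 : d / (K * (m * ε)) ≤ K := by
    rw [div_le_iff₀ (by positivity), ← mul_assoc]
    exact (min_le_right _ _).trans (by rw [mul_assoc K K])
  set Q := Real.sqrt (1 / d) with hQ
  have hQ0 : 0 ≤ Q := Real.sqrt_nonneg _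
  refine ⟨min d (η / (4 * (Q + 1))), lt_min hd0 (by positivity), fun r θ hr hθ i => ?_⟩
  -- Both points are compared with the common reference point (r₀ - d, θ₀).
  have hb := fun θ t (ht : t ∈ Icc (r₀ - d) (r₀ + d)) =>
    (h i).abs_sub_angle_le hm (h i).le_u (a := r₀ - d) (b := r₀ + d) (θ := θ) (θ' := θ₀)
      hε0 hε1 hK0 (by linarith) (by linarith) (by linarith) ht
  have e0 : (r₀ + d - (r₀ - d)) / (2 * K * (m * ε)) = d / (K * (m * ε)) := by
    field_simp; ring
  have e1 : 2 / (r₀ + d - (r₀ - d)) = 1 / d := by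
    rw [show r₀ + d - (r₀ - d) = 2 * d by ring]; field_simp
  rw [e0, e1] at hb
  have hr' := abs_lt.1 (hr.trans_le (min_le_left _ _))
  have b1 := hb θ r ⟨by linarith, by linarith⟩
  have b2 := hb θ₀ r₀ ⟨by linarith, by linarith⟩
  rw [sub_self, abs_zero, mul_zero, add_zero] at b2
  have hθ' := hθ.trans_le (min_le_right _ _)
  have b3 : Q * |θ - θ₀| ≤ η / 4 := by
    calc Q * |θ - θ₀| ≤ (Q + 1) * (η / (4 * (Q + 1))) := by gcongr; linarith
      _ = η / 4 := by field_simp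
  rw [abs_le] at b1 b2
  rw [abs_lt]
  constructor <;> linarith

theorem exists_subseq_warping {m C : ℝ} (hm : 0 < m) {u : ℕ → ℝ → ℝ} {φ : ℕ → S2 → ℝ}
    (h : ∀ i, HasUniformBounds m C (u i) (φ i)) :
    ∃ σ : ℕ → ℕ, StrictMono σ ∧ ∃ φ' : S2 → ℝ, ∀ ε ∈ Ioo (0 : ℝ) 1,
      TendstoUniformlyOn (fun i => φ (σ i)) φ' atTop (Omega ε) := by
  have : LocallyCompactSpace (Ioo (0 : ℝ) 2) := isOpen_Ioo.locallyCompactSpace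
  let f : ℕ → C(Ioo (0 : ℝ) 2 × ℝ, ℝ) := fun i =>
    ⟨fun q => logLift (φ i) ![q.1, q.2, 0], (h i).smoothPair.ψ_smooth.continuous.comp (by
      refine continuous_pi fun k => ?_
      fin_cases k <;> simp <;> fun_prop)⟩
  obtain ⟨σ, hσ, F, hF⟩ := exists_subseq_tendsto_continuousMap f
    (fun q => ⟨C + |poleLog q.1| / 2, fun i => (h i).abs_log_le ![q.1, q.2, 0] q.1.2⟩)
    (by
      rintro ⟨⟨r₀, hr₀⟩, θ₀⟩
      rw [Metric.equicontinuousAt_iff]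
      intro η hη
      obtain ⟨δ, hδ, hδ'⟩ := equicontinuousAt_log hm h hr₀ (θ₀ := θ₀) hη
      refine ⟨δ, hδ, fun q hq i => ?_⟩
      rw [Prod.dist_eq, max_lt_iff] at hq
      rw [dist_comm]
      exact hδ' q.1 q.2 hq.1 hq.2 i)
  have hF' := (ContinuousMap.continuous_postcomp ⟨Real.exp, Real.continuous_exp⟩).tendsto F
    |>.comp hF
  rw [ContinuousMap.tendsto_iff_forall_isCompact_tendstoUniformlyOn] at hF'
  classical
  -- Choosing θ in [0, 2π] keeps the representatives of points of Ω_ε in one compact set.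
  -- Periodicity of the limit `F` is not needed, and the value 0 at the poles plays no role.
  let φ' : S2 → ℝ := fun p => if hp : ∃ q : Ioo (0 : ℝ) 2 × ℝ, q.2 ∈ Icc 0 (2 * Real.pi) ∧
      spherePt q.1 q.2 = p then Real.exp (F hp.choose) else 0
  refine ⟨σ, hσ, φ', fun ε hε => ?_⟩
  let Kc : Set (Ioo (0 : ℝ) 2 × ℝ) :=
    (Subtype.val ⁻¹' Icc ε (2 - ε)) ×ˢ Icc 0 (2 * Real.pi)
  have hKc : IsCompact Kc := by
    refine IsCompact.prod ?_ isCompact_Icc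
    rw [Subtype.isCompact_iff, Subtype.image_preimage_coe,
      inter_eq_self_of_subset_right fun r hr => Icc_mem_Ioo hε.1 hr]
    exact isCompact_Icc
  have h1 := hF' Kc hKc
  rw [Metric.tendstoUniformlyOn_iff] at h1 ⊢
  intro η hη
  filter_upwards [h1 η hη] with i hi p hp
  obtain ⟨r, hr, θ, rfl⟩ := hp
  have hr2 := Icc_mem_Ioo hε.1 hr
  have hex : ∃ q : Ioo (0 : ℝ) 2 × ℝ, q.2 ∈ Icc 0 (2 * Real.pi) ∧
      spherePt q.1 q.2 = spherePt r θ := by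
    have hpi := Real.pi_pos
    have f1 := Int.floor_le (θ / (2 * Real.pi))
    have f2 := Int.lt_floor_add_one (θ / (2 * Real.pi))
    rw [le_div_iff₀ (by positivity)] at f1
    rw [div_lt_iff₀ (by positivity)] at f2
    refine ⟨(⟨r, hr2⟩, θ + (-⌊θ / (2 * Real.pi)⌋ : ℤ) * (2 * Real.pi)), ?_, ?_⟩
    · push_cast
      constructor <;> linarith
    · exact spherePt_add_int_mul _ _ _
  obtain ⟨q, hq2, hq, hφ'⟩ : ∃ q : Ioo (0 : ℝ) 2 × ℝ, q.2 ∈ Icc 0 (2 * Real.pi) ∧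
      spherePt q.1 q.2 = spherePt r θ ∧ φ' (spherePt r θ) = Real.exp (F q) :=
    ⟨hex.choose, hex.choose_spec.1, hex.choose_spec.2, dif_pos hex⟩
  have hqr : (q.1 : ℝ) = r := spherePt_radius_inj (Ioo_subset_Icc_self q.1.2)
    (Ioo_subset_Icc_self hr2) hq
  have h2 := hi q ⟨by rw [mem_preimage, hqr]; exact hr, hq2⟩
  have h3 : Real.exp (logLift (φ (σ i)) ![q.1, q.2, 0]) = φ (σ i) (spherePt r θ) := by
    rw [exp_logLift ((h (σ i)).φ_pos _), ← hq]
    rfl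
  rw [hφ', ← h3]
  exact h2

theorem exists_warpingLimit {m C : ℝ} (hm : 0 < m) {u : ℕ → ℝ → ℝ} {φ : ℕ → S2 → ℝ}
    (h : ∀ i, HasUniformBounds m C (u i) (φ i)) :
    ∃ σ : ℕ → ℕ, StrictMono σ ∧ ∃ (u' : ℝ → ℝ) (φ' : S2 → ℝ),
      IsWarpingLimit (fun i => u (σ i)) (fun i => φ (σ i)) u' φ' := by
  obtain ⟨σ, hσ, u', hu'⟩ := exists_subseq_radius fun i => (h i).toIsEnergyPair
  obtain ⟨τ, hτ, φ', hφ'⟩ := exists_subseq_warping hm fun i => h (σ i)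
  refine ⟨σ ∘ τ, hσ.comp hτ, u', φ', ?_, hφ'⟩
  intro s hs
  exact hτ.tendsto_atTop.eventually (hu' s hs)

/-! ### Weak convergence in `L²` -/

/-- Sequential Banach–Alaoglu, transported by the Riesz isomorphism. -/
theorem exists_subseq_weak_inner {H : Type*} [NormedAddCommGroup H] [InnerProductSpace ℝ H]
    [CompleteSpace H] [TopologicalSpace.SeparableSpace H] (f : ℕ → H) {C : ℝ}
    (hf : ∀ i, ‖f i‖ ≤ C) : ∃ σ : ℕ → ℕ, StrictMono σ ∧ ∃ g : H, ∀ h : H,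
      Tendsto (fun i => inner ℝ (f (σ i)) h) atTop (𝓝 (inner ℝ g h)) := by
  obtain ⟨G, -, σ, hσ, hG⟩ := WeakDual.isSeqCompact_closedBall ℝ H 0 C
    (x := fun i => StrongDual.toWeakDual (InnerProductSpace.toDual ℝ H (f i))) (fun i => by
      rw [mem_preimage, StrongDual.toStrongDual_toWeakDual, mem_closedBall_zero_iff,
        LinearIsometryEquiv.norm_map]
      exact hf i)
  refine ⟨σ, hσ, (InnerProductSpace.toDual ℝ H).symm (WeakDual.toStrongDual G), fun h => ?_⟩
  rw [InnerProductSpace.toDual_symm_apply]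
  exact ((WeakDual.eval_continuous h).tendsto G).comp hG

section L2

variable {α : Type*} [MeasurableSpace α] {μ : Measure α}

theorem inner_toLp {f h : α → ℝ} (hf : MemLp f 2 μ) (hh : MemLp h 2 μ) :
    inner ℝ (hf.toLp f) (hh.toLp h) = ∫ x, f x * h x ∂μ := by
  rw [L2.inner_def]
  refine integral_congr_ae ?_
  filter_upwards [hf.coeFn_toLp, hh.coeFn_toLp] with x h1 h2
  rw [h1, h2]
  simp [mul_comm]

theorem norm_toLp_sq {f : α → ℝ} (hf : MemLp f 2 μ) : ‖hf.toLp f‖ ^ 2 = ∫ x, f x ^ 2 ∂μ := by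
  rw [← real_inner_self_eq_norm_sq, inner_toLp hf hf]
  simp only [pow_two]

/-- Weak convergence in `L²`. -/
def WeaklyTendsto (μ : Measure α) (f : ℕ → α → ℝ) (g : α → ℝ) : Prop :=
  ∀ h, MemLp h 2 μ → Tendsto (fun i => ∫ x, f i x * h x ∂μ) atTop (𝓝 (∫ x, g x * h x ∂μ))

theorem exists_subseq_weaklyTendsto [IsSeparable μ] {f : ℕ → α → ℝ}
    (hf : ∀ i, MemLp (f i) 2 μ) {C : ℝ} (hC : ∀ i, ∫ x, f i x ^ 2 ∂μ ≤ C) :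
    ∃ σ : ℕ → ℕ, StrictMono σ ∧ ∃ g, MemLp g 2 μ ∧ WeaklyTendsto μ (fun i => f (σ i)) g := by
  have : Fact ((1 : ℝ≥0∞) ≤ 2) := ⟨by norm_num⟩
  have : Fact ((2 : ℝ≥0∞) ≠ ⊤) := ⟨by norm_num⟩
  obtain ⟨σ, hσ, g, hg⟩ := exists_subseq_weak_inner (fun i => (hf i).toLp (f i)) (C := √C)
    (fun i => Real.le_sqrt_of_sq_le (by rw [norm_toLp_sq]; exact hC i))
  refine ⟨σ, hσ, g, Lp.memLp g, fun h hh => ?_⟩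
  have h1 := hg (hh.toLp h)
  simp only [inner_toLp] at h1
  rw [← inner_toLp (Lp.memLp g) hh, Lp.toLp_coeFn]
  exact h1

/-- The integral of a product of a weakly and a strongly convergent sequence. -/
theorem WeaklyTendsto.integral_mul {f : ℕ → α → ℝ} {g : α → ℝ} (hw : WeaklyTendsto μ f g)
    (hf : ∀ i, MemLp (f i) 2 μ) {C : ℝ} (hC : ∀ i, ∫ x, f i x ^ 2 ∂μ ≤ C)
    {h : ℕ → α → ℝ} {h' : α → ℝ} {G : α → ℝ} (hG : MemLp G 2 μ)
    (hm : ∀ i, AEStronglyMeasurable (h i) μ) (hb : ∀ i, ∀ᵐ x ∂μ, |h i x| ≤ G x)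
    (hlim : ∀ᵐ x ∂μ, Tendsto (fun i => h i x) atTop (𝓝 (h' x))) :
    Tendsto (fun i => ∫ x, f i x * h i x ∂μ) atTop (𝓝 (∫ x, g x * h' x ∂μ)) := by
  have hhi : ∀ i, MemLp (h i) 2 μ := fun i => hG.mono' (hm i) (hb i)
  have hb' : ∀ᵐ x ∂μ, |h' x| ≤ G x := by
    filter_upwards [hlim, ae_all_iff.2 hb] with x h1 h2
    exact le_of_tendsto h1.abs (Eventually.of_forall h2)
  have hh' : MemLp h' 2 μ := hG.mono' (aestronglyMeasurable_of_tendsto_ae _ hm hlim) hb'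
  have hsub : ∀ i, MemLp (fun x => h i x - h' x) 2 μ := fun i => (hhi i).sub hh'
  have hsq : Tendsto (fun i => ∫ x, (h i x - h' x) ^ 2 ∂μ) atTop (𝓝 0) := by
    have : Tendsto (fun i => ∫ x, (h i x - h' x) ^ 2 ∂μ) atTop (𝓝 (∫ _, (0 : ℝ) ∂μ)) := by
      refine tendsto_integral_of_dominated_convergence (fun x => 4 * G x ^ 2)
        (fun i => ((hsub i).1.pow 2)) (hG.integrable_sq.const_mul 4) (fun i => ?_) ?_
      · filter_upwards [hb i, hb'] with x h1 h2
        rw [Real.norm_eq_abs, abs_of_nonneg (sq_nonneg _)]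
        rw [abs_le] at h1 h2
        have : |h i x - h' x| ≤ 2 * G x := by
          rw [abs_le]; constructor <;> linarith
        have h3 := sq_le_sq' (by linarith [neg_abs_le (h i x - h' x)]) ((le_abs_self _).trans this)
        linarith
      · filter_upwards [hlim] with x hx
        have := (hx.sub_const (h' x)).pow 2
        simpa using this
    simpa using this
  have hC0 : 0 ≤ C := le_trans (integral_nonneg fun x => sq_nonneg _) (hC 0)
  -- Split h_i = h' + (h_i - h'). Weak convergence handles the first part, and Cauchy–Schwarz with
  -- strong convergence the second.
  have hdiff : Tendsto (fun i => ∫ x, f i x * (h i x - h' x) ∂μ) atTop (𝓝 0) := by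
    have hlim0 : Tendsto (fun i => √C * √(∫ x, (h i x - h' x) ^ 2 ∂μ)) atTop (𝓝 0) := by
      have := (Real.continuous_sqrt.tendsto 0).comp hsq
      simpa using this.const_mul (√C)
    refine squeeze_zero_norm (fun i => ?_) hlim0
    rw [← inner_toLp (hf i) (hsub i)]
    refine (norm_inner_le_norm _ _).trans ?_
    gcongr
    · exact Real.le_sqrt_of_sq_le (by rw [norm_toLp_sq]; exact hC i)
    · exact Real.le_sqrt_of_sq_le (by rw [norm_toLp_sq])
  have h2 := (hw h' hh').add hdiff
  rw [add_zero] at h2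
  refine h2.congr fun i => ?_
  have i1 : Integrable (fun x => f i x * h' x) μ := (hf i).integrable_mul hh'
  have i2 : Integrable (fun x => f i x * (h i x - h' x)) μ := (hf i).integrable_mul (hsub i)
  rw [← integral_add i1 i2]
  congr 1
  funext x
  ring

end L2

/-- Local weak `L²` convergence on `polarDomain`, tested against locally dominated sequences that
converge almost everywhere. -/
structure IsLocalWeakLimit (P : ℕ → Coord → ℝ) (p : Coord → ℝ) : Prop where
  memLp : ∀ K ⊆ polarDomain, IsCompact K → MemLp p 2 (volume.restrict K)
  tendsto : ∀ K ⊆ polarDomain, IsCompact K → ∀ (γ : ℕ → Coord → ℝ) (γ' G : Coord → ℝ),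
    MemLp G 2 (volume.restrict K) → (∀ i, AEStronglyMeasurable (γ i) (volume.restrict K)) →
    (∀ i, ∀ᵐ x ∂volume.restrict K, |γ i x| ≤ G x) →
    (∀ᵐ x ∂volume.restrict K, Tendsto (fun i => γ i x) atTop (𝓝 (γ' x))) →
    Tendsto (fun i => ∫ x in K, γ i x * P i x) atTop (𝓝 (∫ x in K, γ' x * p x))

theorem isLocalWeakLimit_zero : IsLocalWeakLimit (fun _ _ => 0) fun _ => 0 where
  memLp _ _ _ := MemLp.zero
  tendsto K _ _ γ γ' G _ _ _ _ := by simp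

/-- To test P_i against γ_i on K, test ρ_i P_i against γ_i/ρ_i extended by zero; the lower bound for
ρ_i on K keeps this dominated and convergent. -/
theorem isLocalWeakLimit_of_weighted {P ρ : ℕ → Coord → ℝ} {ρ' f : Coord → ℝ}
    (hρm : ∀ i, AEStronglyMeasurable (ρ i) (volume.restrict polarDomain))
    (hρ : ∀ x ∈ polarDomain, Tendsto (fun i => ρ i x) atTop (𝓝 (ρ' x)))
    (hρpos : ∀ K ⊆ polarDomain, IsCompact K → ∃ c > 0, ∀ i, ∀ x ∈ K, c ≤ ρ i x)
    (hP : ∀ i, MemLp (fun x => ρ i x * P i x) 2 (volume.restrict polarDomain)) {C : ℝ}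
    (hC : ∀ i, ∫ x in polarDomain, (ρ i x * P i x) ^ 2 ≤ C)
    (hf : MemLp f 2 (volume.restrict polarDomain))
    (hw : WeaklyTendsto (volume.restrict polarDomain) (fun i x => ρ i x * P i x) f) :
    IsLocalWeakLimit P fun x => f x / ρ' x := by
  have hρ'm : AEStronglyMeasurable ρ' (volume.restrict polarDomain) :=
    aestronglyMeasurable_of_tendsto_ae _ hρm (by
      filter_upwards [ae_restrict_mem isOpen_polarDomain.measurableSet] with x hx using hρ x hx)
  have hρ'pos : ∀ K ⊆ polarDomain, ∀ c, (∀ i, ∀ x ∈ K, c ≤ ρ i x) → ∀ x ∈ K, c ≤ ρ' x :=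
    fun K hK c hc x hx => ge_of_tendsto (hρ x (hK hx)) (Eventually.of_forall fun i => hc i x hx)
  constructor
  · intro K hK hKc
    obtain ⟨c, hc0, hc⟩ := hρpos K hK hKc
    have hle := Measure.restrict_mono hK (le_refl (volume : Measure Coord))
    have hfK := (hf.mono_measure hle).const_mul c⁻¹
    refine hfK.mono ((hf.mono_measure hle).1.mul (hρ'm.mono_measure hle).inv₀) ?_
    filter_upwards [ae_restrict_mem hKc.measurableSet] with x hx
    have h1 := hρ'pos K hK c hc x hx
    rw [norm_mul, norm_inv, norm_div, Real.norm_of_nonneg hc0.le,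
      Real.norm_of_nonneg (hc0.le.trans h1), div_eq_inv_mul]
    gcongr
  · intro K hK hKc γ γ' G hG hγm hγb hγ
    obtain ⟨c, hc0, hc⟩ := hρpos K hK hKc
    have hKm := hKc.measurableSet
    have hle := Measure.restrict_mono hK (le_refl (volume : Measure Coord))
    have hrr : (volume.restrict polarDomain).restrict K = volume.restrict K :=
      Measure.restrict_restrict_of_subset hK
    have hGK : MemLp (K.indicator fun x => c⁻¹ * G x) 2 (volume.restrict polarDomain) := by
      rw [memLp_indicator_iff_restrict hKm, hrr]
      exact hG.const_mul c⁻¹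
    have key := hw.integral_mul hP hC (h := fun i => K.indicator fun x => γ i x / ρ i x)
      (h' := K.indicator fun x => γ' x / ρ' x) hGK
      (fun i => by
        rw [aestronglyMeasurable_indicator_iff hKm, hrr]
        exact (hγm i).mul ((hρm i).mono_measure hle).inv₀)
      (fun i => by
        have h1 : ∀ᵐ x ∂volume.restrict polarDomain, x ∈ K → |γ i x| ≤ G x := by
          have := hγb i
          rw [← hrr] at this
          exact (ae_restrict_iff' hKm).1 this
        filter_upwards [h1] with x hx
        by_cases hxK : x ∈ K
        · rw [indicator_of_mem hxK, indicator_of_mem hxK, abs_div,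
            abs_of_nonneg (hc0.le.trans (hc i x hxK)), div_eq_inv_mul]
          have h2 := hx hxK
          have h3 := hc i x hxK
          gcongr
        · rw [indicator_of_notMem hxK, indicator_of_notMem hxK, abs_zero])
      (by
        have h1 : ∀ᵐ x ∂volume.restrict polarDomain, x ∈ K →
            Tendsto (fun i => γ i x) atTop (𝓝 (γ' x)) := by
          rw [← hrr] at hγ
          exact (ae_restrict_iff' hKm).1 hγ
        filter_upwards [h1] with x hx
        by_cases hxK : x ∈ K
        · simp only [indicator_of_mem hxK]
          exact (hx hxK).div (hρ x (hK hxK))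
            (hc0.trans_le (hρ'pos K hK c hc x hxK)).ne'
        · simp only [indicator_of_notMem hxK]
          exact tendsto_const_nhds)
    have e1 : ∀ i, ∫ x in polarDomain, ρ i x * P i x * K.indicator (fun x => γ i x / ρ i x) x =
        ∫ x in K, γ i x * P i x := by
      intro i
      rw [← hrr, ← integral_indicator hKm]
      congr 1
      funext x
      by_cases hxK : x ∈ K
      · rw [indicator_of_mem hxK, indicator_of_mem hxK]
        have := (hc0.trans_le (hc i x hxK)).ne'
        field_simp
      · rw [indicator_of_notMem hxK, indicator_of_notMem hxK, mul_zero]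
    have e2 : ∫ x in polarDomain, f x * K.indicator (fun x => γ' x / ρ' x) x =
        ∫ x in K, γ' x * (f x / ρ' x) := by
      rw [← hrr, ← integral_indicator hKm]
      congr 1
      funext x
      by_cases hxK : x ∈ K
      · rw [indicator_of_mem hxK, indicator_of_mem hxK]
        ring
      · rw [indicator_of_notMem hxK, indicator_of_notMem hxK, mul_zero]
    rw [e2] at key
    simpa only [e1] using key

/-! ### The energy of `log φ` -/

/-- A weight on `(0,2) × ℝ × ℝ` making periodic functions integrable. -/
def angleWeight (x : Coord) : ℝ := (1 + x 1 ^ 2)⁻¹ * (1 + x 2 ^ 2)⁻¹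

theorem angleWeight_pos (x : Coord) : 0 < angleWeight x := by
  unfold angleWeight; positivity

theorem continuous_angleWeight : Continuous angleWeight := by
  unfold angleWeight
  refine Continuous.mul (Continuous.inv₀ (by fun_prop) fun x => ?_)
    (Continuous.inv₀ (by fun_prop) fun x => ?_) <;> positivity

theorem polar_integrand_eq (w : ℝ → ℝ) (x : Coord) :
    (polarDomain.indicator fun x => angleWeight x * w (x 0)) x =
      ∏ k, (![(Ioo (0 : ℝ) 2).indicator w, fun t => (1 + t ^ 2)⁻¹, fun t => (1 + t ^ 2)⁻¹] :
        Fin 3 → ℝ → ℝ) k (x k) := by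
  rw [Fin.prod_univ_three]
  by_cases hx : x ∈ polarDomain
  · have hx' : x 0 ∈ Ioo (0 : ℝ) 2 := hx
    simp [indicator_of_mem hx, indicator_of_mem hx', angleWeight]
    ring
  · have hx' : x 0 ∉ Ioo (0 : ℝ) 2 := hx
    simp [indicator_of_notMem hx, indicator_of_notMem hx']

theorem integrableOn_angleWeight_mul {w : ℝ → ℝ} (hw : IntegrableOn w (Ioo 0 2)) :
    IntegrableOn (fun x : Coord => angleWeight x * w (x 0)) polarDomain := by
  rw [← integrable_indicator_iff isOpen_polarDomain.measurableSet]
  have hk : ∀ k, Integrable ((![(Ioo (0 : ℝ) 2).indicator w, fun t => (1 + t ^ 2)⁻¹,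
      fun t => (1 + t ^ 2)⁻¹] : Fin 3 → ℝ → ℝ) k) := by
    intro k
    fin_cases k
    · exact (integrable_indicator_iff measurableSet_Ioo).2 hw
    · exact integrable_inv_one_add_sq
    · exact integrable_inv_one_add_sq
  have := Integrable.fintype_prod (μ := fun _ : Fin 3 => (volume : Measure ℝ)) hk
  exact this.congr (Eventually.of_forall fun x => (polar_integrand_eq w x).symm)

theorem integral_angleWeight_mul (w : ℝ → ℝ) :
    ∫ x in polarDomain, angleWeight x * w (x 0) = (∫ r in Ioo (0 : ℝ) 2, w r) * Real.pi ^ 2 := by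
  rw [← integral_indicator isOpen_polarDomain.measurableSet]
  simp only [polar_integrand_eq w]
  rw [integral_fintype_prod_volume_eq_prod, Fin.prod_univ_three]
  simp only [Matrix.cons_val_zero, Matrix.cons_val_one, Matrix.cons_val,
    integral_univ_inv_one_add_sq, integral_indicator measurableSet_Ioo]
  ring

namespace IsEnergyPair

variable {u : ℝ → ℝ} {φ : S2 → ℝ} (h : IsEnergyPair u φ)
include h

/-- The integral is u'(0) - u'(2). That it is the same for all pairs is the source of the uniform
energy bound. -/
theorem integral_deriv2 : IntegrableOn (fun r => -deriv (deriv u) r) (Ioo 0 2) ∧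
    ∫ r in Ioo (0 : ℝ) 2, -deriv (deriv u) r = 2 := by
  have hcont : ContinuousOn (fun r => -derivWithin u (Icc 0 2) r) (Icc 0 2) :=
    (h.u_smooth.continuousOn_derivWithin (uniqueDiffOn_Icc (by norm_num)) (by simp)).neg
  have hder : ∀ r ∈ Ioo (0 : ℝ) 2, HasDerivAt (fun r => -derivWithin u (Icc 0 2) r)
      (-deriv (deriv u) r) r := by
    intro r hr
    refine HasDerivAt.fun_neg ((h.smoothPair.du_diff hr).hasDerivAt.congr_of_eventuallyEq ?_)
    filter_upwards [isOpen_Ioo.mem_nhds hr] with t ht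
    exact derivWithin_of_mem_nhds (Icc_mem_nhds ht.1 ht.2)
  have hint : IntegrableOn (fun r => -deriv (deriv u) r) (Ioc 0 2) :=
    intervalIntegral.integrableOn_deriv_of_nonneg hcont hder fun r hr =>
      neg_nonneg.2 (h.deriv2_nonpos hr)
  refine ⟨hint.mono_set Ioo_subset_Ioc_self, ?_⟩
  have := intervalIntegral.integral_eq_sub_of_hasDerivAt_of_le (by norm_num : (0 : ℝ) ≤ 2)
    hcont hder ((intervalIntegrable_iff_integrableOn_Ioc_of_le (by norm_num)).2 hint)
  rw [intervalIntegral.integral_of_le (by norm_num), integral_Ioc_eq_integral_Ioo,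
    h.deriv_zero, h.deriv_two] at this
  rw [this]; norm_num

theorem measurable_pd (k : Fin 3) : Measurable (pd k (logLift φ)) :=
  (contDiff_pd h.smoothPair.ψ_smooth k).continuous.measurable

theorem continuousOn_weight :
    ContinuousOn (fun x : Coord => √(u (x 0) * angleWeight x)) polarDomain := by
  refine ContinuousOn.sqrt (ContinuousOn.mul ?_ continuous_angleWeight.continuousOn)
  exact h.continuousOn.comp (continuous_apply (0 : Fin 3)).continuousOn
    fun x hx => Ioo_subset_Icc_self hx

/-- The square is at most `angleWeight` times -u''. Integrating gives 2 from r and π from each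
angle, independently of the pair. -/
theorem weighted_energy (k : Fin 3) :
    MemLp (fun x => √(u (x 0) * angleWeight x) * pd k (logLift φ) x) 2
      (volume.restrict polarDomain) ∧
    ∫ x in polarDomain, (√(u (x 0) * angleWeight x) * pd k (logLift φ) x) ^ 2 ≤
      2 * Real.pi ^ 2 := by
  have hΩ := isOpen_polarDomain.measurableSet
  have hmeas : AEStronglyMeasurable (fun x => √(u (x 0) * angleWeight x) * pd k (logLift φ) x)
      (volume.restrict polarDomain) :=
    (h.continuousOn_weight.aestronglyMeasurable hΩ).mul (h.measurable_pd k).aestronglyMeasurable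
  have hle : ∀ x ∈ polarDomain, (√(u (x 0) * angleWeight x) * pd k (logLift φ) x) ^ 2 ≤
      angleWeight x * -deriv (deriv u) (x 0) := by
    intro x hx
    have h0 := h.u_pos _ hx
    have hw := angleWeight_pos x
    rw [mul_pow, Real.sq_sqrt (by positivity), mul_comm (u (x 0)), mul_assoc]
    exact mul_le_mul_of_nonneg_left (h.sq_pd_le hx k) hw.le
  have hdom := integrableOn_angleWeight_mul h.integral_deriv2.1
  have hint : IntegrableOn (fun x => (√(u (x 0) * angleWeight x) * pd k (logLift φ) x) ^ 2)
      polarDomain := by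
    refine Integrable.mono' hdom (hmeas.pow 2) ?_
    filter_upwards [ae_restrict_mem hΩ] with x hx
    rw [Real.norm_of_nonneg (sq_nonneg _)]
    exact hle x hx
  refine ⟨(memLp_two_iff_integrable_sq hmeas).2 hint, ?_⟩
  calc _ ≤ ∫ x in polarDomain, angleWeight x * -deriv (deriv u) (x 0) :=
        setIntegral_mono_on hint hdom hΩ hle
    _ = 2 * Real.pi ^ 2 := by
        rw [integral_angleWeight_mul fun r => -deriv (deriv u) r, h.integral_deriv2.2]

end IsEnergyPair

/-! ### Properties of the limit -/

/-- Compact subsets of `polarDomain` lie in a slab `ε ≤ r ≤ 2 - ε`. -/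
theorem exists_slab {K : Set Coord} (hK : K ⊆ polarDomain) (hKc : IsCompact K) :
    ∃ ε ∈ Ioo (0 : ℝ) 1, ∀ x ∈ K, x 0 ∈ Icc ε (2 - ε) := by
  rcases K.eq_empty_or_nonempty with rfl | hne
  · exact ⟨1 / 2, by norm_num, by simp⟩
  obtain ⟨a, haK, ha⟩ := hKc.exists_isMinOn hne (continuous_apply (0 : Fin 3)).continuousOn
  obtain ⟨b, hbK, hb⟩ := hKc.exists_isMaxOn hne (continuous_apply (0 : Fin 3)).continuousOn
  have ha0 := (hK haK).1
  have hb0 := (hK hbK).2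
  refine ⟨min (1 / 2) (min (a 0) (2 - b 0)), ⟨?_, ?_⟩, fun x hx => ⟨?_, ?_⟩⟩
  · exact lt_min (by norm_num) (lt_min ha0 (by linarith))
  · exact (min_le_left _ _).trans_lt (by norm_num)
  · exact (min_le_right _ _).trans ((min_le_left _ _).trans (ha hx))
  · have h1 : x 0 ≤ b 0 := hb hx
    have h2 := (min_le_right (1 / 2 : ℝ) _).trans (min_le_right (a 0) (2 - b 0))
    linarith

/-- A sequence with uniform bounds, and its limit. -/
structure IsBoundedLimit (m C : ℝ) (u : ℕ → ℝ → ℝ) (φ : ℕ → S2 → ℝ) (u' : ℝ → ℝ) (φ' : S2 → ℝ) :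
    Prop extends IsWarpingLimit u φ u' φ' where
  m_pos : 0 < m
  bounds : ∀ i, HasUniformBounds m C (u i) (φ i)

namespace IsBoundedLimit

variable {m C : ℝ} {u : ℕ → ℝ → ℝ} {φ : ℕ → S2 → ℝ} {u' : ℝ → ℝ} {φ' : S2 → ℝ}
  (h : IsBoundedLimit m C u φ u' φ')
include h

theorem comp {σ : ℕ → ℕ} (hσ : StrictMono σ) :
    IsBoundedLimit m C (fun i => u (σ i)) (fun i => φ (σ i)) u' φ' where
  u_tendsto s hs := hσ.tendsto_atTop.eventually (h.u_tendsto s hs)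
  φ_tendsto ε hε s hs := hσ.tendsto_atTop.eventually (h.φ_tendsto ε hε s hs)
  m_pos := h.m_pos
  bounds i := h.bounds (σ i)

theorem tendsto_u_apply {r : ℝ} (hr : r ∈ Icc (0 : ℝ) 2) :
    Tendsto (fun i => u i r) atTop (𝓝 (u' r)) := h.u_tendsto.tendsto_at hr

theorem tendsto_polarLift {x : Coord} (hx : x ∈ polarDomain) :
    Tendsto (fun i => polarLift (φ i) x) atTop (𝓝 (polarLift φ' x)) := by
  obtain ⟨ε, hε, hK⟩ := exists_slab (singleton_subset_iff.2 hx) isCompact_singleton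
  exact (h.φ_tendsto ε hε).tendsto_at ⟨x 0, hK x rfl, x 1, rfl⟩

theorem le_u' {r : ℝ} (hr : r ∈ Icc (0 : ℝ) 2) : m * (r * (2 - r)) ≤ u' r :=
  ge_of_tendsto (h.tendsto_u_apply hr) (Eventually.of_forall fun i => (h.bounds i).le_u r hr)

theorem u'_pos {r : ℝ} (hr : r ∈ Ioo (0 : ℝ) 2) : 0 < u' r :=
  (mul_pos h.m_pos (mul_pos hr.1 (sub_pos.2 hr.2))).trans_le (h.le_u' (Ioo_subset_Icc_self hr))

theorem polarLift_bounds {x : Coord} (hx : x ∈ polarDomain) :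
    Real.exp (-(C + |poleLog (x 0)| / 2)) ≤ polarLift φ' x ∧
      polarLift φ' x ≤ Real.exp (C + |poleLog (x 0)| / 2) := by
  have hb := fun i => abs_le.1 ((h.bounds i).abs_log_le x hx)
  have he : ∀ i, Real.exp (logLift (φ i) x) = polarLift (φ i) x := fun i =>
    exp_logLift ((h.bounds i).φ_pos _)
  constructor
  · refine ge_of_tendsto (h.tendsto_polarLift hx) (Eventually.of_forall fun i => ?_)
    rw [← he]
    exact Real.exp_le_exp.2 (hb i).1
  · refine le_of_tendsto (h.tendsto_polarLift hx) (Eventually.of_forall fun i => ?_)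
    rw [← he]
    exact Real.exp_le_exp.2 (hb i).2

theorem polarLift_pos {x : Coord} (hx : x ∈ polarDomain) : 0 < polarLift φ' x :=
  (Real.exp_pos _).trans_le (h.polarLift_bounds hx).1

theorem tendsto_logLift {x : Coord} (hx : x ∈ polarDomain) :
    Tendsto (fun i => logLift (φ i) x) atTop (𝓝 (logLift φ' x)) :=
  (h.tendsto_polarLift hx).log (h.polarLift_pos hx).ne'

theorem abs_u'_sub_le {r t : ℝ} (hr : r ∈ Icc (0 : ℝ) 2) (ht : t ∈ Icc (0 : ℝ) 2) :
    |u' r - u' t| ≤ |r - t| :=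
  le_of_tendsto ((h.tendsto_u_apply hr).sub (h.tendsto_u_apply ht)).abs
    (Eventually.of_forall fun i => (h.bounds i).abs_sub_le hr ht)

theorem u'_lipschitz : LipschitzOnWith 1 u' (Icc 0 2) :=
  LipschitzOnWith.of_dist_le_mul fun r hr t ht => by
    simpa [Real.dist_eq] using h.abs_u'_sub_le hr ht

/-- Rademacher's theorem in the variable r; null sets of radii pull back to null sets of points. -/
theorem ae_differentiableAt : ∀ᵐ x ∂volume.restrict polarDomain, DifferentiableAt ℝ u' (x 0) := by
  have h1 : ∀ᵐ r : ℝ, r ∈ Ioo (0 : ℝ) 2 → DifferentiableAt ℝ u' r := by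
    filter_upwards [h.u'_lipschitz.ae_differentiableWithinAt_of_mem_real] with r hr hr'
    exact (hr (Ioo_subset_Icc_self hr')).differentiableAt (Icc_mem_nhds hr'.1 hr'.2)
  have h2 : ∀ᵐ x : Coord, x 0 ∈ Ioo (0 : ℝ) 2 → DifferentiableAt ℝ u' (x 0) :=
    (Measure.quasiMeasurePreserving_eval (fun _ : Fin 3 => (volume : Measure ℝ)) 0).ae h1
  rw [ae_restrict_iff' isOpen_polarDomain.measurableSet]
  exact h2

/-- The derivatives of concave functions converge where the limit is differentiable. -/
theorem tendsto_deriv {r : ℝ} (hr : r ∈ Ioo (0 : ℝ) 2) (hd : DifferentiableAt ℝ u' r) :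
    Tendsto (fun i => deriv (u i) r) atTop (𝓝 (deriv u' r)) := by
  have hslope := hasDerivAt_iff_tendsto_slope.1 hd.hasDerivAt
  have hlim : ∀ t ∈ Icc (0 : ℝ) 2, Tendsto (fun i => slope (u i) r t) atTop (𝓝 (slope u' r t)) := by
    intro t ht
    simp only [slope_def_field]
    exact ((h.tendsto_u_apply ht).sub (h.tendsto_u_apply (Ioo_subset_Icc_self hr))).div_const _
  rw [tendsto_order]
  constructor
  -- By concavity u_i'(r) lies above every slope to the right of r and below every slope to the
  -- left. For fixed t these slopes converge, and those of the limit tend to its derivative.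
  · intro a ha
    have h1 : ∀ᶠ t in 𝓝[>] r, a < slope u' r t :=
      (hslope.mono_left (nhdsWithin_mono _ fun t ht => ne_of_gt ht)).eventually (lt_mem_nhds ha)
    have h2 : ∀ᶠ t in 𝓝[>] r, t ∈ Ioo r 2 := Ioo_mem_nhdsGT hr.2
    obtain ⟨t, ht, ht2⟩ := (h1.and h2).exists
    have htI : t ∈ Icc (0 : ℝ) 2 := ⟨hr.1.le.trans ht2.1.le, ht2.2.le⟩
    filter_upwards [(hlim t htI).eventually (lt_mem_nhds ht)] with i hi
    exact hi.trans_le ((h.bounds i).concaveOn.slope_le_of_hasDerivAt (Ioo_subset_Icc_self hr) htI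
      ht2.1 ((h.bounds i).smoothPair.u_diff hr).hasDerivAt)
  · intro a ha
    have h1 : ∀ᶠ t in 𝓝[<] r, slope u' r t < a :=
      (hslope.mono_left (nhdsWithin_mono _ fun t ht => ne_of_lt ht)).eventually (gt_mem_nhds ha)
    have h2 : ∀ᶠ t in 𝓝[<] r, t ∈ Ioo 0 r := Ioo_mem_nhdsLT hr.1
    obtain ⟨t, ht, ht2⟩ := (h1.and h2).exists
    have htI : t ∈ Icc (0 : ℝ) 2 := ⟨ht2.1.le, ht2.2.le.trans hr.2.le⟩
    filter_upwards [(hlim t htI).eventually (gt_mem_nhds ht)] with i hi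
    refine lt_of_le_of_lt ?_ hi
    rw [slope_comm]
    exact (h.bounds i).concaveOn.le_slope_of_hasDerivAt htI (Ioo_subset_Icc_self hr)
      ht2.2 ((h.bounds i).smoothPair.u_diff hr).hasDerivAt

theorem ae_tendsto_deriv : ∀ᵐ x ∂volume.restrict polarDomain,
    Tendsto (fun i => deriv (u i) (x 0)) atTop (𝓝 (deriv u' (x 0))) := by
  filter_upwards [h.ae_differentiableAt, ae_restrict_mem isOpen_polarDomain.measurableSet]
    with x hd hx using h.tendsto_deriv hx hd

theorem exists_weak_gradient_component (k : Fin 3) : ∃ σ : ℕ → ℕ, StrictMono σ ∧ ∃ f,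
    MemLp f 2 (volume.restrict polarDomain) ∧
    WeaklyTendsto (volume.restrict polarDomain)
      (fun i x => √(u (σ i) (x 0) * angleWeight x) * pd k (logLift (φ (σ i))) x) f :=
  exists_subseq_weaklyTendsto (fun i => ((h.bounds i).weighted_energy k).1)
    (fun i => ((h.bounds i).weighted_energy k).2)

theorem isLocalWeakLimit_of_weaklyTendsto {k : Fin 3} {f : Coord → ℝ}
    (hf : MemLp f 2 (volume.restrict polarDomain))
    (hw : WeaklyTendsto (volume.restrict polarDomain)
      (fun i x => √(u i (x 0) * angleWeight x) * pd k (logLift (φ i)) x) f) :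
    IsLocalWeakLimit (fun i => pd k (logLift (φ i)))
      fun x => f x / √(u' (x 0) * angleWeight x) := by
  refine isLocalWeakLimit_of_weighted (ρ := fun i x => √(u i (x 0) * angleWeight x))
    (ρ' := fun x => √(u' (x 0) * angleWeight x))
    (fun i => (h.bounds i).continuousOn_weight.aestronglyMeasurable
      isOpen_polarDomain.measurableSet) ?_ ?_
    (fun i => ((h.bounds i).weighted_energy k).1) (fun i => ((h.bounds i).weighted_energy k).2) hf hw
  · intro x hx
    exact ((h.tendsto_u_apply (Ioo_subset_Icc_self hx)).mul_const _).sqrt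
  · intro K hK hKc
    rcases K.eq_empty_or_nonempty with rfl | hne
    · exact ⟨1, one_pos, by simp⟩
    have hcont : ContinuousOn (fun x : Coord => √(m * (x 0 * (2 - x 0)) * angleWeight x)) K :=
      (Continuous.sqrt (Continuous.mul (by fun_prop) continuous_angleWeight)).continuousOn
    obtain ⟨a, haK, ha⟩ := hKc.exists_isMinOn hne hcont
    have ha1 := (hK haK).1
    have ha2 : 0 < 2 - a 0 := sub_pos.2 (hK haK).2
    have hmp := h.m_pos
    have haw := angleWeight_pos a
    refine ⟨√(m * (a 0 * (2 - a 0)) * angleWeight a), Real.sqrt_pos.2 (by positivity),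
      fun i x hx => (ha hx).trans ?_⟩
    exact Real.sqrt_le_sqrt (mul_le_mul_of_nonneg_right
      ((h.bounds i).le_u _ (Ioo_subset_Icc_self (hK hx))) (angleWeight_pos x).le)

/-- After passing to a subsequence, the gradients of `log φ_i` converge weakly. -/
theorem exists_weak_gradient : ∃ σ : ℕ → ℕ, StrictMono σ ∧ ∃ P : Fin 3 → Coord → ℝ,
    (∀ x, P 2 x = 0) ∧ ∀ k, IsLocalWeakLimit (fun i => pd k (logLift (φ (σ i)))) (P k) := by
  obtain ⟨σ, hσ, f, hf, hwf⟩ := h.exists_weak_gradient_component 0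
  obtain ⟨τ, hτ, g, hg, hwg⟩ := (h.comp hσ).exists_weak_gradient_component 1
  have hcomp := h.comp (hσ.comp hτ)
  have h0 := hcomp.isLocalWeakLimit_of_weaklyTendsto (k := 0) hf
    fun e he => (hwf e he).comp hτ.tendsto_atTop
  have h1 := hcomp.isLocalWeakLimit_of_weaklyTendsto (k := 1) hg hwg
  refine ⟨σ ∘ τ, hσ.comp hτ, ![fun x => f x / √(u' (x 0) * angleWeight x),
    fun x => g x / √(u' (x 0) * angleWeight x), fun _ => 0], fun _ => rfl, fun k => ?_⟩
  fin_cases k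
  · exact h0
  · exact h1
  · have : (fun i => pd 2 (logLift (φ ((σ ∘ τ) i)))) = fun _ _ => 0 := by
      funext i x
      exact pd_two_logLift _ x
    change IsLocalWeakLimit (fun i => pd 2 (logLift (φ ((σ ∘ τ) i)))) fun _ => 0
    rw [this]
    exact isLocalWeakLimit_zero

end IsBoundedLimit

/-! ### Locally bounded almost everywhere convergence -/

theorem continuousOn_comp_radius {f : ℝ → ℝ} (hf : ContinuousOn f (Ioo 0 2)) :
    ContinuousOn (fun x : Coord => f (x 0)) polarDomain :=
  ContinuousOn.comp (g := f) (t := Ioo 0 2) hf (continuous_apply (0 : Fin 3)).continuousOn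
    fun _ hx => hx

/-- Almost everywhere convergence on `polarDomain` of a sequence that is uniformly bounded on
compact subsets. -/
structure LocBddTendsto (γ : ℕ → Coord → ℝ) (γ' : Coord → ℝ) : Prop where
  meas : ∀ i, AEStronglyMeasurable (γ i) (volume.restrict polarDomain)
  bound : ∀ K ⊆ polarDomain, IsCompact K → ∃ B, ∀ i, ∀ x ∈ K, |γ i x| ≤ B
  tendsto : ∀ᵐ x ∂volume.restrict polarDomain, Tendsto (fun i => γ i x) atTop (𝓝 (γ' x))

theorem locBddTendsto_const {c : Coord → ℝ} (hc : ContinuousOn c polarDomain) :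
    LocBddTendsto (fun _ => c) c where
  meas _ := hc.aestronglyMeasurable isOpen_polarDomain.measurableSet
  bound K hK hKc := by
    obtain ⟨B, hB⟩ := hKc.exists_bound_of_continuousOn (hc.mono hK)
    exact ⟨B, fun _ => hB⟩
  tendsto := Eventually.of_forall fun _ => tendsto_const_nhds

namespace LocBddTendsto

variable {γ η : ℕ → Coord → ℝ} {γ' η' : Coord → ℝ} (h : LocBddTendsto γ γ')
include h

theorem mul (h' : LocBddTendsto η η') :
    LocBddTendsto (fun i x => γ i x * η i x) fun x => γ' x * η' x where
  meas i := (h.meas i).mul (h'.meas i)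
  bound K hK hKc := by
    obtain ⟨A, hA⟩ := h.bound K hK hKc
    obtain ⟨B, hB⟩ := h'.bound K hK hKc
    refine ⟨A * B, fun i x hx => ?_⟩
    rw [abs_mul]
    exact mul_le_mul (hA i x hx) (hB i x hx) (abs_nonneg _) ((abs_nonneg _).trans (hA i x hx))
  tendsto := by
    filter_upwards [h.tendsto, h'.tendsto] with x h1 h2 using h1.mul h2

theorem add (h' : LocBddTendsto η η') :
    LocBddTendsto (fun i x => γ i x + η i x) fun x => γ' x + η' x where
  meas i := (h.meas i).add (h'.meas i)
  bound K hK hKc := by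
    obtain ⟨A, hA⟩ := h.bound K hK hKc
    obtain ⟨B, hB⟩ := h'.bound K hK hKc
    exact ⟨A + B, fun i x hx => (abs_add_le _ _).trans (add_le_add (hA i x hx) (hB i x hx))⟩
  tendsto := by
    filter_upwards [h.tendsto, h'.tendsto] with x h1 h2 using h1.add h2

theorem sub (h' : LocBddTendsto η η') :
    LocBddTendsto (fun i x => γ i x - η i x) fun x => γ' x - η' x where
  meas i := (h.meas i).sub (h'.meas i)
  bound K hK hKc := by
    obtain ⟨A, hA⟩ := h.bound K hK hKc
    obtain ⟨B, hB⟩ := h'.bound K hK hKc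
    exact ⟨A + B, fun i x hx => (abs_sub _ _).trans (add_le_add (hA i x hx) (hB i x hx))⟩
  tendsto := by
    filter_upwards [h.tendsto, h'.tendsto] with x h1 h2 using h1.sub h2

theorem zpow (hpos : ∀ K ⊆ polarDomain, IsCompact K → ∃ δ > 0, ∀ i, ∀ x ∈ K, δ ≤ γ i x)
    (a : ℤ) : LocBddTendsto (fun i x => γ i x ^ a) fun x => γ' x ^ a where
  meas i := ((h.meas i).aemeasurable.pow_const a).aestronglyMeasurable
  bound K hK hKc := by
    obtain ⟨δ, hδ, hδ'⟩ := hpos K hK hKc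
    obtain ⟨B, hB⟩ := h.bound K hK hKc
    have hc : ContinuousOn (fun t : ℝ => t ^ a) (Icc δ B) := fun t ht =>
      (continuousAt_zpow₀ t a (Or.inl (hδ.trans_le ht.1).ne')).continuousWithinAt
    obtain ⟨M, hM⟩ := isCompact_Icc.exists_bound_of_continuousOn hc
    exact ⟨M, fun i x hx => hM _ ⟨hδ' i x hx, (le_abs_self _).trans (hB i x hx)⟩⟩
  tendsto := by
    filter_upwards [h.tendsto, ae_restrict_mem isOpen_polarDomain.measurableSet] with x h1 hx
    obtain ⟨δ, hδ, hδ'⟩ := hpos {x} (singleton_subset_iff.2 hx) isCompact_singleton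
    have : δ ≤ γ' x := ge_of_tendsto h1 (Eventually.of_forall fun i => hδ' i x rfl)
    exact h1.zpow₀ a (Or.inl (hδ.trans_le this).ne')

variable {K : Set Coord} (hK : K ⊆ polarDomain)
include hK

theorem meas_restrict (i : ℕ) : AEStronglyMeasurable (γ i) (volume.restrict K) :=
  (h.meas i).mono_measure (Measure.restrict_mono hK le_rfl)

theorem ae_tendsto_restrict :
    ∀ᵐ x ∂volume.restrict K, Tendsto (fun i => γ i x) atTop (𝓝 (γ' x)) :=
  ae_restrict_of_ae_restrict_of_subset hK h.tendsto

variable (hKc : IsCompact K)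
include hKc

theorem memLp_apply (p : ℝ≥0∞) (i : ℕ) : MemLp (γ i) p (volume.restrict K) := by
  obtain ⟨B, hB⟩ := h.bound K hK hKc
  have : IsFiniteMeasure (volume.restrict K) := ⟨by simpa using hKc.measure_lt_top⟩
  exact MemLp.of_bound (h.meas_restrict hK i) B ((ae_restrict_mem hKc.measurableSet).mono
    fun x hx => hB i x hx)

theorem memLp (p : ℝ≥0∞) : MemLp γ' p (volume.restrict K) := by
  obtain ⟨B, hB⟩ := h.bound K hK hKc
  have : IsFiniteMeasure (volume.restrict K) := ⟨by simpa using hKc.measure_lt_top⟩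
  refine MemLp.of_bound (aestronglyMeasurable_of_tendsto_ae _ (h.meas_restrict hK)
    (h.ae_tendsto_restrict hK)) B ?_
  filter_upwards [ae_restrict_mem hKc.measurableSet, h.ae_tendsto_restrict hK] with x hx h1
  exact le_of_tendsto h1.norm (Eventually.of_forall fun i => hB i x hx)

theorem integrableOn : IntegrableOn γ' K :=
  memLp_one_iff_integrable.1 (h.memLp hK hKc 1)

theorem tendsto_integral :
    Tendsto (fun i => ∫ x in K, γ i x) atTop (𝓝 (∫ x in K, γ' x)) := by
  obtain ⟨B, hB⟩ := h.bound K hK hKc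
  exact tendsto_integral_of_dominated_convergence (fun _ => B) (h.meas_restrict hK)
    (integrableOn_const hKc.measure_lt_top.ne) (fun i => (ae_restrict_mem hKc.measurableSet).mono
      fun x hx => hB i x hx) (h.ae_tendsto_restrict hK)

variable {P : ℕ → Coord → ℝ} {p : Coord → ℝ} (hP : IsLocalWeakLimit P p)
include hP

theorem tendsto_integral_mul :
    Tendsto (fun i => ∫ x in K, γ i x * P i x) atTop (𝓝 (∫ x in K, γ' x * p x)) := by
  obtain ⟨B, hB⟩ := h.bound K hK hKc
  have : IsFiniteMeasure (volume.restrict K) := ⟨by simpa using hKc.measure_lt_top⟩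
  exact hP.tendsto K hK hKc γ γ' (fun _ => B) (memLp_const B) (h.meas_restrict hK)
    (fun i => (ae_restrict_mem hKc.measurableSet).mono fun x hx => hB i x hx)
    (h.ae_tendsto_restrict hK)

theorem memLp_mul : MemLp (fun x => γ' x * p x) 2 (volume.restrict K) :=
  (hP.memLp K hK hKc).mul (h.memLp hK hKc ⊤)

theorem integrableOn_mul_sq : IntegrableOn (fun x => γ' x * p x ^ 2) K := by
  have := (h.memLp_mul hK hKc hP).integrable_mul (hP.memLp K hK hKc)
  refine this.congr (Eventually.of_forall fun x => ?_)
  simp only [Pi.mul_apply]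
  ring

/-- Lower semicontinuity of weighted `L²` norms. -/
theorem exists_tendsto_le_integral_sq (hPm : ∀ i, Continuous (P i))
    (hpos : ∀ i, ∀ x ∈ K, 0 ≤ γ i x) :
    ∃ L : ℕ → ℝ,
      (∀ i, L i ≤ ∫ x in K, γ i x * P i x ^ 2) ∧
        Tendsto L atTop (𝓝 (∫ x in K, γ' x * p x ^ 2)) := by
  obtain ⟨B, hB⟩ := h.bound K hK hKc
  have hp := hP.memLp K hK hKc
  have hKm := hKc.measurableSet
  have hpsq := hp.integrable_sq
  have hb1 : ∀ i, ∀ᵐ x ∂volume.restrict K, |γ i x * p x| ≤ B * |p x| := fun i =>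
    (ae_restrict_mem hKm).mono fun x hx => by
      rw [abs_mul]
      exact mul_le_mul_of_nonneg_right (hB i x hx) (abs_nonneg _)
  have hb2 : ∀ i, ∀ᵐ x ∂volume.restrict K, ‖γ i x * p x ^ 2‖ ≤ B * p x ^ 2 := fun i =>
    (ae_restrict_mem hKm).mono fun x hx => by
      rw [norm_mul, Real.norm_of_nonneg (sq_nonneg (p x))]
      exact mul_le_mul_of_nonneg_right (hB i x hx) (sq_nonneg _)
  have hm2 := fun i => (h.meas_restrict hK i).mul (hp.1.pow 2)
  have hG : MemLp (fun x => B * |p x|) 2 (volume.restrict K) := hp.abs.const_mul B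
  have hlim := h.ae_tendsto_restrict hK
  have l1 := hP.tendsto K hK hKc (fun i x => γ i x * p x) (fun x => γ' x * p x) _ hG
    (fun i => (h.meas_restrict hK i).mul hp.1) hb1
    (hlim.mono fun x hx => hx.mul_const (p x))
  have l2 := tendsto_integral_of_dominated_convergence (f := fun x => γ' x * p x ^ 2)
    (fun x => B * p x ^ 2) hm2 (hpsq.const_mul B) hb2 (hlim.mono fun x hx => hx.mul_const (p x ^ 2))
  have hi2 : ∀ i, IntegrableOn (fun x => γ i x * p x ^ 2) K := fun i =>
    (hpsq.const_mul B).mono' (hm2 i) (hb2 i)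
  have hPb : ∀ i, MemLp (P i) 2 (volume.restrict K) := fun i =>
    (locBddTendsto_const (hPm i).continuousOn).memLp hK hKc 2
  have hi1 : ∀ i, IntegrableOn (fun x => γ i x * p x * P i x) K := fun i =>
    (hG.mono' ((h.meas_restrict hK i).mul hp.1) (hb1 i)).integrable_mul (hPb i)
  have hi3 : ∀ i, IntegrableOn (fun x => γ i x * P i x ^ 2) K := fun i =>
    (h.memLp_apply hK hKc 2 i).integrable_mul
      ((locBddTendsto_const ((hPm i).pow 2).continuousOn).memLp hK hKc 2)
  -- This is the inequality 2pP - p² ≤ P², from (P - p)² ≥ 0. Its left side is affine in P and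
  -- passes to the weak limit.
  refine ⟨fun i => 2 * (∫ x in K, γ i x * p x * P i x) -
    ∫ x in K, γ i x * p x ^ 2, fun i => ?_, ?_⟩
  · beta_reduce
    rw [← integral_const_mul, ← integral_sub ((hi1 i).const_mul 2) (hi2 i)]
    refine setIntegral_mono_on (((hi1 i).const_mul 2).sub (hi2 i)) (hi3 i) hKm fun x hx => ?_
    have := mul_nonneg (hpos i x hx) (sq_nonneg (P i x - p x))
    nlinarith
  · have e : ∀ x, γ' x * p x * p x = γ' x * p x ^ 2 := fun x => by ring
    simp only [e] at l1
    have := (l1.const_mul 2).sub l2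
    rwa [two_mul, add_sub_cancel_right] at this

theorem integrableOn_mul : IntegrableOn (fun x => γ' x * p x) K :=
  (h.memLp hK hKc 2).integrable_mul (hP.memLp K hK hKc)

end LocBddTendsto

/-! ### Weak partial derivatives -/

theorem setIntegral_eq_of_support {f : Coord → ℝ} {K Ω : Set Coord} (hK : K ⊆ Ω)
    (hf : ∀ x, x ∉ K → f x = 0) : ∫ x in Ω, f x = ∫ x in K, f x := by
  rw [setIntegral_eq_integral_of_forall_compl_eq_zero hf,
    setIntegral_eq_integral_of_forall_compl_eq_zero fun x hx => hf x fun hx' => hx (hK hx')]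

theorem pd_eq_zero_of_notMem_tsupport {k : Fin 3} {ψ : Coord → ℝ} {x : Coord}
    (hx : x ∉ tsupport ψ) : pd k ψ x = 0 := by
  have : fderiv ℝ ψ x = 0 := by
    by_contra hne
    exact hx (support_fderiv_subset ℝ hne)
  rw [pd, this]; rfl

namespace HasWeakPartial

variable {Ω : Set Coord} {k : Fin 3} {f f' g g' : Coord → ℝ}

/-- The fundamental lemma of the calculus of variations. It lets the chosen representative in
`weakPartial` be replaced by an explicit formula. -/
theorem ae_eq (hΩ : IsOpen Ω) (h : HasWeakPartial Ω k f f') (h' : HasWeakPartial Ω k f g') :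
    ∀ᵐ x ∂volume.restrict Ω, f' x = g' x := by
  rw [ae_restrict_iff' hΩ.measurableSet]
  have key := hΩ.ae_eq_zero_of_integral_contDiff_smul_eq_zero (μ := volume)
    (h.locInt'.sub h'.locInt') (fun ψ hψ hψc hψs => by
      have hi : ∀ e : Coord → ℝ, LocallyIntegrableOn e Ω →
          IntegrableOn (fun x => e x * ψ x) (tsupport ψ) := fun e he =>
        (he.integrableOn_compact_subset hψs hψc).mul_continuousOn hψ.continuous.continuousOn hψc
      have h0 : ∀ e : Coord → ℝ, ∀ x, x ∉ tsupport ψ → e x * ψ x = 0 := fun e x hx => by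
        rw [image_eq_zero_of_notMem_tsupport hx, mul_zero]
      have h1 := h.parts ψ hψ hψc hψs
      rw [h'.parts ψ hψ hψc hψs, setIntegral_eq_of_support hψs (h0 f'),
        setIntegral_eq_of_support hψs (h0 g')] at h1
      have h2 : ∀ x, ψ x • (f' - g') x = f' x * ψ x - g' x * ψ x := fun x => by
        simp only [smul_eq_mul, Pi.sub_apply]; ring
      simp only [h2]
      rw [← setIntegral_eq_integral_of_forall_compl_eq_zero (s := tsupport ψ)
        (fun x hx => by rw [h0 f' x hx, h0 g' x hx, sub_zero]),
        integral_sub (hi f' h.locInt') (hi g' h'.locInt')]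
      linarith)
  filter_upwards [key] with x hx hxΩ
  exact sub_eq_zero.1 (hx hxΩ)

theorem weakPartial_ae_eq (hΩ : IsOpen Ω) (h : HasWeakPartial Ω k f f') :
    ∀ᵐ x ∂volume.restrict Ω, weakPartial Ω k f x = f' x := by
  have hex : ∃ f', HasWeakPartial Ω k f f' := ⟨f', h⟩
  rw [weakPartial, dif_pos hex]
  exact ae_eq hΩ hex.choose_spec h

theorem congr (hΩ : IsOpen Ω) (h : HasWeakPartial Ω k f f') (hf : EqOn f g Ω)
    (hf' : EqOn f' g' Ω) : HasWeakPartial Ω k g g' where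
  locInt := by
    refine (locallyIntegrableOn_iff hΩ.isLocallyClosed).2 fun K hK hKc => ?_
    exact (h.locInt.integrableOn_compact_subset hK hKc).congr_fun (hf.mono hK) hKc.measurableSet
  locInt' := by
    refine (locallyIntegrableOn_iff hΩ.isLocallyClosed).2 fun K hK hKc => ?_
    exact (h.locInt'.integrableOn_compact_subset hK hKc).congr_fun (hf'.mono hK) hKc.measurableSet
  parts ψ hψ hψc hψs := by
    have h1 := h.parts ψ hψ hψc hψs
    have e1 : EqOn (fun x => f x * pd k ψ x) (fun x => g x * pd k ψ x) Ω := fun x hx => by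
      simp only [hf hx]
    have e2 : EqOn (fun x => f' x * ψ x) (fun x => g' x * ψ x) Ω := fun x hx => by
      simp only [hf' hx]
    rw [setIntegral_congr_fun hΩ.measurableSet e1, setIntegral_congr_fun hΩ.measurableSet e2] at h1
    exact h1

theorem zero (Ω : Set Coord) (k : Fin 3) : HasWeakPartial Ω k (fun _ => 0) fun _ => 0 where
  locInt := (locallyIntegrable_zero).locallyIntegrableOn Ω
  locInt' := (locallyIntegrable_zero).locallyIntegrableOn Ω
  parts ψ _ _ _ := by simp

end HasWeakPartial

/-- The weak partial derivative of the limit of a sequence of functions whose partial derivatives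
depend linearly on a weakly convergent sequence. -/
theorem hasWeakPartial_of_tendsto {k : Fin 3} {f A B P : ℕ → Coord → ℝ}
    {f' A' B' p : Coord → ℝ} (hf : LocBddTendsto f f') (hA : LocBddTendsto A A')
    (hB : LocBddTendsto B B') (hP : IsLocalWeakLimit P p) (hPc : ∀ i, Continuous (P i))
    (hd : ∀ i, ∀ x ∈ polarDomain, DifferentiableAt ℝ (f i) x)
    (hpd : ∀ i, ∀ x ∈ polarDomain, pd k (f i) x = A i x + B i x * P i x) :
    HasWeakPartial polarDomain k f' fun x => A' x + B' x * p x := by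
  have hlc : IsLocallyClosed polarDomain := isOpen_polarDomain.isLocallyClosed
  refine ⟨(locallyIntegrableOn_iff hlc).2 fun K hK hKc => hf.integrableOn hK hKc,
    (locallyIntegrableOn_iff hlc).2 fun K hK hKc =>
      (hA.integrableOn hK hKc).add (hB.integrableOn_mul hK hKc hP), fun ψ hψ hψc hψs => ?_⟩
  set K := tsupport ψ with hKdef
  have hKm : MeasurableSet K := hψc.measurableSet
  have hψ0 : ∀ x, x ∉ K → ψ x = 0 := fun x hx => image_eq_zero_of_notMem_tsupport hx
  have hpψ0 : ∀ x, x ∉ K → pd k ψ x = 0 := fun x hx => pd_eq_zero_of_notMem_tsupport hx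
  have hψt := locBddTendsto_const (c := ψ) hψ.continuous.continuousOn
  have hpt := locBddTendsto_const (c := pd k ψ) (contDiff_pd hψ k).continuous.continuousOn
  have hfp := hf.mul hpt
  have hAψ := hA.mul hψt
  have hBψ := hB.mul hψt
  have hint : ∀ {γ : ℕ → Coord → ℝ} {γ' : Coord → ℝ}, LocBddTendsto γ γ' → ∀ i,
      IntegrableOn (γ i) K := fun h i => memLp_one_iff_integrable.1 (h.memLp_apply hψs hψc 1 i)
  have hBPi : ∀ i, IntegrableOn (fun x => B i x * ψ x * P i x) K := fun i =>
    (hint hBψ i).mul_continuousOn (hPc i).continuousOn hψc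
  -- Classical integration by parts along the sequence; both sides then pass to the limit and limits
  -- are unique.
  have hparts : ∀ i, ∫ x in K, f i x * pd k ψ x =
      -((∫ x in K, A i x * ψ x) + ∫ x in K, B i x * ψ x * P i x) := by
    intro i
    have e1 : EqOn (fun x => pd k (f i) x * ψ x) (fun x => A i x * ψ x + B i x * ψ x * P i x) K :=
      fun x hx => by
        simp only [hpd i x (hψs hx)]; ring
    have s1 : (Function.support fun x => pd k (f i) x * ψ x) ⊆ K := fun x hx => by
      by_contra hxK
      exact hx (by simp only [hψ0 x hxK, mul_zero])
    have s2 : (Function.support fun x => f i x * pd k ψ x) ⊆ K := fun x hx => by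
      by_contra hxK
      exact hx (by simp only [hpψ0 x hxK, mul_zero])
    have s3 : (Function.support fun x => f i x * ψ x) ⊆ K := fun x hx => by
      by_contra hxK
      exact hx (by simp only [hψ0 x hxK, mul_zero])
    have i1 : Integrable fun x => pd k (f i) x * ψ x :=
      (integrableOn_iff_integrable_of_support_subset s1).1
        (((hint hAψ i).add (hBPi i)).congr_fun e1.symm hKm)
    have i2 : Integrable fun x => f i x * pd k ψ x :=
      (integrableOn_iff_integrable_of_support_subset s2).1 (hint hfp i)
    have i3 : Integrable fun x => f i x * ψ x :=
      (integrableOn_iff_integrable_of_support_subset s3).1 (hint (hf.mul hψt) i)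
    have key := integral_mul_fderiv_eq_neg_fderiv_mul_of_integrable (v := Pi.single k 1) i1 i2 i3
      (fun x hx => hd i x (hψs hx)) (fun x _ => hψ.differentiable (by simp) x)
    change ∫ x, f i x * pd k ψ x = -∫ x, pd k (f i) x * ψ x at key
    rw [← integral_add (hint hAψ i) (hBPi i), ← setIntegral_congr_fun hKm e1,
      setIntegral_eq_integral_of_forall_compl_eq_zero (s := K)
        (fun x hx => by rw [hpψ0 x hx, mul_zero]),
      setIntegral_eq_integral_of_forall_compl_eq_zero (s := K)
        (fun x hx => by rw [hψ0 x hx, mul_zero]), key]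
  have l1 := hfp.tendsto_integral hψs hψc
  have l2 := ((hAψ.tendsto_integral hψs hψc).add
    (hBψ.tendsto_integral_mul hψs hψc hP)).neg
  rw [setIntegral_eq_of_support hψs (fun x hx => by rw [hpψ0 x hx, mul_zero]),
    setIntegral_eq_of_support hψs (fun x hx => by rw [hψ0 x hx, mul_zero])]
  have e2 : ∀ x, (A' x + B' x * p x) * ψ x = A' x * ψ x + B' x * ψ x * p x := fun x => by ring
  simp only [e2]
  rw [integral_add (hAψ.integrableOn hψs hψc) (hBψ.integrableOn_mul hψs hψc hP)]
  exact tendsto_nhds_unique (l1.congr hparts) l2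

namespace IsBoundedLimit

variable {m C : ℝ} {u : ℕ → ℝ → ℝ} {φ : ℕ → S2 → ℝ} {u' : ℝ → ℝ} {φ' : S2 → ℝ}
  (h : IsBoundedLimit m C u φ u' φ')
include h

theorem u_le_one (i : ℕ) {r : ℝ} (hr : r ∈ Icc (0 : ℝ) 2) : u i r ≤ 1 := by
  linarith [(h.bounds i).u_le_left hr, (h.bounds i).u_le_right hr]

theorem locBddTendsto_u : LocBddTendsto (fun i x => u i (x 0)) fun x => u' (x 0) where
  meas i := (continuousOn_comp_radius ((h.bounds i).continuousOn.mono
    Ioo_subset_Icc_self)).aestronglyMeasurable isOpen_polarDomain.measurableSet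
  bound K hK _ := ⟨1, fun i x hx => by
    have := Ioo_subset_Icc_self (hK hx)
    rw [abs_of_nonneg ((h.bounds i).u_nonneg this)]
    exact h.u_le_one i this⟩
  tendsto := (ae_restrict_mem isOpen_polarDomain.measurableSet).mono fun x hx =>
    h.tendsto_u_apply (Ioo_subset_Icc_self hx)

theorem exists_le_u {K : Set Coord} (hK : K ⊆ polarDomain) (hKc : IsCompact K) :
    ∃ δ > 0, ∀ i, ∀ x ∈ K, δ ≤ u i (x 0) := by
  obtain ⟨ε, hε, hKε⟩ := exists_slab hK hKc
  have hm := h.m_pos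
  refine ⟨m * (ε * ε), mul_pos hm (mul_pos hε.1 hε.1), fun i x hx => ?_⟩
  refine le_trans (mul_le_mul_of_nonneg_left ?_ hm.le)
    ((h.bounds i).le_u _ (Ioo_subset_Icc_self (hK hx)))
  exact mul_le_mul (hKε x hx).1 (by linarith [(hKε x hx).2]) hε.1.le (hK hx).1.le

theorem locBddTendsto_u_zpow (a : ℤ) :
    LocBddTendsto (fun i x => u i (x 0) ^ a) fun x => u' (x 0) ^ a :=
  h.locBddTendsto_u.zpow (fun _ hK hKc => h.exists_le_u hK hKc) a

theorem exists_log_bound {K : Set Coord} (hK : K ⊆ polarDomain) (hKc : IsCompact K) :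
    ∃ M, ∀ i, ∀ x ∈ K, |logLift (φ i) x| ≤ M := by
  have hc : ContinuousOn (fun x : Coord => C + |poleLog (x 0)| / 2) K :=
    (continuousOn_comp_radius (f := fun r => C + |poleLog r| / 2) fun r hr =>
      ((hasDerivAt_poleLog hr).continuousAt.abs.div_const 2).const_add C
        |>.continuousWithinAt).mono hK
  obtain ⟨M, hM⟩ := hKc.exists_bound_of_continuousOn hc
  exact ⟨M, fun i x hx => ((h.bounds i).abs_log_le x (hK hx)).trans
    ((le_abs_self _).trans (hM x hx))⟩

theorem locBddTendsto_exp : LocBddTendsto (fun i x => Real.exp (logLift (φ i) x))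
    fun x => Real.exp (logLift φ' x) where
  meas i := (h.bounds i).smoothPair.ψ_smooth.continuous.rexp.aestronglyMeasurable
  bound K hK hKc := by
    obtain ⟨M, hM⟩ := h.exists_log_bound hK hKc
    refine ⟨Real.exp M, fun i x hx => ?_⟩
    rw [abs_of_pos (Real.exp_pos _)]
    exact Real.exp_le_exp.2 ((le_abs_self _).trans (hM i x hx))
  tendsto := (ae_restrict_mem isOpen_polarDomain.measurableSet).mono fun x hx =>
    (h.tendsto_logLift hx).rexp

theorem locBddTendsto_exp_zpow (b : ℤ) :
    LocBddTendsto (fun i x => Real.exp (logLift (φ i) x) ^ b)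
      fun x => Real.exp (logLift φ' x) ^ b :=
  h.locBddTendsto_exp.zpow (fun _ hK hKc => by
    obtain ⟨M, hM⟩ := h.exists_log_bound hK hKc
    exact ⟨Real.exp (-M), Real.exp_pos _, fun i x hx =>
      Real.exp_le_exp.2 (abs_le.1 (hM i x hx)).1⟩) b

theorem locBddTendsto_deriv :
    LocBddTendsto (fun i x => deriv (u i) (x 0)) fun x => deriv u' (x 0) where
  meas i := (continuousOn_comp_radius
    (h.bounds i).smoothPair.deriv_smooth.continuousOn).aestronglyMeasurable
      isOpen_polarDomain.measurableSet
  bound _ hK _ := ⟨1, fun i _ hx => (h.bounds i).abs_deriv_le (hK hx)⟩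
  tendsto := h.ae_tendsto_deriv

theorem locBddTendsto_radial (k : Fin 3) :
    LocBddTendsto (fun i x => radial (deriv (u i)) k x) fun x => radial (deriv u') k x := by
  by_cases hk : k = 0
  · simpa only [radial, if_pos hk] using h.locBddTendsto_deriv
  · simpa only [radial, if_neg hk] using locBddTendsto_const continuousOn_const

/-- The nonzero entries of the metric and its inverse, and the weighted test function, all have the
form c u^a e^{bψ}, so this one computation yields every weak derivative needed. -/
theorem hasWeakPartial_monomial {P : Fin 3 → Coord → ℝ} {k : Fin 3}
    (hP : IsLocalWeakLimit (fun i => pd k (logLift (φ i))) (P k)) {c : Coord → ℝ}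
    (hc : ContDiffOn ℝ 1 c polarDomain) (a b : ℤ) :
    HasWeakPartial polarDomain k
      (fun x => c x * u' (x 0) ^ a * Real.exp (logLift φ' x) ^ b)
      (fun x => pd k c x * u' (x 0) ^ a * Real.exp (logLift φ' x) ^ b
        + c x * a * u' (x 0) ^ (a - 1) * radial (deriv u') k x * Real.exp (logLift φ' x) ^ b
        + c x * u' (x 0) ^ a * b * Real.exp (logLift φ' x) ^ b * P k x) := by
  have hct := locBddTendsto_const hc.continuousOn
  have hcd : ∀ x ∈ polarDomain, DifferentiableAt ℝ c x := fun x hx =>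
    (hc.contDiffAt (isOpen_polarDomain.mem_nhds hx)).differentiableAt (by simp)
  have hpc := locBddTendsto_const (c := pd k c)
    ((hc.continuousOn_fderiv_of_isOpen isOpen_polarDomain (by simp)).clm_apply continuousOn_const)
  have hcst : ∀ t : ℝ, LocBddTendsto (fun _ _ => t) fun _ => t := fun t =>
    locBddTendsto_const continuousOn_const
  have hu := h.locBddTendsto_u_zpow a
  have hE := h.locBddTendsto_exp_zpow b
  refine hasWeakPartial_of_tendsto ((hct.mul hu).mul hE)
    (((hpc.mul hu).mul hE).add ((((hct.mul (hcst a)).mul (h.locBddTendsto_u_zpow (a - 1))).mul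
      (h.locBddTendsto_radial k)).mul hE)) (((hct.mul hu).mul (hcst b)).mul hE) hP
    (fun i => (contDiff_pd (h.bounds i).smoothPair.ψ_smooth k).continuous) (fun i x hx => ?_)
    (fun i x hx => ?_)
  · have hs := (h.bounds i).smoothPair
    have hu' : DifferentiableAt ℝ (fun y : Coord => u i (y 0)) x :=
      (hs.u_diff hx).comp x (differentiableAt_apply 0 x)
    exact ((hcd x hx).mul (hu'.zpow (Or.inl (hs.u_pos _ hx).ne'))).mul
      ((hs.ψ_diff x).exp.zpow (Or.inl (Real.exp_pos _).ne'))
  · have hs := (h.bounds i).smoothPair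
    exact pd_monomial a b (hcd x hx) (hs.u_diff hx) (hs.u_pos _ hx).ne' (hs.ψ_diff x)

end IsBoundedLimit

/-! ### Regularity of the limit metric -/

theorem logMetric_apply (u : ℝ → ℝ) (ψ : Coord → ℝ) (x : Coord) (i j : Fin 3) :
    logMetric u ψ x i j =
      if i = j then 1 * u (x 0) ^ uExp i * Real.exp (ψ x) ^ eExp i else 0 := by
  rw [logMetric, Matrix.diagonal_apply, one_mul]

theorem logMetricInv_apply (u : ℝ → ℝ) (ψ : Coord → ℝ) (x : Coord) (i j : Fin 3) :
    logMetricInv u ψ x i j =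
      if i = j then 1 * u (x 0) ^ (-uExp i) * Real.exp (ψ x) ^ (-eExp i) else 0 := by
  rw [logMetricInv, Matrix.diagonal_apply, one_mul]

namespace IsBoundedLimit

variable {m C : ℝ} {u : ℕ → ℝ → ℝ} {φ : ℕ → S2 → ℝ} {u' : ℝ → ℝ} {φ' : S2 → ℝ}
  (h : IsBoundedLimit m C u φ u' φ')
include h

theorem metric_eq {x : Coord} (hx : x ∈ polarDomain) :
    warpedMetric u' φ' x = logMetric u' (logLift φ') x := warpedMetric_eq (h.polarLift_pos hx)

theorem inverse_eq {x : Coord} (hx : x ∈ polarDomain) :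
    (warpedMetric u' φ' x)⁻¹ = logMetricInv u' (logLift φ') x := by
  rw [h.metric_eq hx, logMetric_inv (h.u'_pos hx).ne']

theorem locBddTendsto_monomial (a b : ℤ) :
    LocBddTendsto (fun i x => 1 * u i (x 0) ^ a * Real.exp (logLift (φ i) x) ^ b)
      fun x => 1 * u' (x 0) ^ a * Real.exp (logLift φ' x) ^ b :=
  ((locBddTendsto_const continuousOn_const).mul (h.locBddTendsto_u_zpow a)).mul
    (h.locBddTendsto_exp_zpow b)

theorem posDef {x : Coord} (hx : x ∈ polarDomain) : (warpedMetric u' φ' x).PosDef := by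
  rw [h.metric_eq hx, logMetric, Matrix.posDef_diagonal_iff]
  exact fun i => mul_pos (zpow_pos (h.u'_pos hx) _) (zpow_pos (Real.exp_pos _) _)

/-- The proposition `p` stands for i = j, so that diagonal and off-diagonal entries are treated
together; likewise in `hasWeakPartial_entry`. -/
theorem locallyEssBounded_of_eqOn {f : Coord → ℝ} {p : Prop} [Decidable p] {a b : ℤ}
    (hf : ∀ x ∈ polarDomain, f x =
      if p then 1 * u' (x 0) ^ a * Real.exp (logLift φ' x) ^ b else 0) :
    LocallyEssBounded polarDomain f := by
  intro K hK hKc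
  have hae : ∀ᵐ x ∂volume.restrict K, (if p then 1 * u' (x 0) ^ a * Real.exp (logLift φ' x) ^ b
      else 0) = f x :=
    (ae_restrict_mem hKc.measurableSet).mono fun x hx => (hf x (hK hx)).symm
  refine MemLp.ae_eq hae ?_
  by_cases hp : p
  · simpa only [if_pos hp] using (h.locBddTendsto_monomial a b).memLp hK hKc ⊤
  · simp only [if_neg hp]
    exact MemLp.zero

section Gradient

variable {P : Fin 3 → Coord → ℝ} (hP : ∀ k, IsLocalWeakLimit (fun i => pd k (logLift (φ i))) (P k))
include hP

theorem hasWeakPartial_monoDeriv (k : Fin 3) (a b : ℤ) :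
    HasWeakPartial polarDomain k (fun x => 1 * u' (x 0) ^ a * Real.exp (logLift φ' x) ^ b)
      fun x => monoDeriv a b (u' (x 0)) (deriv u' (x 0)) (Real.exp (logLift φ' x))
        (fun k => P k x) k := by
  refine (h.hasWeakPartial_monomial (hP k) (c := fun _ => 1) contDiffOn_const a b).congr
    isOpen_polarDomain (fun _ _ => rfl) fun x _ => ?_
  simp only [pd, fderiv_fun_const, Pi.zero_apply, monoDeriv, radial,
    zero_mul, zero_add, one_mul, zero_apply]

theorem memLp_monoDeriv (k : Fin 3) (a b : ℤ) {K : Set Coord} (hK : K ⊆ polarDomain)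
    (hKc : IsCompact K) :
    MemLp (fun x => monoDeriv a b (u' (x 0)) (deriv u' (x 0)) (Real.exp (logLift φ' x))
      (fun k => P k x) k) 2 (volume.restrict K) := by
  have hcst : ∀ t : ℝ, LocBddTendsto (fun _ _ => t) fun _ => t := fun t =>
    locBddTendsto_const continuousOn_const
  have hE := h.locBddTendsto_exp_zpow b
  exact (((((hcst a).mul (h.locBddTendsto_u_zpow (a - 1))).mul (h.locBddTendsto_radial k)).mul
    hE).memLp hK hKc 2).add ((((h.locBddTendsto_u_zpow a).mul (hcst b)).mul hE).memLp_mul hK hKc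
      (hP k))

theorem hasWeakPartial_entry {f : Coord → ℝ} {p : Prop} [Decidable p] {a b : ℤ}
    (hf : ∀ x ∈ polarDomain, f x =
      if p then 1 * u' (x 0) ^ a * Real.exp (logLift φ' x) ^ b else 0) (k : Fin 3) :
    HasWeakPartial polarDomain k f fun x => if p then monoDeriv a b (u' (x 0)) (deriv u' (x 0))
      (Real.exp (logLift φ' x)) (fun k => P k x) k else 0 := by
  by_cases hp : p
  · simp only [if_pos hp] at hf ⊢
    exact (h.hasWeakPartial_monoDeriv hP k a b).congr isOpen_polarDomain
      (fun x hx => (hf x hx).symm) fun _ _ => rfl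
  · simp only [if_neg hp] at hf ⊢
    exact (HasWeakPartial.zero polarDomain k).congr isOpen_polarDomain
      (fun x hx => (hf x hx).symm) fun _ _ => rfl

theorem isLeeLeFlochMetric : IsLeeLeFlochMetric polarDomain (warpedMetric u' φ') where
  posDef _ hx := h.posDef hx
  bounded i j := h.locallyEssBounded_of_eqOn fun x hx => by
    rw [h.metric_eq hx, logMetric_apply]
  inv_bounded i j := h.locallyEssBounded_of_eqOn fun x hx => by
    rw [h.inverse_eq hx, logMetricInv_apply]
  sobolev k i j := by
    refine ⟨_, h.hasWeakPartial_entry hP (fun x hx => by rw [h.metric_eq hx, logMetric_apply]) k,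
      fun K hK hKc => ?_⟩
    by_cases hij : i = j
    · simpa only [if_pos hij] using h.memLp_monoDeriv hP k _ _ hK hKc
    · simp only [if_neg hij]
      exact MemLp.zero

theorem ae_hasWeakJet : ∀ᵐ x ∂volume.restrict polarDomain,
    HasWeakJet (warpedMetric u' φ') x (u' (x 0)) (deriv u' (x 0)) (Real.exp (logLift φ' x))
      fun k => P k x := by
  have h1 : ∀ᵐ x ∂volume.restrict polarDomain, ∀ k i j,
      weakPartial polarDomain k (fun y => warpedMetric u' φ' y i j) x =
        if i = j then monoDeriv (uExp i) (eExp i) (u' (x 0)) (deriv u' (x 0))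
          (Real.exp (logLift φ' x)) (fun k => P k x) k else 0 := by
    simp only [ae_all_iff]
    exact fun k i j => (h.hasWeakPartial_entry hP (fun x hx => by
      rw [h.metric_eq hx, logMetric_apply]) k).weakPartial_ae_eq isOpen_polarDomain
  have h2 : ∀ᵐ x ∂volume.restrict polarDomain, ∀ k i j,
      weakPartial polarDomain k (fun y => (warpedMetric u' φ' y)⁻¹ i j) x =
        if i = j then monoDeriv (-uExp i) (-eExp i) (u' (x 0)) (deriv u' (x 0))
          (Real.exp (logLift φ' x)) (fun k => P k x) k else 0 := by
    simp only [ae_all_iff]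
    exact fun k i j => (h.hasWeakPartial_entry hP (fun x hx => by
      rw [h.inverse_eq hx, logMetricInv_apply]) k).weakPartial_ae_eq isOpen_polarDomain
  filter_upwards [h1, h2, ae_restrict_mem isOpen_polarDomain.measurableSet] with x hx1 hx2 hx
  exact ⟨h.metric_eq hx, h.inverse_eq hx, hx1, hx2⟩

/-- The weighted test function is the monomial with c = w/s, a = 1, b = -1. -/
theorem ae_weakPartial_weighted {w : Coord → ℝ} (hw : ContDiff ℝ ∞ w) :
    ∀ᵐ x ∂volume.restrict polarDomain,
      weakPartial polarDomain 0 (weighted standardMetric (warpedMetric u' φ') w) x =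
        (pd 0 w x / stdRadius (x 0) - w x * deriv stdRadius (x 0) / stdRadius (x 0) ^ 2)
          * u' (x 0) * (Real.exp (logLift φ' x))⁻¹
        + w x / stdRadius (x 0) * deriv u' (x 0) * (Real.exp (logLift φ' x))⁻¹
        - w x / stdRadius (x 0) * u' (x 0) * (Real.exp (logLift φ' x))⁻¹ * P 0 x := by
  have hs : ContDiff ℝ ∞ fun x : Coord => stdRadius (x 0) :=
    contDiff_stdRadius.comp (contDiff_apply ℝ ℝ 0)
  have hc : ContDiffOn ℝ 1 (fun x => w x / stdRadius (x 0)) polarDomain :=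
    ((hw.contDiffOn.div hs.contDiffOn fun x hx => (stdRadius_pos hx).ne').of_le (by simp))
  refine HasWeakPartial.weakPartial_ae_eq isOpen_polarDomain
    ((h.hasWeakPartial_monomial (hP 0) hc 1 (-1)).congr isOpen_polarDomain ?_ ?_)
  · intro x hx
    have h1 : 0 < stdRadius (x 0) := stdRadius_pos hx
    simp only [weighted, volDensity_standard hx]
    rw [volDensity, h.metric_eq hx, ← volDensity, volDensity_logMetric (h.u'_pos hx)]
    simp only [zpow_one, zpow_neg]
    field_simp
  · intro x hx
    have h1 : 0 < stdRadius (x 0) := stdRadius_pos hx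
    have hsd : DifferentiableAt ℝ stdRadius (x 0) :=
      contDiff_stdRadius.differentiable (by simp) _
    have hpd : pd 0 (fun x => w x / stdRadius (x 0)) x =
        pd 0 w x / stdRadius (x 0) - w x * deriv stdRadius (x 0) / stdRadius (x 0) ^ 2 := by
      -- The quotient rule for w/s, read off as a monomial in s with exponent -1.
      have := pd_monomial (k := 0) (c := w) (ψ := fun _ => 0) (u := stdRadius) (x := x) (-1) 0
        (hw.differentiable (by simp) x) hsd h1.ne' (differentiableAt_const _)
      simp only [zpow_zero, mul_one, radial, if_true, zpow_neg, zpow_one, Int.cast_zero, mul_zero,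
        zero_mul, add_zero, ← div_eq_mul_inv] at this
      rw [this, show (-1 - 1 : ℤ) = -2 by norm_num, zpow_neg, zpow_ofNat]
      push_cast
      field_simp
      ring
    simp only [hpd, radial, if_true, zpow_one, zpow_neg, sub_self, zpow_zero]
    push_cast
    ring

theorem ae_integrand_eq (hP2 : ∀ x, P 2 x = 0) {v : S2 × Circle → ℝ}
    (hv : ContMDiff ((𝓡 2).prod (𝓡 1)) 𝓘(ℝ, ℝ) ∞ v) :
    ∀ᵐ x ∂volume.restrict polarDomain, integrand (warpedMetric u' φ') v x =
      jetDensity (u' (x 0)) (deriv u' (x 0)) (Real.exp (logLift φ' x)) (P 0 x) (P 1 x)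
        (v (polar x)) (pd 0 (fun y => v (polar y)) x) (stdRadius (x 0)) (deriv stdRadius (x 0))
        (deriv (deriv stdRadius) (x 0)) := by
  filter_upwards [h.ae_hasWeakJet hP, h.ae_weakPartial_weighted hP (contDiff_comp_polar hv),
    ae_restrict_mem isOpen_polarDomain.measurableSet] with x h1 h2 hx
  exact h1.pairingDensity_eq hx (h.u'_pos hx) (Real.exp_pos _) (hP2 x) h2

end Gradient

end IsBoundedLimit

/-! ### The curvature density as a quadratic function of the gradient -/

/-- The part of `jetDensity` that does not contain the gradient of `log φ`. -/
def jetConst (u du E w w₀ s ds dds : ℝ) : ℝ :=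
  E * (2 * du * w₀ - (w₀ * ds + w * dds) * (s * u⁻¹ + u * s⁻¹)
    - w * ds * (ds * u⁻¹ - s * du * (u⁻¹ * u⁻¹) + du * s⁻¹ - u * ds * (s⁻¹ * s⁻¹)))

/-- The linear coefficient of `jetDensity`. -/
def jetLinear (u du E w s ds : ℝ) : ℝ := E * w * (2 * du - ds * (s * u⁻¹ + u * s⁻¹))

/-- The sorting needed for the limit: the constant and linear parts converge, and the squares carry
nonpositive coefficients when w ≥ 0, u > 0 and E > 0, so weak limits can only increase the integral.
-/
theorem jetDensity_eq {u : ℝ} (hu : u ≠ 0) (du E p q w w₀ s ds dds : ℝ) :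
    jetDensity u du E p q w w₀ s ds dds = jetConst u du E w w₀ s ds dds
      + jetLinear u du E w s ds * p - 2 * E * w * u * p ^ 2 - 2 * E * w * u⁻¹ * q ^ 2 := by
  have : u * (q ^ 2 / u ^ 2) = u⁻¹ * q ^ 2 := by field_simp
  have h2 : 2 * E * w * u * (p ^ 2 + q ^ 2 / u ^ 2) =
      2 * E * w * u * p ^ 2 + 2 * E * w * (u * (q ^ 2 / u ^ 2)) := by ring
  rw [jetDensity, h2, this, jetConst, jetLinear]
  simp only [div_eq_mul_inv, ← inv_pow]
  ring

/-! ### The inequality for smooth pairs -/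

/-- The radial factor of the boundary term. -/
def fluxFactor (u : ℝ → ℝ) (r : ℝ) : ℝ :=
  2 * deriv u r - deriv stdRadius r * (stdRadius r / u r + u r / stdRadius r)

/-- The boundary term. -/
def flux (u : ℝ → ℝ) (ψ w : Coord → ℝ) (x : Coord) : ℝ :=
  Real.exp (ψ x) * w x * fluxFactor u (x 0)

namespace SmoothPair

variable {u : ℝ → ℝ} {ψ w : Coord → ℝ} (h : SmoothPair u ψ)
include h

theorem contDiffOn_fluxFactor : ContDiffOn ℝ ∞ (fluxFactor u) (Ioo 0 2) := by
  have hs : ContDiffOn ℝ ∞ stdRadius (Ioo 0 2) := contDiff_stdRadius.contDiffOn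
  exact (contDiffOn_const.mul h.deriv_smooth).sub (smoothPair_std.deriv_smooth.mul
    ((hs.div h.u_smooth fun r hr => (h.u_pos r hr).ne').add
      (h.u_smooth.div hs fun r hr => (stdRadius_pos hr).ne')))

theorem contDiffOn_flux (hw : ContDiff ℝ ∞ w) : ContDiffOn ℝ ∞ (flux u ψ w) polarDomain :=
  (h.ψ_smooth.exp.mul hw).contDiffOn.mul (h.contDiffOn_fluxFactor.comp
    (contDiff_apply ℝ ℝ (0 : Fin 3)).contDiffOn fun _ hx => hx)

/-- The last summand is w times the scalar curvature times the density u e^{-ψ}. Thus for smooth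
pairs the pairing is the classical one up to a boundary flux. -/
theorem jetDensity_eq_pd_flux (hw : ContDiff ℝ ∞ w) {x : Coord} (hx : x ∈ polarDomain) :
    jetDensity (u (x 0)) (deriv u (x 0)) (Real.exp (ψ x)) (pd 0 ψ x) (pd 1 ψ x) (w x) (pd 0 w x)
      (stdRadius (x 0)) (deriv stdRadius (x 0)) (deriv (deriv stdRadius) (x 0)) =
    pd 0 (flux u ψ w) x + 2 * Real.exp (ψ x) * w x * (-deriv (deriv u) (x 0)
      - u (x 0) * (pd 0 ψ x ^ 2 + pd 1 ψ x ^ 2 / u (x 0) ^ 2)) := by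
  have hu0 := (h.u_pos _ hx).ne'
  have hs0 := (smoothPair_std.u_pos _ hx).ne'
  have hd : HasDerivAt (fluxFactor u) _ (x 0) :=
    ((h.du_diff hx).hasDerivAt.const_mul 2).fun_sub
      ((smoothPair_std.du_diff hx).hasDerivAt.fun_mul
        (((smoothPair_std.u_diff hx).hasDerivAt.fun_div (h.u_diff hx).hasDerivAt hu0).fun_add
          ((h.u_diff hx).hasDerivAt.fun_div (smoothPair_std.u_diff hx).hasDerivAt hs0)))
  have hw' : DifferentiableAt ℝ w x := hw.differentiable (by simp) x
  have hE : DifferentiableAt ℝ (fun y => Real.exp (ψ y)) x := (h.ψ_diff x).exp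
  have hG : DifferentiableAt ℝ (fun y : Coord => fluxFactor u (y 0)) x :=
    DifferentiableAt.comp (g := fluxFactor u) (f := fun y : Coord => y 0) x hd.differentiableAt
      (differentiableAt_apply 0 x)
  have e : pd 0 (flux u ψ w) x = _ := pd_mul (f := fun y => Real.exp (ψ y) * w y) (hE.mul hw') hG
  rw [e, pd_mul hE hw', pd_exp (h.ψ_diff x), pd_comp_coord hd.differentiableAt, if_pos rfl,
    hd.deriv, jetDensity, fluxFactor]
  field_simp
  ring

end SmoothPair

theorem two_le_div_add_div {a b : ℝ} (ha : 0 < a) (hb : 0 < b) : 2 ≤ a / b + b / a := by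
  rw [div_add_div _ _ hb.ne' ha.ne', le_div_iff₀ (by positivity)]
  nlinarith [sq_nonneg (a - b)]

/-- A crude bound, giving e^ψ ≤ e^C · 2/ε on the boundary of M_ε. The true order is ε^{-1/2}, but
the flux factor gains ε², so 1/ε is enough. -/
theorem abs_poleLog_le {ε : ℝ} (hε : ε ∈ Ioo (0 : ℝ) 1) :
    |poleLog ε| / 2 ≤ Real.log (2 / ε) ∧ |poleLog (2 - ε)| / 2 ≤ Real.log (2 / ε) := by
  have h1 : Real.log ε ≤ Real.log (2 - ε) := Real.log_le_log hε.1 (by linarith [hε.2])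
  have h2 : Real.log (2 - ε) ≤ Real.log 2 :=
    Real.log_le_log (by linarith [hε.2]) (by linarith [hε.1])
  have h3 : poleLog (2 - ε) = -poleLog ε := by
    rw [poleLog, poleLog, sub_sub_cancel]; ring
  have h4 : |poleLog ε| = Real.log (2 - ε) - Real.log ε := by
    rw [poleLog, abs_of_nonpos (by linarith)]; ring
  rw [h3, abs_neg, h4, Real.log_div two_ne_zero hε.1.ne']
  constructor <;> linarith

/-- Integration of a derivative in the direction of `r` over `boxEps ε`. -/
theorem integral_boxEps_pd_zero_ge {T : Coord → ℝ} (hT : ContDiffOn ℝ ∞ T polarDomain) {ε B : ℝ}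
    (hε : ε ∈ Ioo (0 : ℝ) 1) (h0 : ∀ x ∈ polarDomain, x 0 = ε → T x ≤ B)
    (h2 : ∀ x ∈ polarDomain, x 0 = 2 - ε → -B ≤ T x) :
    IntegrableOn (pd 0 T) (boxEps ε) ∧
      -(8 * Real.pi ^ 2 * B) ≤ ∫ x in boxEps ε, pd 0 T x := by
  have hpi := Real.pi_pos
  have hsub := boxEps_subset hε.1
  have hint : IntegrableOn (pd 0 T) (boxEps ε) :=
    (((hT.continuousOn_fderiv_of_isOpen isOpen_polarDomain (by simp)).clm_apply
      continuousOn_const).mono hsub).integrableOn_compact (isCompact_boxEps ε)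
  refine ⟨hint, ?_⟩
  have hd : ∀ x ∈ polarDomain, HasFDerivAt T (fderiv ℝ T x) x := fun x hx =>
    ((hT.contDiffAt (isOpen_polarDomain.mem_nhds hx)).differentiableAt (by simp)).hasFDerivAt
  set a : Coord := ![ε, 0, 0] with ha
  set b : Coord := ![2 - ε, 2 * Real.pi, 2 * Real.pi] with hb
  have hab : a ≤ b := by
    intro i
    fin_cases i
    · change ε ≤ 2 - ε; linarith [hε.2]
    · change (0 : ℝ) ≤ 2 * Real.pi; positivity
    · change (0 : ℝ) ≤ 2 * Real.pi; positivity
  have hIcc : boxEps ε = Icc a b := boxEps_eq_Icc ε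
  rw [hIcc] at hsub hint ⊢
  have hsum : ∀ x, ∑ i : Fin 3, (![fderiv ℝ T x, 0, 0] : Fin 3 → Coord →L[ℝ] ℝ) i
      (Pi.single i 1) = pd 0 T x := fun x => by
    simp [Fin.sum_univ_three, pd]
  -- The vector field is (T, 0, 0), so only the faces r = ε and r = 2 - ε contribute.
  have key := integral_divergence_of_hasFDerivAt_off_countable' a b hab
    (![T, fun _ => 0, fun _ => 0] : Fin 3 → Coord → ℝ)
    (fun i x => (![fderiv ℝ T x, 0, 0] : Fin 3 → Coord →L[ℝ] ℝ) i) ∅ countable_empty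
    (fun i => by
      fin_cases i
      · exact hT.continuousOn.mono hsub
      · exact continuousOn_const
      · exact continuousOn_const)
    (fun x hx i => by
      have hx' : x ∈ Icc a b := ⟨fun j => (hx.1 j (mem_univ j)).1.le,
        fun j => (hx.1 j (mem_univ j)).2.le⟩
      fin_cases i
      · exact hd x (hsub hx')
      · exact hasFDerivAt_const 0 x
      · exact hasFDerivAt_const 0 x)
    (by simpa only [hsum] using hint)
  simp only [hsum] at key
  rw [key, Fin.sum_univ_three]
  simp only [Matrix.cons_val_zero, Matrix.cons_val_one, Matrix.cons_val, integral_zero, sub_zero,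
    add_zero]
  set S : Set (Fin 2 → ℝ) := Icc (a ∘ Fin.succAbove 0) (b ∘ Fin.succAbove 0) with hS
  have hSc : IsCompact S := isCompact_Icc
  have hSv : volume.real S = 4 * Real.pi ^ 2 := by
    rw [hS, Measure.real, Real.volume_Icc_pi_toReal (a := a ∘ Fin.succAbove 0)
      (b := b ∘ Fin.succAbove 0) (fun i => hab _), Fin.prod_univ_two]
    simp [ha, hb]
    ring
  have hmem : ∀ t ∈ Ioo (0 : ℝ) 2, ∀ y : Fin 2 → ℝ, (Fin.insertNth 0 t y : Coord) ∈ polarDomain := by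
    intro t ht y
    change (Fin.insertNth 0 t y : Coord) 0 ∈ Ioo (0 : ℝ) 2
    simpa using ht
  have hfc : ∀ t ∈ Ioo (0 : ℝ) 2, IntegrableOn (fun y => T (Fin.insertNth 0 t y)) S := by
    intro t ht
    refine ContinuousOn.integrableOn_compact hSc (hT.continuousOn.comp ?_ fun y _ => hmem t ht y)
    have : Continuous fun y : Fin 2 → ℝ => (Fin.insertNth 0 t y : Coord) :=
      Continuous.finInsertNth (A := fun _ => ℝ) 0 continuous_const continuous_id
    exact this.continuousOn
  have hε0 : ε ∈ Ioo (0 : ℝ) 2 := ⟨hε.1, by linarith [hε.2]⟩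
  have hε2 : 2 - ε ∈ Ioo (0 : ℝ) 2 := ⟨by linarith [hε.2], by linarith [hε.1]⟩
  have hconst : ∀ c : ℝ, ∫ _ in S, c = 4 * Real.pi ^ 2 * c := fun c => by
    rw [setIntegral_const, hSv, smul_eq_mul]
  have hci : ∀ c : ℝ, IntegrableOn (fun _ : Fin 2 → ℝ => c) S := fun c =>
    integrableOn_const hSc.measure_lt_top.ne
  have g1 : ∫ _ in S, -B ≤ ∫ y in S, T (Fin.insertNth 0 (2 - ε) y) :=
    setIntegral_mono_on (hci _) (hfc _ hε2) hSc.measurableSet fun y _ =>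
      h2 _ (hmem _ hε2 y) (by simp)
  have g2 : ∫ y in S, T (Fin.insertNth 0 ε y) ≤ ∫ _ in S, B :=
    setIntegral_mono_on (hfc _ hε0) (hci _) hSc.measurableSet fun y _ =>
      h0 _ (hmem _ hε0 y) (by simp)
  rw [hconst] at g1 g2
  have g3 : a 0 = ε := rfl
  have g4 : b 0 = 2 - ε := rfl
  rw [g3, g4]
  linarith

/-! ### Uniform lower bound for the integrals over M_ε. -/

namespace HasUniformBounds

variable {m C : ℝ} {u : ℝ → ℝ} {φ : S2 → ℝ} (h : HasUniformBounds m C u φ)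
include h

/-- Applied with t = cos(πε/2): the product of 2/ε and ε² leaves one power of ε, with a constant
that depends on the pair only through C. -/
theorem abs_flux_bound {w : Coord → ℝ} {W ε : ℝ} (hw0 : ∀ x, 0 ≤ w x) (hW : ∀ x, w x ≤ W)
    (hε : ε ∈ Ioo (0 : ℝ) 1) {t : ℝ} (ht1 : t ≤ 1) (ht : 1 - t ≤ Real.pi ^ 2 / 8 * ε ^ 2)
    {x : Coord} (hx : |poleLog (x 0)| / 2 ≤ Real.log (2 / ε)) (hxd : x ∈ polarDomain) :
    Real.exp (logLift φ x) * w x * (2 * (1 - t)) ≤ Real.exp C * W * (Real.pi ^ 2 / 2) * ε := by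
  have h1 : Real.exp (logLift φ x) ≤ Real.exp C * (2 / ε) := by
    rw [← Real.exp_log (show (0 : ℝ) < 2 / ε from div_pos two_pos hε.1), ← Real.exp_add]
    exact Real.exp_le_exp.2 ((le_abs_self _).trans ((h.abs_log_le x hxd).trans (by linarith)))
  have hε0 := hε.1
  have hE := Real.exp_pos (logLift φ x)
  have hC := Real.exp_pos C
  have hW0 := (hw0 x).trans (hW x)
  calc Real.exp (logLift φ x) * w x * (2 * (1 - t))
      ≤ Real.exp C * (2 / ε) * W * (2 * (Real.pi ^ 2 / 8 * ε ^ 2)) := by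
        refine mul_le_mul (mul_le_mul h1 (hW x) (hw0 x) (by positivity)) (by linarith)
          (by linarith) (by positivity)
    _ = _ := by field_simp; ring

/-- Only one sign of the flux matters at each end. At r = ε, u' ≤ 1 and s/u + u/s ≥ 2 give a flux
factor of at most 2(1 - cos(πε/2)); at r = 2 - ε, where s' changes sign, u' ≥ -1 gives the opposite
bound. The interior term is nonnegative by the energy inequality. -/
theorem integral_jetDensity_ge {w : Coord → ℝ} (hw : ContDiff ℝ ∞ w) {W ε : ℝ}
    (hw0 : ∀ x, 0 ≤ w x) (hW : ∀ x, w x ≤ W) (hε : ε ∈ Ioo (0 : ℝ) 1)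
    (hint : IntegrableOn (fun x => jetDensity (u (x 0)) (deriv u (x 0)) (Real.exp (logLift φ x))
      (pd 0 (logLift φ) x) (pd 1 (logLift φ) x) (w x) (pd 0 w x) (stdRadius (x 0))
      (deriv stdRadius (x 0)) (deriv (deriv stdRadius) (x 0))) (boxEps ε)) :
    -(8 * Real.pi ^ 2 * (Real.exp C * W * (Real.pi ^ 2 / 2) * ε)) ≤
      ∫ x in boxEps ε, jetDensity (u (x 0)) (deriv u (x 0)) (Real.exp (logLift φ x))
        (pd 0 (logLift φ) x) (pd 1 (logLift φ) x) (w x) (pd 0 w x) (stdRadius (x 0))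
        (deriv stdRadius (x 0)) (deriv (deriv stdRadius) (x 0)) := by
  have hpi := Real.pi_pos
  have hs := h.smoothPair
  set t := Real.cos (Real.pi * ε / 2) with ht
  have ht1 : t ≤ 1 := Real.cos_le_one _
  have ht0 : 0 ≤ t := Real.cos_nonneg_of_mem_Icc ⟨by nlinarith [hε.1], by nlinarith [hε.2]⟩
  have htε : 1 - t ≤ Real.pi ^ 2 / 8 * ε ^ 2 := by
    have := Real.one_sub_sq_div_two_le_cos (x := Real.pi * ε / 2)
    rw [← ht] at this
    nlinarith
  have hfac : ∀ r ∈ Ioo (0 : ℝ) 2, 2 ≤ stdRadius r / u r + u r / stdRadius r := fun r hr =>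
    two_le_div_add_div (stdRadius_pos hr) (h.u_pos r hr)
  obtain ⟨hi, hge⟩ := integral_boxEps_pd_zero_ge (hs.contDiffOn_flux hw)
    (B := Real.exp C * W * (Real.pi ^ 2 / 2) * ε) hε (fun x hx hx0 => by
      have hEw := mul_nonneg (Real.exp_pos (logLift φ x)).le (hw0 x)
      refine le_trans (mul_le_mul_of_nonneg_left ?_ hEw) (h.abs_flux_bound hw0 hW hε ht1 htε
        (by rw [hx0]; exact (abs_poleLog_le hε).1) hx)
      rw [fluxFactor, deriv_stdRadius]
      have h1 := (abs_le.1 (h.abs_deriv_le hx)).2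
      have h2 := hfac _ hx
      have h3 : Real.cos (Real.pi * x 0 / 2) = t := by rw [hx0]
      rw [h3]
      nlinarith) (fun x hx hx0 => by
      have hEw := mul_nonneg (Real.exp_pos (logLift φ x)).le (hw0 x)
      refine le_trans (neg_le_neg (h.abs_flux_bound hw0 hW hε ht1 htε
        (by rw [hx0]; exact (abs_poleLog_le hε).2) hx)) ?_
      rw [← mul_neg]
      refine mul_le_mul_of_nonneg_left ?_ hEw
      rw [fluxFactor, deriv_stdRadius]
      have h1 := (abs_le.1 (h.abs_deriv_le hx)).1
      have h2 := hfac _ hx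
      have h3 : Real.cos (Real.pi * x 0 / 2) = -t := by
        rw [hx0, ht, ← Real.cos_pi_sub]; congr 1; ring
      rw [h3]
      nlinarith)
  refine hge.trans (setIntegral_mono_on hi hint (isCompact_boxEps ε).measurableSet fun x hx => ?_)
  have hxd := boxEps_subset hε.1 hx
  rw [hs.jetDensity_eq_pd_flux hw hxd]
  have h1 := h.energy x hxd
  have h2 := mul_nonneg (mul_nonneg two_pos.le (Real.exp_pos (logLift φ x)).le) (hw0 x)
  have := mul_nonneg h2 (sub_nonneg.2 h1)
  linarith

end HasUniformBounds

/-! ### Nonnegativity of the scalar curvature distribution of the limit -/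

/-- The shift by 2 keeps every parameter below 1, already for n = 0. -/
theorem iUnion_boxEps : ⋃ n : ℕ, boxEps (1 / ((n : ℝ) + 2)) = box := by
  ext x
  simp only [mem_iUnion]
  constructor
  · rintro ⟨n, hn⟩
    exact ⟨boxEps_subset (by positivity) hn, hn.2.1, hn.2.2⟩
  · rintro ⟨⟨h0, h2⟩, h1⟩
    obtain ⟨n, hn⟩ := exists_nat_one_div_lt (lt_min h0 (sub_pos.2 h2))
    have h3 : 1 / ((n : ℝ) + 2) ≤ 1 / ((n : ℝ) + 1) :=
      one_div_le_one_div_of_le (by positivity) (by linarith)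
    have h4 := hn.trans_le (min_le_left _ _)
    have h5 := hn.trans_le (min_le_right _ _)
    exact ⟨n, ⟨by linarith, by linarith⟩, h1⟩

theorem monotone_boxEps : Monotone fun n : ℕ => boxEps (1 / ((n : ℝ) + 2)) := by
  intro n k hnk x hx
  have h1 : (n : ℝ) ≤ k := Nat.cast_le.2 hnk
  have h3 : 1 / ((k : ℝ) + 2) ≤ 1 / ((n : ℝ) + 2) :=
    one_div_le_one_div_of_le (by positivity) (by linarith)
  exact ⟨⟨h3.trans hx.1.1, hx.1.2.trans (by linarith)⟩, hx.2⟩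

theorem pairing_nonneg_of_le {g : MetricField} {v : S2 × Circle → ℝ} {N : ℝ}
    (h : ∀ ε ∈ Ioo (0 : ℝ) 1, -(N * ε) ≤ ∫ x in boxEps ε, integrand g v x) : 0 ≤ pairing g v := by
  have hlim : Tendsto (fun ε : ℝ => ((-(N * ε) : ℝ) : EReal)) (𝓝[>] 0) (𝓝 ((0 : ℝ) : EReal)) := by
    refine (continuous_coe_real_ereal.tendsto 0).comp ?_
    have : Tendsto (fun ε : ℝ => -(N * ε)) (𝓝 0) (𝓝 (-(N * 0))) :=
      (continuous_const.mul continuous_id).neg.tendsto 0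
    rw [mul_zero, neg_zero] at this
    exact this.mono_left nhdsWithin_le_nhds
  rw [pairing, ← EReal.coe_zero, ← hlim.liminf_eq]
  refine liminf_le_liminf ?_
  filter_upwards [Ioo_mem_nhdsGT one_pos] with ε hε
  exact EReal.coe_le_coe_iff.2 (h ε hε)

theorem integral_nonneg_of_le {f : Coord → ℝ} {N : ℝ} (hf : IntegrableOn f box)
    (h : ∀ ε ∈ Ioo (0 : ℝ) 1, -(N * ε) ≤ ∫ x in boxEps ε, f x) : 0 ≤ ∫ x in box, f x := by
  rw [← iUnion_boxEps] at hf ⊢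
  have hlim := tendsto_setIntegral_of_monotone
    (fun n : ℕ => (isCompact_boxEps (1 / ((n : ℝ) + 2))).measurableSet) monotone_boxEps hf
  have h0 : Tendsto (fun n : ℕ => -(N * (1 / ((n : ℝ) + 2)))) atTop (𝓝 0) := by
    have h1 : Tendsto (fun n : ℕ => 1 / ((n : ℝ) + 2)) atTop (𝓝 0) :=
      tendsto_const_nhds.div_atTop (tendsto_natCast_atTop_atTop.atTop_add tendsto_const_nhds)
    simpa using (h1.const_mul N).neg
  refine le_of_tendsto_of_tendsto h0 hlim (Eventually.of_forall fun n => h _ ⟨by positivity, ?_⟩)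
  rw [div_lt_one (by positivity)]
  have : (0 : ℝ) ≤ n := Nat.cast_nonneg n
  linarith

theorem integral_add_sub_sub {μ : Measure Coord} {a b c d : Coord → ℝ} (ha : Integrable a μ)
    (hb : Integrable b μ) (hc : Integrable c μ) (hd : Integrable d μ) :
    ∫ x, (a x + b x - c x - d x) ∂μ =
      ∫ x, a x ∂μ + ∫ x, b x ∂μ - ∫ x, c x ∂μ - ∫ x, d x ∂μ := by
  have h1 : Integrable (fun x => a x + b x) μ := ha.add hb
  have h2 : Integrable (fun x => a x + b x - c x) μ := h1.sub hc
  rw [integral_sub h2 hd, integral_sub h1 hc, integral_add ha hb]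

namespace IsBoundedLimit

variable {m C : ℝ} {u : ℕ → ℝ → ℝ} {φ : ℕ → S2 → ℝ} {u' : ℝ → ℝ} {φ' : S2 → ℝ}
  (h : IsBoundedLimit m C u φ u' φ') {w : Coord → ℝ} (hw : ContDiff ℝ ∞ w)
include h hw

theorem locBddTendsto_jetConst : LocBddTendsto
    (fun i x => jetConst (u i (x 0)) (deriv (u i) (x 0)) (Real.exp (logLift (φ i) x)) (w x)
      (pd 0 w x) (stdRadius (x 0)) (deriv stdRadius (x 0)) (deriv (deriv stdRadius) (x 0)))
    fun x => jetConst (u' (x 0)) (deriv u' (x 0)) (Real.exp (logLift φ' x)) (w x)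
      (pd 0 w x) (stdRadius (x 0)) (deriv stdRadius (x 0)) (deriv (deriv stdRadius) (x 0)) := by
  have h2 : LocBddTendsto (fun _ _ => (2 : ℝ)) fun _ => 2 := locBddTendsto_const continuousOn_const
  have hw' := locBddTendsto_const hw.continuous.continuousOn
  have hw₀ := locBddTendsto_const (contDiff_pd hw 0).continuous.continuousOn
  have hs := locBddTendsto_const (continuousOn_comp_radius smoothPair_std.u_smooth.continuousOn)
  have hds := locBddTendsto_const
    (continuousOn_comp_radius smoothPair_std.deriv_smooth.continuousOn)
  have hdds := locBddTendsto_const (continuousOn_comp_radius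
    (smoothPair_std.deriv_smooth.deriv_of_isOpen (m := ∞) isOpen_Ioo (by simp)).continuousOn)
  have hsi := locBddTendsto_const (continuousOn_comp_radius (smoothPair_std.u_smooth.continuousOn.inv₀
    fun r hr => (stdRadius_pos hr).ne'))
  have hu := h.locBddTendsto_u
  have hdu := h.locBddTendsto_deriv
  have hui := h.locBddTendsto_u_zpow (-1)
  simp only [zpow_neg, zpow_one] at hui
  exact h.locBddTendsto_exp.mul ((((h2.mul hdu).mul hw₀).sub
    (((hw₀.mul hds).add (hw'.mul hdds)).mul ((hs.mul hui).add (hu.mul hsi)))).sub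
    ((hw'.mul hds).mul ((((hds.mul hui).sub ((hs.mul hdu).mul (hui.mul hui))).add
      (hdu.mul hsi)).sub ((hu.mul hds).mul (hsi.mul hsi)))))

theorem locBddTendsto_jetLinear : LocBddTendsto
    (fun i x => jetLinear (u i (x 0)) (deriv (u i) (x 0)) (Real.exp (logLift (φ i) x)) (w x)
      (stdRadius (x 0)) (deriv stdRadius (x 0)))
    fun x => jetLinear (u' (x 0)) (deriv u' (x 0)) (Real.exp (logLift φ' x)) (w x)
      (stdRadius (x 0)) (deriv stdRadius (x 0)) := by
  have h2 : LocBddTendsto (fun _ _ => (2 : ℝ)) fun _ => 2 := locBddTendsto_const continuousOn_const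
  have hw' := locBddTendsto_const hw.continuous.continuousOn
  have hs := locBddTendsto_const (continuousOn_comp_radius smoothPair_std.u_smooth.continuousOn)
  have hds := locBddTendsto_const
    (continuousOn_comp_radius smoothPair_std.deriv_smooth.continuousOn)
  have hsi := locBddTendsto_const (continuousOn_comp_radius (smoothPair_std.u_smooth.continuousOn.inv₀
    fun r hr => (stdRadius_pos hr).ne'))
  have hui := h.locBddTendsto_u_zpow (-1)
  simp only [zpow_neg, zpow_one] at hui
  exact (h.locBddTendsto_exp.mul hw').mul ((h2.mul h.locBddTendsto_deriv).sub
    (hds.mul ((hs.mul hui).add (h.locBddTendsto_u.mul hsi))))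

theorem locBddTendsto_jetQuadratic : LocBddTendsto
      (fun i x => 2 * Real.exp (logLift (φ i) x) * w x * u i (x 0))
      (fun x => 2 * Real.exp (logLift φ' x) * w x * u' (x 0)) ∧
    LocBddTendsto (fun i x => 2 * Real.exp (logLift (φ i) x) * w x * (u i (x 0))⁻¹)
      (fun x => 2 * Real.exp (logLift φ' x) * w x * (u' (x 0))⁻¹) := by
  have h2 : LocBddTendsto (fun _ _ => (2 : ℝ)) fun _ => 2 := locBddTendsto_const continuousOn_const
  have hEw := (h2.mul h.locBddTendsto_exp).mul (locBddTendsto_const hw.continuous.continuousOn)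
  have hui := h.locBddTendsto_u_zpow (-1)
  simp only [zpow_neg, zpow_one] at hui
  exact ⟨hEw.mul h.locBddTendsto_u, hEw.mul hui⟩

variable {P : Fin 3 → Coord → ℝ} (hP : ∀ k, IsLocalWeakLimit (fun i => pd k (logLift (φ i))) (P k))
include hP

theorem integrableOn_jetDensity {K : Set Coord} (hK : K ⊆ polarDomain) (hKc : IsCompact K) :
    IntegrableOn (fun x => jetDensity (u' (x 0)) (deriv u' (x 0)) (Real.exp (logLift φ' x))
      (P 0 x) (P 1 x) (w x) (pd 0 w x) (stdRadius (x 0)) (deriv stdRadius (x 0))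
      (deriv (deriv stdRadius) (x 0))) K := by
  refine ((((h.locBddTendsto_jetConst hw).integrableOn hK hKc).add
    ((h.locBddTendsto_jetLinear hw).integrableOn_mul hK hKc (hP 0))).sub
    ((h.locBddTendsto_jetQuadratic hw).1.integrableOn_mul_sq hK hKc (hP 0))).sub
    ((h.locBddTendsto_jetQuadratic hw).2.integrableOn_mul_sq hK hKc (hP 1)) |>.congr_fun
    (fun x hx => ?_) hKc.measurableSet
  rw [jetDensity_eq (h.u'_pos (hK hx)).ne']
  rfl

/-- Upper semicontinuity: the subtracted quadratic terms are replaced by convergent lower bounds `L`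
and `M`, so the approximants dominate the integrals of the smooth pairs, which satisfy the estimate
uniformly. -/
theorem integral_jetDensity_ge {W ε : ℝ} (hw0 : ∀ x, 0 ≤ w x) (hW : ∀ x, w x ≤ W)
    (hε : ε ∈ Ioo (0 : ℝ) 1) :
    -(8 * Real.pi ^ 2 * (Real.exp C * W * (Real.pi ^ 2 / 2) * ε)) ≤
      ∫ x in boxEps ε, jetDensity (u' (x 0)) (deriv u' (x 0)) (Real.exp (logLift φ' x))
        (P 0 x) (P 1 x) (w x) (pd 0 w x) (stdRadius (x 0)) (deriv stdRadius (x 0))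
        (deriv (deriv stdRadius) (x 0)) := by
  have hK := boxEps_subset hε.1
  have hKc := isCompact_boxEps ε
  have hKm := hKc.measurableSet
  set K := boxEps ε
  have hβ := h.locBddTendsto_jetConst hw
  have hγ := h.locBddTendsto_jetLinear hw
  obtain ⟨hκ, hμ⟩ := h.locBddTendsto_jetQuadratic hw
  have hPc : ∀ k i, Continuous (pd k (logLift (φ i))) := fun k i =>
    (contDiff_pd (h.bounds i).smoothPair.ψ_smooth k).continuous
  have hEw : ∀ i x, 0 ≤ 2 * Real.exp (logLift (φ i) x) * w x := fun i x =>
    mul_nonneg (by positivity) (hw0 x)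
  obtain ⟨L, hL, hL'⟩ := hκ.exists_tendsto_le_integral_sq hK hKc (hP 0) (hPc 0) fun i x hx =>
    mul_nonneg (hEw i x) ((h.bounds i).u_pos _ (hK hx)).le
  obtain ⟨M, hM, hM'⟩ := hμ.exists_tendsto_le_integral_sq hK hKc (hP 1) (hPc 1) fun i x hx =>
    mul_nonneg (hEw i x) (inv_nonneg.2 ((h.bounds i).u_pos _ (hK hx)).le)
  have hlim := (((hβ.tendsto_integral hK hKc).add
    (hγ.tendsto_integral_mul hK hKc (hP 0))).sub hL').sub hM'
  have e : ∀ x ∈ K, jetDensity (u' (x 0)) (deriv u' (x 0)) (Real.exp (logLift φ' x))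
      (P 0 x) (P 1 x) (w x) (pd 0 w x) (stdRadius (x 0)) (deriv stdRadius (x 0))
      (deriv (deriv stdRadius) (x 0)) = _ := fun x hx => jetDensity_eq (h.u'_pos (hK hx)).ne' ..
  rw [setIntegral_congr_fun hKm e, integral_add_sub_sub (hβ.integrableOn hK hKc)
    (hγ.integrableOn_mul hK hKc (hP 0)) (hκ.integrableOn_mul_sq hK hKc (hP 0))
    (hμ.integrableOn_mul_sq hK hKc (hP 1))]
  refine ge_of_tendsto hlim (Eventually.of_forall fun i => ?_)
  have hint : ∀ {γ : ℕ → Coord → ℝ} {γ' : Coord → ℝ}, LocBddTendsto γ γ' → IntegrableOn (γ i) K :=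
    fun hγ => memLp_one_iff_integrable.1 (hγ.memLp_apply hK hKc 1 i)
  have hPsq : ∀ k, Continuous fun x => pd k (logLift (φ i)) x ^ 2 := fun k => (hPc k i).pow 2
  have i1 := hint hβ
  have i2 := (hint hγ).mul_continuousOn (hPc 0 i).continuousOn hKc
  have i3 := (hint hκ).mul_continuousOn (hPsq 0).continuousOn hKc
  have i4 := (hint hμ).mul_continuousOn (hPsq 1).continuousOn hKc
  have ei : ∀ x ∈ K, jetDensity (u i (x 0)) (deriv (u i) (x 0)) (Real.exp (logLift (φ i) x))
      (pd 0 (logLift (φ i)) x) (pd 1 (logLift (φ i)) x) (w x) (pd 0 w x) (stdRadius (x 0))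
      (deriv stdRadius (x 0)) (deriv (deriv stdRadius) (x 0)) = _ := fun x hx =>
    jetDensity_eq ((h.bounds i).u_pos _ (hK hx)).ne' ..
  have key := (h.bounds i).integral_jetDensity_ge hw hw0 hW hε
    ((((i1.add i2).sub i3).sub i4).congr_fun (fun x hx => (ei x hx).symm) hKm)
  rw [setIntegral_congr_fun hKm ei, integral_add_sub_sub i1 i2 i3 i4] at key
  have := hL i
  have := hM i
  linarith

omit hw hP in
-- A weakly convergent gradient requires a further subsequence, which leaves u', φ' and hence the
-- metric unchanged. The one bound -Nε on the integrals over M_ε serves both the exhaustion limit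
-- and the absolutely convergent integral.
theorem nonnegDistributionalScalar :
    NonnegDistributionalScalar (warpedMetric u' φ') := by
  obtain ⟨σ, hσ, P, hP2, hP⟩ := h.exists_weak_gradient
  have h' := h.comp hσ
  have hae : ∀ v : S2 × Circle → ℝ, ContMDiff ((𝓡 2).prod (𝓡 1)) 𝓘(ℝ, ℝ) ∞ v →
      ∀ K ⊆ polarDomain, ∀ᵐ x ∂volume.restrict K, _ := fun v hv K hK =>
    ae_restrict_of_ae_restrict_of_subset hK (h'.ae_integrand_eq hP hP2 hv)
  have hge : ∀ v : S2 × Circle → ℝ, ContMDiff ((𝓡 2).prod (𝓡 1)) 𝓘(ℝ, ℝ) ∞ v →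
      (∀ p, 0 ≤ v p) → ∃ N, ∀ ε ∈ Ioo (0 : ℝ) 1,
        -(N * ε) ≤ ∫ x in boxEps ε, integrand (warpedMetric u' φ') v x := by
    intro v hv hv0
    obtain ⟨W, hW⟩ := isCompact_univ.exists_bound_of_continuousOn hv.continuous.continuousOn
    refine ⟨8 * Real.pi ^ 2 * (Real.exp C * W * (Real.pi ^ 2 / 2)), fun ε hε => ?_⟩
    rw [integral_congr_ae (hae v hv _ (boxEps_subset hε.1))]
    refine le_trans (le_of_eq (by ring)) (h'.integral_jetDensity_ge (contDiff_comp_polar hv) hP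
      (fun x => hv0 _) (fun x => (le_abs_self _).trans (hW (polar x) (mem_univ _))) hε)
  refine ⟨h'.isLeeLeFlochMetric hP, fun v hv ε hε => ?_, fun v hv hv0 => ?_,
    fun v hv hv0 hint => ?_⟩
  · have hK := boxEps_subset hε.1
    exact Integrable.congr (h'.integrableOn_jetDensity (contDiff_comp_polar hv) hP hK
      (isCompact_boxEps ε)) ((hae v hv _ hK).mono fun x hx => hx.symm)
  · obtain ⟨N, hN⟩ := hge v hv hv0
    exact pairing_nonneg_of_le hN
  · obtain ⟨N, hN⟩ := hge v hv hv0
    exact integral_nonneg_of_le hint hN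

end IsBoundedLimit

end

end WarpedLL

theorem theorem1p5 (V₀ A₀ : ℝ) (hA₀ : 0 < A₀) (u : ℕ → ℝ → ℝ) (φ : ℕ → WarpedLL.S2 → ℝ)
    (hpair : ∀ i, WarpedLL.IsWarpingPair (u i) (φ i))
    (hΛ : ∀ i, WarpedLL.ConditionLambda V₀ A₀ (WarpedLL.warpedMetric (u i) (φ i))) :
    (∃ σ : ℕ → ℕ, StrictMono σ ∧ ∃ (u' : ℝ → ℝ) (φ' : WarpedLL.S2 → ℝ),
      WarpedLL.IsWarpingLimit (fun i => u (σ i)) (fun i => φ (σ i)) u' φ') ∧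
    ∀ σ : ℕ → ℕ, StrictMono σ → ∀ (u' : ℝ → ℝ) (φ' : WarpedLL.S2 → ℝ),
      WarpedLL.IsWarpingLimit (fun i => u (σ i)) (fun i => φ (σ i)) u' φ' →
      WarpedLL.NonnegDistributionalScalar (WarpedLL.warpedMetric u' φ') := by
  obtain ⟨m, hm, C, hC⟩ := WarpedLL.exists_uniformBounds V₀ A₀ hA₀
  have hb := fun i => hC _ _ (hpair i) (hΛ i)
  refine ⟨WarpedLL.exists_warpingLimit hm hb, fun σ _ u' φ' hlim => ?_⟩
  exact WarpedLL.IsBoundedLimit.nonnegDistributionalScalar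
    { hlim with m_pos := hm, bounds := fun i => hb (σ i) }
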